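/- All graphs are finite and simple, and planar graphs are considered with a fixed planar embedding. A *maximal planar graph* (MPG) is a planar graph to which no edge can be added without violating planarity. A *semi-maximal planar graph* (SMPG) $G^C$ with respect to a cycle $C$ of length at least four is a plane graph whose outer face is bounded by $C$ and all of whose other faces are triangles. Colourings are proper with colours $\{1,2,3,4\}$, and colourings that differ by a permutation of the colours are identified. A cycle is *bichromatic* under $f$ if its vertices receive exactly two colours. If $C'$ is a bichromatic cycle of $f$, the $\sigma$-operation $\sigma(f,C')$ interchanges the two colours not used on $C'$ at the vertices in the interior (or, equivalently up to a permutation of colours, in the exterior) of $C'$. The *Kempe class* $F^f(G)$ is the set of all $4$-colourings of $G$ obtained from $f$ by a finite (possibly empty) sequence of $\sigma$-operations. A plane MPG $G$ with chromatic number $4$ and minimum degree at least $4$ is a *UBCMPG with respect to a cycle $C$* if it has a $4$-colouring $f$ such that $C$ is bichromatic under every $f'\in F^f(G)$ (in particular under $f$). An SMPG $G^C$ is a *base-module* with respect to $C$ if there is an SMPG $G_1^C$ with respect to $C$ such that $G^C\cap G_1^C=C$ and $G^C\cup G_1^C$, drawn in the plane with $G^C$ and $G_1^C$ on the two sides of $C$,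 is a UBCMPG with respect to $C$; it is a *4-base-module* if $C$ has length four. Let $G^{C_4}$ be an SMPG with respect to a $4$-cycle $C_4=v_1v_2v_3v_4v_1$. A $4$-colouring $f$ of $G^{C_4}$ under which $C_4$ is bichromatic is a *shared-endpoint-colouring on $\{v_2,v_4\}$* if for neither of the two colours $i$ not used on $C_4$ there is a path from $v_1$ to $v_3$ in $G^{C_4}$ with all vertices coloured $f(v_1)$ or $i$; it is a *shared-endpoint-colouring on $\{v_1,v_3\}$* if there is such a path for each of these two colours $i$. **Theorem.** Let $G^{C_4}$ be an SMPG with respect to $C_4=v_1v_2v_3v_4v_1$ with chromatic number $4$, in which every vertex not on $C_4$ has degree at least $4$, and which has a $4$-colouring under which $C_4$ is bichromatic. Then $G^{C_4}$ is a 4-base-module if and only if there is a $4$-colouring $f_0$ of $G^{C_4}$ with $C_4$ bichromatic such that either all colourings in $F^{f_0}(G^{C_4})$ are shared-endpoint-colourings on $\{v_2,v_4\}$, or all of them are shared-endpoint-colourings on $\{v_1,v_3\}$. -/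

import Mathlib

universe u

namespace SimpleGraph

/-- A plane drawing of a finite simple graph, up to homeomorphism of the sphere: `rot` lists the
edges around every vertex in (say) clockwise order, and Euler's formula says that the faces traced
out by this rotation system close up to spheres, one for each connected component. -/
structure PlaneEmbedding {V : Type u} (G : SimpleGraph V) where
  /-- The next dart (oriented edge) around the initial vertex of a dart. -/
  rot : Equiv.Perm G.Dart
  rot_fst : ∀ d, (rot d).fst = d.fst
  rot_sameCycle : ∀ d e : G.Dart, d.fst = e.fst → rot.SameCycle d e
  /-- `#vertices + #faces = #edges + 2 * #components`. A component with an edge has one face for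
  each orbit of "next dart along the face"; an isolated vertex has one face. -/
  euler :
    Nat.card V
      + (Nat.card (Quotient (Equiv.Perm.SameCycle.setoid
            ((Function.Involutive.toPerm Dart.symm Dart.symm_involutive).trans rot)))
          + {v : V | ∀ w, ¬ G.Adj v w}.ncard)
      = G.edgeSet.ncard + 2 * Nat.card G.ConnectedComponent

/-- A finite graph is planar if it has a plane drawing. -/
def IsPlanar {V : Type u} (G : SimpleGraph V) : Prop := Nonempty G.PlaneEmbedding

/-- A maximal planar graph: no edge can be added without violating planarity. -/
def IsMaximalPlanar {V : Type u} (G : SimpleGraph V) : Prop :=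
  G.IsPlanar ∧ ∀ G' : SimpleGraph V, G < G' → ¬ G'.IsPlanar

/-- `f` uses exactly two colours on the vertices of the cycle `C`. -/
def IsBichromatic {V : Type u} {G : SimpleGraph V} (f : G.Coloring (Fin 4)) {x : V}
    (C : G.Walk x x) : Prop :=
  (f '' {v | v ∈ C.support}).ncard = 2

namespace PlaneEmbedding

variable {V : Type u} {G : SimpleGraph V}

/-- The next dart along the face on a fixed side of a dart. The faces are the orbits of this
permutation. -/
def next (P : G.PlaneEmbedding) : Equiv.Perm G.Dart :=
  (Function.Involutive.toPerm Dart.symm Dart.symm_involutive).trans P.rot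

/-- `G` is a semi-maximal planar graph with respect to `C`: the outer face is bounded by the cycle
`C` of length at least four, and all other faces are triangles. The cycle `C` is listed in the
direction in which it is traversed as the boundary of the outer face. -/
structure IsSemiMaximal (P : G.PlaneEmbedding) {x : V} (C : G.Walk x x) : Prop where
  connected : G.Connected
  isCycle : C.IsCycle
  four_le_length : 4 ≤ C.length
  outer : ∀ d ∈ C.darts, P.next d ∈ C.darts
  inner : ∀ d : G.Dart, d ∉ C.darts → P.next (P.next (P.next d)) = d

/-- One step between darts without crossing the cycle `D`: either along the boundary of a face, or
across an edge not on `D` into the neighbouring face. -/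
def SideStep (P : G.PlaneEmbedding) {x : V} (D : G.Walk x x) (d e : G.Dart) : Prop :=
  e = P.next d ∨ (d.edge ∉ D.edges ∧ e = d.symm)

/-- The vertices off the cycle `D` that lie on the same side of `D` as the face of the dart `d`.
As `d` varies, these are the (vertices in the) interior and the exterior of `D`. -/
def side (P : G.PlaneEmbedding) {x : V} (D : G.Walk x x) (d : G.Dart) : Set V :=
  {v | v ∉ D.support ∧ ∃ e : G.Dart, e.fst = v ∧ Relation.ReflTransGen (P.SideStep D) d e}

/-- `g` is obtained from `f` by the `σ`-operation with respect to some bichromatic cycle `D` of `f`: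
the two colours `s`, `t` missing on `D` are interchanged at the vertices in the interior (or
exterior) of `D`. -/
def SigmaStep (P : G.PlaneEmbedding) (f g : G.Coloring (Fin 4)) : Prop :=
  ∃ (x : V) (D : G.Walk x x) (d : G.Dart) (s t : Fin 4),
    D.IsCycle ∧ IsBichromatic f D ∧ s ≠ t ∧ (∀ v ∈ D.support, f v ≠ s ∧ f v ≠ t) ∧
      (∀ v ∈ P.side D d, g v = Equiv.swap s t (f v)) ∧ ∀ v ∉ P.side D d, g v = f v

/-- `g` belongs to the Kempe class of `f`: it is obtained from `f` by finitely many
`σ`-operations, where colourings that differ by a permutation of the colours are identified. -/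
def KempeEquiv (P : G.PlaneEmbedding) : G.Coloring (Fin 4) → G.Coloring (Fin 4) → Prop :=
  Relation.ReflTransGen fun f g =>
    P.SigmaStep f g ∨ ∃ π : Equiv.Perm (Fin 4), ∀ v, g v = π (f v)

/-- `G` is an unchanged bichromatic-cycle maximal planar graph with respect to `C`. -/
structure IsUBCMPG (P : G.PlaneEmbedding) {x : V} (C : G.Walk x x) : Prop where
  isMaximalPlanar : G.IsMaximalPlanar
  chromaticNumber_eq : G.chromaticNumber = 4
  four_le_degree : ∀ v, 4 ≤ (G.neighborSet v).ncard
  isCycle : C.IsCycle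
  unchanged : ∃ f : G.Coloring (Fin 4), IsBichromatic f C ∧
    ∀ f' : G.Coloring (Fin 4), P.KempeEquiv f f' → IsBichromatic f' C

/-- The plane graph `G` is the union of the plane graphs `H` and `H₁`, embedded into it by `ι` and
`ι₁`; their intersection is the cycle `C`, which is the cycle `C₁` of `H₁`; and each inner face of
`H` (face other than the one bounded by `C`) and of `H₁` is a face of `G`. -/
structure IsGluing {V₁ W : Type u} {H : SimpleGraph V} {H₁ : SimpleGraph V₁} {G : SimpleGraph W}
    (P : H.PlaneEmbedding) (P₁ : H₁.PlaneEmbedding) (Q : G.PlaneEmbedding)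
    {x : V} {x₁ : V₁} (C : H.Walk x x) (C₁ : H₁.Walk x₁ x₁)
    (ι : H →g G) (ι₁ : H₁ →g G) : Prop where
  injective : Function.Injective ι
  injective₁ : Function.Injective ι₁
  union : (⊤ : H.Subgraph).map ι ⊔ (⊤ : H₁.Subgraph).map ι₁ = ⊤
  inter : (⊤ : H.Subgraph).map ι ⊓ (⊤ : H₁.Subgraph).map ι₁ = (C.map ι).toSubgraph
  cycle : (C₁.map ι₁).toSubgraph = (C.map ι).toSubgraph
  face : ∀ d : H.Dart, d ∉ C.darts → Q.next (ι.mapDart d) = ι.mapDart (P.next d)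
  face₁ : ∀ d : H₁.Dart, d ∉ C₁.darts → Q.next (ι₁.mapDart d) = ι₁.mapDart (P₁.next d)

/-- `H` is a base-module with respect to `C`: it is semi-maximal planar with respect to `C`, and
some other semi-maximal planar graph, glued to it along `C`, makes it into a UBCMPG with respect
to `C`. It is a 4-base-module if `C` has length four. -/
def IsBaseModule {H : SimpleGraph V} (P : H.PlaneEmbedding) {x : V} (C : H.Walk x x) : Prop :=
  P.IsSemiMaximal C ∧
    ∃ (V₁ : Type u) (_ : Finite V₁) (H₁ : SimpleGraph V₁) (P₁ : H₁.PlaneEmbedding)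
      (x₁ : V₁) (C₁ : H₁.Walk x₁ x₁)
      (W : Type u) (_ : Finite W) (G : SimpleGraph W) (Q : G.PlaneEmbedding)
      (ι : H →g G) (ι₁ : H₁ →g G),
      P₁.IsSemiMaximal C₁ ∧ IsGluing P P₁ Q C C₁ ι ι₁ ∧ Q.IsUBCMPG (C.map ι)

end PlaneEmbedding

/-- The closed walk `v₁ v₂ v₃ v₄ v₁`. -/
def fourCycle {V : Type u} {G : SimpleGraph V} {v₁ v₂ v₃ v₄ : V} (h₁₂ : G.Adj v₁ v₂)
    (h₂₃ : G.Adj v₂ v₃) (h₃₄ : G.Adj v₃ v₄) (h₄₁ : G.Adj v₄ v₁) : G.Walk v₁ v₁ :=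
  .cons h₁₂ (.cons h₂₃ (.cons h₃₄ (.cons h₄₁ .nil)))

/-- There is a path from `a` to `b` all of whose vertices have the colour of `a` or colour `i`. -/
def HasEndpointPath {V : Type u} {G : SimpleGraph V} (f : G.Coloring (Fin 4)) (a b : V)
    (i : Fin 4) : Prop :=
  ∃ p : G.Walk a b, p.IsPath ∧ ∀ w ∈ p.support, f w = f a ∨ f w = i

/-- `f` is a shared-endpoint-colouring on `{v₂, v₄}`: the colouring `f` is bichromatic on the
4-cycle and, for each of the two colours `i` missing on the cycle, there is no path from `v₁` to
`v₃` in colours `f v₁` and `i`. -/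
def IsSharedEndpoint₂₄ {V : Type u} {G : SimpleGraph V} (f : G.Coloring (Fin 4)) {v₁ v₂ v₃ v₄ : V}
    (h₁₂ : G.Adj v₁ v₂) (h₂₃ : G.Adj v₂ v₃) (h₃₄ : G.Adj v₃ v₄) (h₄₁ : G.Adj v₄ v₁) : Prop :=
  IsBichromatic f (fourCycle h₁₂ h₂₃ h₃₄ h₄₁) ∧
    ∀ i, i ≠ f v₁ → i ≠ f v₂ → ¬ HasEndpointPath f v₁ v₃ i

/-- `f` is a shared-endpoint-colouring on `{v₁, v₃}`: the colouring `f` is bichromatic on the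
4-cycle and, for each of the two colours `i` missing on the cycle, there is a path from `v₁` to
`v₃` in colours `f v₁` and `i`. -/
def IsSharedEndpoint₁₃ {V : Type u} {G : SimpleGraph V} (f : G.Coloring (Fin 4)) {v₁ v₂ v₃ v₄ : V}
    (h₁₂ : G.Adj v₁ v₂) (h₂₃ : G.Adj v₂ v₃) (h₃₄ : G.Adj v₃ v₄) (h₄₁ : G.Adj v₄ v₁) : Prop :=
  IsBichromatic f (fourCycle h₁₂ h₂₃ h₃₄ h₄₁) ∧
    ∀ i, i ≠ f v₁ → i ≠ f v₂ → HasEndpointPath f v₁ v₃ i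

end SimpleGraph

/-! The argument replaces `σ`-operations by a more flexible move, `IsSwap`: interchange colours s
and t on a set of faces across whose boundary no edge has an end coloured s or t. Every
`σ`-operation is such a swap. Conversely the boundary of a set of faces is an even edge set, so it
can be peeled off cycle by cycle, each cycle avoiding s and t; hence on a connected drawing a swap
is a composition of `σ`-operations, up to a global permutation of the colours (`IsSwap.kempeEquiv`).

Planarity enters through `exists_faceFunction`: Euler's formula, as a dimension count over the field
with two elements, makes every even edge function the boundary of a set of faces. Two facts about a
4-face v₁v₂v₃v₄ follow. Paths joining the two opposite pairs must meet
(`IsFourFace.exists_mem_support`). Dually, inside a semi-maximal graph with outer cycle coloured a,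
c, a, c, the lack of an a/b chain from v₁ to v₃ forces a c/d chain from v₂ to v₄
(`IsSemiMaximal.colourChain_of_not`).

Necessity: let F be the unchanged colouring of the glued graph and i a colour missing on the cycle.
An f(v₁)/i chain from v₁ to v₃ exists on exactly one of the two sides, since otherwise a Kempe
change breaks the cycle or two chains cross (`IsGluing.colourChain_iff_not`). Applying the
`σ`-operation along the cycle to one side only shows that the answer is the same for both missing
colours (`IsGluing.colourChain_iff_of_ne`). Kempe changes of the given side lift to the glued graph
and alter the other side only by a permutation of colours (`IsGluing.exists_kempeEquiv_lift`), so
the answer is constant on the Kempe class.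

Sufficiency: up to a quarter turn of the cycle, v₂ and v₄ are always joined in both missing colours.
Glue on a fixed cap with two adjacent new vertices, both adjacent to v₁ and v₃. In the result any
two cycle vertices coloured s or t are joined by an s/t chain, so every swap restricts to a swap of
the given side (`IsGluing.exists_kempeEquiv_of_isSwap`). The Kempe class of the capped graph
therefore restricts into that of f₀, and the cycle stays bichromatic. -/

namespace SimpleGraph

/-! ### Even edge functions modulo two. -/

variable {V : Type u} {G : SimpleGraph V}

instance Dart.instFinite [Finite V] : Finite G.Dart :=
  Finite.of_injective _ Dart.toProd_injective

open Classical in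
/-- The sum modulo two of an edge function over the darts at a vertex. -/
noncomputable def vertexSum [Fintype G.Dart] (r : G.Dart → ZMod 2) (v : V) : ZMod 2 :=
  ∑ d, if d.fst = v then r d else 0

-- Summing the vertex sums over X gives zero; an edge inside X is counted once from each end and
-- cancels, which leaves the edges of the cut. Thus an even edge set crosses every cut an even
-- number of times.
open Classical in
theorem sum_leaving_eq_zero [Fintype G.Dart] [Finite V] (r : G.Dart → ZMod 2)
    (hsymm : ∀ d, r d.symm = r d) (heven : ∀ v, vertexSum r v = 0) (X : Set V) :
    ∑ d, (if d.fst ∈ X ∧ d.snd ∉ X then r d else 0) = 0 := by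
  have := Fintype.ofFinite V
  have h1 : ∑ d, (if d.fst ∈ X then r d else 0) = 0 := by
    have : ∀ d : G.Dart, (if d.fst ∈ X then r d else 0) =
        ∑ v, if v ∈ X then (if d.fst = v then r d else 0) else 0 := by
      intro d
      rw [Finset.sum_eq_single d.fst] <;> simp +contextual
      intro b hb h h'
      exact absurd h'.symm hb
    simp_rw [this]
    rw [Finset.sum_comm]
    refine Finset.sum_eq_zero fun v _ => ?_
    split_ifs
    · exact heven v
    · simp
  have h2 : ∑ d, (if d.fst ∈ X ∧ d.snd ∈ X then r d else 0) = 0 := by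
    refine Finset.sum_involution (fun d _ => d.symm) ?_ ?_ ?_ ?_
    · intro d _
      have : (d.symm.fst ∈ X ∧ d.symm.snd ∈ X) ↔ (d.fst ∈ X ∧ d.snd ∈ X) := by
        rw [and_comm]; rfl
      simp only [this, hsymm]
      exact CharTwo.add_self_eq_zero _
    · intro d _ _
      exact d.symm_ne
    · simp
    · simp
  have h3 : ∑ d, (if d.fst ∈ X then r d else 0) =
      ∑ d, (if d.fst ∈ X ∧ d.snd ∉ X then r d else 0) +
        ∑ d, (if d.fst ∈ X ∧ d.snd ∈ X then r d else 0) := by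
    rw [← Finset.sum_add_distrib]
    refine Finset.sum_congr rfl fun d _ => ?_
    by_cases ha : d.fst ∈ X <;> by_cases hb : d.snd ∈ X <;> simp [ha, hb]
  rw [h1, h2, add_zero] at h3
  exact h3.symm

/-- An edge function that is even at each vertex and does not vanish is supported on a cycle. -/
theorem exists_isCycle_of_even [Fintype G.Dart] [Finite V] (r : G.Dart → ZMod 2)
    (hsymm : ∀ d, r d.symm = r d) (heven : ∀ v, vertexSum r v = 0) (d₀ : G.Dart)
    (hd₀ : r d₀ ≠ 0) :
    ∃ (x : V) (D : G.Walk x x), D.IsCycle ∧ d₀.edge ∈ D.edges ∧ ∀ d : G.Dart, d.edge ∈ D.edges →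
        r d ≠ 0 := by
  classical
  let R : SimpleGraph V :=
    { Adj := fun a b => ∃ d : G.Dart, d.fst = a ∧ d.snd = b ∧ r d ≠ 0
      symm := ⟨by
        rintro a b ⟨d, ha, hb, h⟩
        exact ⟨d.symm, hb, ha, by rwa [hsymm]⟩⟩
      loopless := ⟨by
        rintro a ⟨d, ha, hb, -⟩
        exact d.fst_ne_snd (ha.trans hb.symm)⟩ }
  have hRG : R ≤ G := by
    rintro a b ⟨d, rfl, rfl, -⟩
    exact d.adj
  have hadj : R.Adj d₀.fst d₀.snd := ⟨d₀, rfl, rfl, hd₀⟩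
  -- If `d₀` were a bridge of the support of `r`, it would be the only edge of the support leaving
  -- the component of its initial vertex, contradicting the parity of cuts. An edge that is not a
  -- bridge lies on a cycle.
  have hreach : (R \ fromEdgeSet {s(d₀.fst, d₀.snd)}).Reachable d₀.fst d₀.snd := by
    by_contra hn
    have := sum_leaving_eq_zero r hsymm heven
      {v | (R \ fromEdgeSet {s(d₀.fst, d₀.snd)}).Reachable d₀.fst v}
    rw [Finset.sum_eq_single d₀] at this
    · simp only [Set.mem_ofPred_eq, Reachable.refl, hn, not_false_eq_true, and_self,
          ↓reduceIte] at this
      exact hd₀ this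
    · intro d _ hd
      simp only [Set.mem_ofPred_eq, ite_eq_right_iff, and_imp]
      intro h1 h2
      by_contra hr
      by_cases he : d.edge = d₀.edge
      · rcases (dart_edge_eq_iff _ _).1 he with h | h
        · exact hd h
        · subst h; exact hn h1
      · refine h2 (h1.trans (Adj.reachable ?_))
        rw [sdiff_adj]
        refine ⟨⟨d, rfl, rfl, hr⟩, ?_⟩
        simp only [fromEdgeSet_adj, Set.mem_singleton_iff, not_and]
        intro h; exact absurd h he
    · simp
  obtain ⟨x, D, hD, hmem⟩ := adj_and_reachable_delete_edges_iff_exists_cycle.1 ⟨hadj, hreach⟩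
  refine ⟨x, D.mapLe hRG, (Walk.isCycle_mapLe hRG).2 hD, by simpa [Dart.edge] using hmem, ?_⟩
  intro d hd
  simp only [Walk.edges_mapLe_eq_edges] at hd
  obtain ⟨e, h1, h2, h3⟩ : R.Adj d.fst d.snd := Walk.adj_of_mem_edges D hd
  have : e = d := Dart.ext _ _ (Prod.ext h1 h2)
  rwa [this] at h3

namespace Walk

open Classical in
/-- The number modulo two of times that a walk uses the edge of a dart. -/
noncomputable def parity {a b : V} (p : G.Walk a b) (d : G.Dart) : ZMod 2 := p.edges.count d.edge

theorem parity_symm {a b : V} (p : G.Walk a b) (d : G.Dart) : p.parity d.symm = p.parity d := by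
  simp [parity]

theorem parity_eq_zero {a b : V} (p : G.Walk a b) (d : G.Dart) (h : d.edge ∉ p.edges) :
    p.parity d = 0 := by
  classical
  simp [parity, List.count_eq_zero_of_not_mem h]

-- A walk has odd degree only at its ends, and these contributions cancel when it is closed. So
-- closed walks give even edge functions.
open Classical in
theorem vertexSum_parity [Fintype G.Dart] {a b : V} (p : G.Walk a b) (v : V) :
    vertexSum p.parity v = (if v = a then 1 else 0) + (if v = b then 1 else 0) := by
  induction p with
  | nil => simp [vertexSum, parity, CharTwo.add_self_eq_zero]
  | @cons a c b h p ih =>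
    have hsum : vertexSum (cons h p).parity v = vertexSum p.parity v +
        ∑ d : G.Dart, (if d.fst = v ∧ d.edge = s(a, c) then 1 else 0) := by
      rw [vertexSum, vertexSum, ← Finset.sum_add_distrib]
      refine Finset.sum_congr rfl fun d _ => ?_
      simp only [parity, edges_cons, List.count_cons, beq_iff_eq, @eq_comm _ s(a, c)]
      by_cases h1 : d.fst = v <;> by_cases h2 : d.edge = s(a, c) <;> simp [h1, h2]
    have hone : ∑ d : G.Dart, (if d.fst = v ∧ d.edge = s(a, c) then (1 : ZMod 2) else 0) =
        (if v = a then 1 else 0) + (if v = c then 1 else 0) := by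
      let e : G.Dart := ⟨(a, c), h⟩
      rw [← Finset.sum_subset (Finset.subset_univ {e, e.symm}), Finset.sum_pair e.symm_ne.symm]
      · simp [e, eq_comm, Dart.edge, Dart.symm]
      · intro d _ hd
        have : d.edge ≠ s(a, c) := by
          intro h'
          rcases (dart_edge_eq_iff d e).1 h' with h | h <;> simp [h] at hd
        simp [this]
    rw [hsum, ih, hone]
    have := CharTwo.add_self_eq_zero (if v = c then (1 : ZMod 2) else 0)
    linear_combination this

end Walk

namespace PlaneEmbedding

theorem next_fst (P : G.PlaneEmbedding) (d : G.Dart) : (P.next d).fst = d.snd :=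
  P.rot_fst d.symm

theorem rot_eq_next_symm (P : G.PlaneEmbedding) (d : G.Dart) : P.rot d = P.next d.symm := by
  simp [next, Function.Involutive.toPerm]

/-- Since `rot d = next d.symm`, the value at `d.symm` equals that at `rot d`; as `rot` permutes the
darts at v, each value occurs twice. So boundaries of sets of faces are even. -/
theorem vertexSum_faceFunction [Fintype G.Dart] (P : G.PlaneEmbedding) (S : G.Dart → ZMod 2)
    (hS : ∀ d, S (P.next d) = S d) (v : V) : vertexSum (fun d => S d + S d.symm) v = 0 := by
  classical
  have : ∀ d : G.Dart, (if d.fst = v then S d + S d.symm else 0) =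
      (if d.fst = v then S d else 0) + (if (P.rot d).fst = v then S (P.rot d) else 0) := by
    intro d
    rw [P.rot_fst, P.rot_eq_next_symm, hS]
    split_ifs <;> simp
  rw [vertexSum]
  simp_rw [this]
  rw [Finset.sum_add_distrib, Equiv.sum_comp P.rot (fun d => if d.fst = v then S d else 0)]
  exact CharTwo.add_self_eq_zero _

/-- A property of darts at `v` propagates around `v`, if each step does, except possibly the one
that leads to `y`, where it holds. -/
theorem forall_fst_of_rot [Finite V] (P : G.PlaneEmbedding) (p : G.Dart → Prop) (y : G.Dart)
    (hy : p y)
    (h : ∀ d : G.Dart, d.fst = y.fst → p d → P.rot d ≠ y → p (P.rot d)) :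
    ∀ d : G.Dart, d.fst = y.fst → p d := by
  intro d hd
  obtain ⟨n, rfl⟩ := (P.rot_sameCycle y d hd.symm).exists_nat_pow_eq
  clear hd
  have : ∀ n : ℕ, ((P.rot ^ n) y).fst = y.fst ∧ p ((P.rot ^ n) y) := by
    intro n
    induction n with
    | zero => exact ⟨rfl, hy⟩
    | succ n ih =>
      rw [pow_succ', Equiv.Perm.mul_apply]
      refine ⟨(P.rot_fst _).trans ih.1, ?_⟩
      by_cases h' : P.rot ((P.rot ^ n) y) = y
      · rwa [h']
      · exact h _ ih.1 ih.2 h'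
  exact (this n).2

end PlaneEmbedding
end SimpleGraph

/-! ### Euler's formula: even edge functions bound sets of faces. -/

namespace SimpleGraph

variable {V : Type u} {G : SimpleGraph V}

theorem Connected.exists_adj_of_dart (hG : G.Connected) (d : G.Dart) (v : V) : ∃ w, G.Adj v w := by
  by_cases h : v = d.fst
  · exact ⟨d.snd, h ▸ d.adj⟩
  · obtain ⟨p⟩ := hG.preconnected v d.fst
    cases p with
    | nil => exact absurd rfl h
    | cons h' p => exact ⟨_, h'⟩

theorem Connected.eq_of_forall_adj {α : Type*} (hG : G.Connected) (f : V → α)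
    (h : ∀ a b, G.Adj a b → f a = f b) (a b : V) : f a = f b := by
  obtain ⟨p⟩ := hG.preconnected a b
  induction p with
  | nil => rfl
  | cons h' p ih => exact (h _ _ h').trans ih

theorem Connected.euler_left [Finite V] (hG : G.Connected) (d₀ : G.Dart) :
    {v : V | ∀ w, ¬ G.Adj v w}.ncard = 0 ∧ Nat.card G.ConnectedComponent = 1 := by
  constructor
  · rw [Set.ncard_eq_zero]
    ext v
    obtain ⟨w, hw⟩ := hG.exists_adj_of_dart d₀ v
    simp only [Set.mem_ofPred_eq, Set.mem_empty_iff_false, iff_false, not_forall, not_not]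
    exact ⟨w, hw⟩
  · rw [Nat.card_eq_one_iff_unique]
    have := hG.nonempty
    exact ⟨hG.preconnected.subsingleton_connectedComponent, inferInstance⟩

namespace PlaneEmbedding

/-- Turning around a vertex means crossing an edge and then advancing along a face, and neither
changes the value. -/
theorem faceFunction_rot [Finite V] {α : Type*} (P : G.PlaneEmbedding) (S : G.Dart → α)
    (hS : ∀ d, S (P.next d) = S d) (d : G.Dart) (h : ∀ e : G.Dart, e.fst = d.fst → S e.symm = S e)
    (e : G.Dart) (he : e.fst = d.fst) : S e = S d :=
  P.forall_fst_of_rot (fun e => S e = S d) d rfl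
    (fun e he h' _ => by rw [P.rot_eq_next_symm, hS, h e he, h']) e he

/-- A function on darts that is constant along faces and across edges is constant. -/
theorem faceFunction_const [Finite V] {α : Type*} (P : G.PlaneEmbedding) (hG : G.Connected)
    (S : G.Dart → α) (hS : ∀ d, S (P.next d) = S d) (h : ∀ d : G.Dart, S d.symm = S d)
    (d e : G.Dart) : S d = S e := by
  choose w hw using hG.exists_adj_of_dart d
  have key : ∀ d : G.Dart, S d = S ⟨(d.fst, w d.fst), hw _⟩ := fun d =>
    P.faceFunction_rot S hS _ (fun e _ => h e) d rfl
  rw [key d, key e]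
  refine hG.eq_of_forall_adj (fun v => S ⟨(v, w v), hw v⟩) ?_ _ _
  intro a b hab
  have h1 := key ⟨(a, b), hab⟩
  have h2 := key ⟨(b, a), hab.symm⟩
  exact h1.symm.trans ((h ⟨(a, b), hab⟩).symm.trans h2)

theorem card_face_add_card [Finite V] (P : G.PlaneEmbedding) (hG : G.Connected) (d₀ : G.Dart) :
    Nat.card V + Nat.card (Quotient (Equiv.Perm.SameCycle.setoid P.next)) =
        Nat.card G.edgeSet + 2 := by
  have h := P.euler
  obtain ⟨h1, h2⟩ := hG.euler_left d₀
  rw [h1, h2, add_zero] at h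
  exact h

/-- In a plane drawing, every even edge function is the boundary of a set of faces. -/
theorem exists_faceFunction [Finite V] [Fintype G.Dart] (P : G.PlaneEmbedding) (hG : G.Connected)
    (r : G.Dart → ZMod 2) (hsymm : ∀ d, r d.symm = r d) (heven : ∀ v, vertexSum r v = 0) :
    ∃ S : G.Dart → ZMod 2, (∀ d, S (P.next d) = S d) ∧ ∀ d, r d = S d + S d.symm := by
  classical
  rcases isEmpty_or_nonempty G.Dart with hE | ⟨⟨d₀⟩⟩
  · exact ⟨fun _ => 0, fun d => hE.elim d, fun d => hE.elim d⟩
  have := Fintype.ofFinite V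
  let Φ := Quotient (Equiv.Perm.SameCycle.setoid P.next)
  have := Fintype.ofFinite Φ
  have := Fintype.ofFinite G.edgeSet
  have hfix : Fact (Nat.Prime 2) := ⟨Nat.prime_two⟩
  let q : G.Dart → Φ := fun d => Quotient.mk _ d
  have hq : ∀ d, q (P.next d) = q d := fun d =>
    Quotient.sound (s := Equiv.Perm.SameCycle.setoid P.next) ⟨-1, by simp⟩
  have hex : ∀ e : G.edgeSet, ∃ d : G.Dart, d.edge = e := by
    rintro ⟨⟨a, b⟩, h⟩
    exact ⟨⟨(a, b), h⟩, rfl⟩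
  choose o ho using hex
  -- Incidence matrix: `M` takes a vertex function to the sum of its values at the two ends of each
  -- edge, and its transpose takes an edge function to its vertex sums, so the kernel of the
  -- transpose is the even functions.
  let M : Matrix G.edgeSet V (ZMod 2) := fun e v =>
    ∑ d : G.Dart, if d.edge = e ∧ d.fst = v then 1 else 0
  have hM : ∀ (f : V → ZMod 2) (e : G.edgeSet), M.mulVec f e = f (o e).fst + f (o e).snd := by
    intro f e
    simp only [Matrix.mulVec, dotProduct, M, Finset.sum_mul]
    rw [Finset.sum_comm]
    rw [← Finset.sum_subset (Finset.subset_univ {o e, (o e).symm}),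
      Finset.sum_pair (o e).symm_ne.symm]
    · simp [ho]
    · intro d _ hd
      have : d.edge ≠ e := by
        rw [← ho e]
        intro h'
        rcases (dart_edge_eq_iff d _).1 h' with h | h <;> simp [h] at hd
      simp [this]
  have hMT : ∀ (x : G.edgeSet → ZMod 2) (v : V),
      M.transpose.mulVec x v = vertexSum (fun d => x ⟨d.edge, d.edge_mem⟩) v := by
    intro x v
    simp only [Matrix.mulVec, dotProduct, Matrix.transpose_apply, vertexSum]
    simp only [M, Finset.sum_mul]
    rw [Finset.sum_comm]
    refine Finset.sum_congr rfl fun d _ => ?_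
    rw [Finset.sum_eq_single ⟨d.edge, d.edge_mem⟩]
    · simp
    · intro e _ he
      have : d.edge ≠ e := fun h => he (Subtype.ext h.symm)
      simp [this]
    · simp
  let B : (Φ → ZMod 2) →ₗ[ZMod 2] (G.edgeSet → ZMod 2) :=
    { toFun := fun S e => S (q (o e)) + S (q (o e).symm)
      map_add' := by intro S T; ext e; simp only [Pi.add_apply]; ring
      map_smul' := by intro c S; ext e; simp [mul_add] }
  have hB : ∀ (S : Φ → ZMod 2) (d : G.Dart),
      B S ⟨d.edge, d.edge_mem⟩ = S (q d) + S (q d.symm) := by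
    intro S d
    rcases (dart_edge_eq_iff _ _).1 (ho ⟨d.edge, d.edge_mem⟩) with h | h
    · simp [B, h]
    · simp [B, h, add_comm]
  -- Connectedness leaves only constants in the kernel of `M`, and likewise for the face functions
  -- in the kernel of `B`.
  have hkerM : Module.finrank (ZMod 2) (LinearMap.ker M.mulVecLin) ≤ 1 := by
    refine finrank_le_one ⟨fun _ => 1, ?_⟩ ?_
    · ext e
      simp [hM, CharTwo.add_self_eq_zero]
    · rintro ⟨f, hf⟩
      refine ⟨f d₀.fst, ?_⟩
      ext v
      change f d₀.fst * 1 = f v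
      rw [mul_one]
      refine hG.eq_of_forall_adj f ?_ _ _
      intro a b hab
      have := congrFun (LinearMap.mem_ker.1 hf) ⟨s(a, b), hab⟩
      rw [Matrix.mulVecLin_apply, hM] at this
      have h' := CharTwo.add_eq_zero.1 this
      rcases dart_edge_eq_mk'_iff.1 (ho ⟨s(a, b), hab⟩) with h | h
      · simpa [h] using h'
      · simpa [h] using h'.symm
  have hkerB : Module.finrank (ZMod 2) (LinearMap.ker B) ≤ 1 := by
    refine finrank_le_one ⟨fun _ => 1, ?_⟩ ?_
    · ext e
      simp [B, CharTwo.add_self_eq_zero]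
    · rintro ⟨S, hS⟩
      refine ⟨S (q d₀), ?_⟩
      ext φ
      induction φ using Quotient.inductionOn with | _ d =>
      change S (q d₀) * 1 = S (q d)
      rw [mul_one]
      refine P.faceFunction_const hG (fun d => S (q d)) (fun d => by simp only [hq]) ?_ d₀ d
      intro d
      have := congrFun (LinearMap.mem_ker.1 hS) ⟨d.edge, d.edge_mem⟩
      rw [hB] at this
      exact (CharTwo.add_eq_zero.1 this).symm
  have hle : LinearMap.range B ≤ LinearMap.ker M.transpose.mulVecLin := by
    rintro _ ⟨S, rfl⟩
    rw [LinearMap.mem_ker]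
    ext v
    rw [Matrix.mulVecLin_apply, hMT]
    simp_rw [hB]
    exact P.vertexSum_faceFunction (fun d => S (q d)) (fun d => by simp only [hq]) v
  -- With V vertices, E edges and F faces, the even functions have dimension at most E − (V − 1),
  -- which is F − 1 by Euler's formula, while the boundaries have dimension at least F − 1.
  have heq : LinearMap.range B = LinearMap.ker M.transpose.mulVecLin := by
    refine Submodule.eq_of_le_of_finrank_le hle ?_
    have h1 := B.finrank_range_add_finrank_ker
    have h2 := M.mulVecLin.finrank_range_add_finrank_ker
    have h3 := M.transpose.mulVecLin.finrank_range_add_finrank_ker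
    have h4 := M.rank_transpose
    rw [Matrix.rank, Matrix.rank] at h4
    have h5 := P.card_face_add_card hG d₀
    simp only [Module.finrank_fintype_fun_eq_card, ← Nat.card_eq_fintype_card] at h1 h2 h3
    change _ + Nat.card Φ = _ at h5
    omega
  have hmem : (fun e : G.edgeSet => r (o e)) ∈ LinearMap.ker M.transpose.mulVecLin := by
    rw [LinearMap.mem_ker]
    ext v
    rw [Matrix.mulVecLin_apply, hMT]
    rw [Pi.zero_apply, ← heven v]
    congr 1
    ext d
    rcases (dart_edge_eq_iff _ _).1 (ho ⟨d.edge, d.edge_mem⟩) with h | h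
    · simp [h]
    · simp [h, hsymm]
  rw [← heq] at hmem
  obtain ⟨S, hS⟩ := hmem
  refine ⟨fun d => S (q d), fun d => by simp only [hq], fun d => ?_⟩
  rw [← hB, hS]
  rcases (dart_edge_eq_iff _ _).1 (ho ⟨d.edge, d.edge_mem⟩) with h | h
  · simp [h]
  · simp [h, hsymm]

end PlaneEmbedding
end SimpleGraph

/-! ### Colour swaps on sets of faces versus `σ`-operations. -/

namespace SimpleGraph

variable {V : Type u} {G : SimpleGraph V}

namespace PlaneEmbedding

/-- `g` is obtained from `f` by interchanging the colours `s` and `t` on the set `S` of faces, whose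
boundary avoids these colours. -/
structure IsSwap (P : G.PlaneEmbedding) (f g : G.Coloring (Fin 4)) (s t : Fin 4)
    (S : G.Dart → Prop) : Prop where
  ne : s ≠ t
  face : ∀ d, S (P.next d) ↔ S d
  edge : ∀ d : G.Dart, f d.fst = s ∨ f d.fst = t → (S d.symm ↔ S d)
  apply_of : ∀ d : G.Dart, S d → g d.fst = Equiv.swap s t (f d.fst)
  apply_of_not : ∀ d : G.Dart, ¬ S d → g d.fst = f d.fst

/-- At a vertex coloured s or t no incident edge is on the boundary of S, so S holds at all its
darts or at none. This makes it meaningful to ask whether such a vertex is in the region. -/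
theorem iff_of_fst_eq [Finite V] (P : G.PlaneEmbedding) {f : V → Fin 4} {s t : Fin 4}
    {S : G.Dart → Prop} (hface : ∀ d, S (P.next d) ↔ S d)
    (hedge : ∀ d : G.Dart, f d.fst = s ∨ f d.fst = t → (S d.symm ↔ S d)) {d e : G.Dart}
    (h : e.fst = d.fst) (hd : f d.fst = s ∨ f d.fst = t) : S e ↔ S d := by
  refine iff_of_eq (P.faceFunction_rot S (fun d => propext (hface d)) d (fun e he => ?_) e h)
  exact propext (hedge e (he ▸ hd))

/-- The dart chosen at a vertex does not matter: for colours s and t by the preceding lemma, and for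
other colours because the transposition fixes them. The result is proper because the ends of an edge
on the boundary of S keep their colours. -/
theorem exists_isSwap [Finite V] (P : G.PlaneEmbedding) (hne : ∀ v, ∃ w, G.Adj v w)
    (f : G.Coloring (Fin 4)) {s t : Fin 4} (hst : s ≠ t) (S : G.Dart → Prop)
    (hface : ∀ d, S (P.next d) ↔ S d)
    (hedge : ∀ d : G.Dart, f d.fst = s ∨ f d.fst = t → (S d.symm ↔ S d)) :
    ∃ g : G.Coloring (Fin 4), P.IsSwap f g s t S := by
  classical
  choose w hw using hne
  let c : V → Fin 4 := fun v => if S ⟨(v, w v), hw v⟩ then Equiv.swap s t (f v) else f v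
  have hc : ∀ d : G.Dart, c d.fst = if S d then Equiv.swap s t (f d.fst) else f d.fst := by
    intro d
    by_cases hd : f d.fst = s ∨ f d.fst = t
    · simp only [c, P.iff_of_fst_eq hface hedge (d := d) (e := ⟨(d.fst, w d.fst), hw _⟩) rfl hd]
    · push Not at hd
      simp [c, Equiv.swap_apply_of_ne_of_ne hd.1 hd.2]
  refine ⟨Coloring.mk c ?_, hst, hface, hedge, ?_, ?_⟩
  · intro a b hab
    have h1 := hc ⟨(a, b), hab⟩
    have h2 := hc ⟨(b, a), hab.symm⟩
    have hf := f.valid hab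
    have hab1 := hedge ⟨(a, b), hab⟩
    have hab2 := hedge ⟨(b, a), hab.symm⟩
    simp only [Dart.symm_mk, Prod.swap_prod_mk] at h1 h2 hab1 hab2
    rw [h1, h2]
    by_cases h : S ⟨(a, b), hab⟩ ↔ S ⟨(b, a), hab.symm⟩
    · simp only [h]
      split_ifs
      · exact fun h' => hf ((Equiv.swap s t).injective h')
      · exact hf
    · have ha : ¬ (f a = s ∨ f a = t) := fun h' => h (hab1 h').symm
      have hb : ¬ (f b = s ∨ f b = t) := fun h' => h (hab2 h')
      push Not at ha hb
      simpa [Equiv.swap_apply_of_ne_of_ne ha.1 ha.2,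
          Equiv.swap_apply_of_ne_of_ne hb.1 hb.2] using hf
  · intro d hd
    change c d.fst = _
    rw [hc, if_pos hd]
  · intro d hd
    change c d.fst = _
    rw [hc, if_neg hd]

/-- Faces are finite orbits, so going forward along a face eventually goes back by one step. -/
theorem reflTransGen_sideStep_next [Finite V] (P : G.PlaneEmbedding) {x : V} (D : G.Walk x x)
    (d₀ d : G.Dart) : Relation.ReflTransGen (P.SideStep D) d₀ (P.next d) ↔
      Relation.ReflTransGen (P.SideStep D) d₀ d := by
  refine ⟨fun h => ?_, fun h => h.tail (Or.inl rfl)⟩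
  obtain ⟨n, hn⟩ := (show P.next.SameCycle (P.next d) d from ⟨-1, by simp⟩).exists_nat_pow_eq
  rw [← hn]
  clear hn
  induction n with
  | zero => exact h
  | succ n ih =>
    rw [pow_succ', Equiv.Perm.mul_apply]
    exact ih.tail (Or.inl rfl)

theorem reflTransGen_sideStep_symm (P : G.PlaneEmbedding) {x : V} (D : G.Walk x x)
    (d₀ d : G.Dart) (hd : d.edge ∉ D.edges) : Relation.ReflTransGen (P.SideStep D) d₀ d.symm ↔
      Relation.ReflTransGen (P.SideStep D) d₀ d :=
  ⟨fun h => h.tail (Or.inr ⟨by simpa using hd, by simp⟩), fun h => h.tail (Or.inr ⟨hd, rfl⟩)⟩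

theorem edge_notMem_edges {x y : V} {D : G.Walk x y} {d : G.Dart} (h : d.fst ∉ D.support) :
    d.edge ∉ D.edges := fun h' => h (Walk.fst_mem_support_of_mem_edges D h')

/-- The region is the set of darts reached without crossing D. Off D all darts at a vertex are on
the same side; on D the colours s and t do not occur, so it is harmless that `side` omits the
vertices of D. -/
theorem SigmaStep.exists_isSwap [Finite V] {P : G.PlaneEmbedding} {f g : G.Coloring (Fin 4)}
    (h : P.SigmaStep f g) : ∃ s t S, P.IsSwap f g s t S := by
  obtain ⟨x, D, d₀, s, t, -, -, hst, hD, hin, hout⟩ := h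
  have key : ∀ d e : G.Dart, e.fst = d.fst → d.fst ∉ D.support →
      (Relation.ReflTransGen (P.SideStep D) d₀ e ↔ Relation.ReflTransGen (P.SideStep D) d₀ d) := by
    intro d e he hd
    refine iff_of_eq (P.faceFunction_rot _ (fun d => propext (P.reflTransGen_sideStep_next D d₀ d))
        d
      (fun e he => propext (P.reflTransGen_sideStep_symm D d₀ e ?_)) e he)
    exact edge_notMem_edges (he ▸ hd)
  refine ⟨s, t, Relation.ReflTransGen (P.SideStep D) d₀, hst, P.reflTransGen_sideStep_next D d₀,
    fun d hd => P.reflTransGen_sideStep_symm D d₀ d fun h' => ?_, fun d hd => ?_, fun d hd => ?_⟩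
  · have := hD _ (Walk.fst_mem_support_of_mem_edges D h')
    tauto
  · by_cases hs : d.fst ∈ D.support
    · rw [hout d.fst fun h' => h'.1 hs, Equiv.swap_apply_of_ne_of_ne (hD _ hs).1 (hD _ hs).2]
    · exact hin d.fst ⟨hs, d, rfl, hd⟩
  · refine hout d.fst ?_
    rintro ⟨hs, e, he, h'⟩
    exact hd ((key d e he hs).1 h')

theorem isBichromatic_of_avoid {f : G.Coloring (Fin 4)} {x : V} {D : G.Walk x x} {s t : Fin 4}
    (hst : s ≠ t) (hD : D.IsCycle) (h : ∀ v ∈ D.support, f v ≠ s ∧ f v ≠ t) :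
    IsBichromatic f D := by
  refine le_antisymm ?_ ?_
  · have hsub : f '' {v | v ∈ D.support} ⊆ (({s, t}ᶜ : Finset (Fin 4)) : Set (Fin 4)) := by
      rintro _ ⟨v, hv, rfl⟩
      simpa [and_comm] using h v hv
    refine (Set.ncard_le_ncard hsub).trans ?_
    rw [Set.ncard_coe_finset, Finset.card_compl, Finset.card_pair hst]
    simp
  · cases D with
    | nil => exact absurd rfl hD.ne_nil
    | @cons _ y _ hxy p =>
      have : ({f x, f y} : Set (Fin 4)) ⊆ f '' {v | v ∈ (Walk.cons hxy p).support} := by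
        rintro _ (rfl | rfl)
        · exact ⟨x, by simp, rfl⟩
        · exact ⟨y, by simp, rfl⟩
      rw [← Set.ncard_pair (f.valid hxy)]
      exact Set.ncard_le_ncard this

theorem IsSwap.sigmaStep [Finite V] {P : G.PlaneEmbedding} {f g : G.Coloring (Fin 4)} {s t : Fin 4}
    {x : V} {D : G.Walk x x} {d₀ : G.Dart}
    (h : P.IsSwap f g s t (Relation.ReflTransGen (P.SideStep D) d₀)) (hne : ∀ v, ∃ w, G.Adj v w)
    (hD : D.IsCycle) (hDst : ∀ v ∈ D.support, f v ≠ s ∧ f v ≠ t) : P.SigmaStep f g := by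
  refine ⟨x, D, d₀, s, t, hD, isBichromatic_of_avoid h.ne hD hDst, h.ne, hDst, ?_, ?_⟩
  · rintro v ⟨-, d, rfl, hd⟩
    exact h.apply_of d hd
  · intro v hv
    obtain ⟨w, hw⟩ := hne v
    by_cases hd : Relation.ReflTransGen (P.SideStep D) d₀ ⟨(v, w), hw⟩
    · rw [h.apply_of _ hd]
      by_cases hs : v ∈ D.support
      · exact Equiv.swap_apply_of_ne_of_ne (hDst v hs).1 (hDst v hs).2
      · exact absurd ⟨hs, _, rfl, hd⟩ hv
    · exact h.apply_of_not _ hd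

/-- Interchanging two colours on a set of faces whose boundary avoids them is a composition of
`σ`-operations. -/
theorem IsSwap.kempeEquiv [Finite V] {P : G.PlaneEmbedding} {f g : G.Coloring (Fin 4)} {s t : Fin 4}
    {S : G.Dart → Prop} (h : P.IsSwap f g s t S) (hG : G.Connected) (hne : ∀ v, ∃ w, G.Adj v w) :
    P.KempeEquiv f g := by
  classical
  have := Fintype.ofFinite G.Dart
  -- Induction on the number of darts across which S changes.
  induction hn : (Finset.univ.filter fun d : G.Dart => ¬(S d.symm ↔ S d)).card
    using Nat.strong_induction_on generalizing S g with
  | _ n ih =>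
  by_cases h0 : ∃ d : G.Dart, ¬(S d.symm ↔ S d)
  · obtain ⟨d₀, hd₀⟩ := h0
    let r : G.Dart → ZMod 2 := fun d => (if S d then 1 else 0) + (if S d.symm then 1 else 0)
    have hr : ∀ d, r d ≠ 0 → ¬(S d.symm ↔ S d) := by
      intro d hd h'
      apply hd
      simp only [r, h']
      exact CharTwo.add_self_eq_zero _
    have hr' : r d₀ ≠ 0 := by
      simp only [r]
      by_cases h1 : S d₀ <;> by_cases h2 : S d₀.symm <;> simp_all
    -- The boundary of S is even, so it contains a cycle through the edge of `d₀`; that cycle avoids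
    -- s and t.
    obtain ⟨x, D, hD, hd₀D, hDr⟩ := exists_isCycle_of_even r (fun d => by simp [r, add_comm])
      (P.vertexSum_faceFunction (fun d => if S d then 1 else 0) (fun d => by simp only [h.face]))
          d₀ hr'
    have hjump : ∀ d : G.Dart, ¬(S d.symm ↔ S d) → f d.fst ≠ s ∧ f d.fst ≠ t := by
      intro d hd
      have := mt (h.edge d) hd
      tauto
    have hDst : ∀ v ∈ D.support, f v ≠ s ∧ f v ≠ t := by
      intro v hv
      obtain ⟨e, he, hve⟩ := (Walk.mem_support_iff_exists_mem_edges_of_not_nil hD.not_nil).1 hv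
      have heG := D.edges_subset_edgeSet he
      obtain ⟨w, rfl⟩ := Sym2.mem_iff_exists.1 hve
      exact hjump ⟨(v, w), heG⟩ (hr _ (hDr ⟨(v, w), heG⟩ he))
    set T : G.Dart → Prop := Relation.ReflTransGen (P.SideStep D) d₀ with hT
    have hTedge : ∀ d : G.Dart, d.edge ∉ D.edges → (T d.symm ↔ T d) :=
      fun d hd => P.reflTransGen_sideStep_symm D d₀ d hd
    -- D separates its two sides: D is the boundary of some U, which is constant along side steps
    -- but changes across `d₀`, an edge that D uses exactly once.
    have hTd₀ : ¬ T d₀.symm := by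
      intro hT'
      obtain ⟨U, hU, hDU⟩ := P.exists_faceFunction hG D.parity D.parity_symm fun v => by
        rw [Walk.vertexSum_parity]; exact CharTwo.add_self_eq_zero _
      have hUT : ∀ d, T d → U d = U d₀ := by
        intro d hd
        induction hd with
        | refl => rfl
        | @tail b _ _ hstep ih =>
          rcases hstep with rfl | ⟨he, rfl⟩
          · rw [hU, ih]
          · rw [← ih]
            have := hDU b
            rw [D.parity_eq_zero _ he] at this
            exact (CharTwo.add_eq_zero.1 this.symm).symm
      have h1 := hDU d₀
      rw [hUT _ hT', CharTwo.add_self_eq_zero, Walk.parity,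
        List.count_eq_one_of_mem hD.edges_nodup hd₀D] at h1
      simp at h1
    have hedge2 : ∀ d : G.Dart, f d.fst = s ∨ f d.fst = t → (T d.symm ↔ T d) := by
      intro d hd
      refine hTedge d fun hd' => ?_
      have := hDst _ (Walk.fst_mem_support_of_mem_edges D hd')
      tauto
    -- Swap first on the symmetric difference of S and T. It changes only across edges where S does,
    -- and no longer across `d₀`; the remaining swap on T is one `σ`-operation along D.
    obtain ⟨g', hg'⟩ := P.exists_isSwap hne f h.ne (fun d => ¬(S d ↔ T d))
      (fun d => by rw [h.face, hT, P.reflTransGen_sideStep_next])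
      (fun d hd => by rw [h.edge d hd, hedge2 d hd])
    have h1 : P.KempeEquiv f g' := by
      refine ih _ ?_ hg' rfl
      rw [← hn]
      refine Finset.card_lt_card ?_
      rw [Finset.ssubset_iff_of_subset]
      · refine ⟨d₀, by simpa using hd₀, ?_⟩
        have : T d₀ := Relation.ReflTransGen.refl
        simp only [Finset.mem_filter, Finset.mem_univ, true_and]
        tauto
      · intro d hd
        simp only [Finset.mem_filter, Finset.mem_univ, true_and] at hd ⊢
        by_cases he : d.edge ∈ D.edges
        · exact hr _ (hDr d he)
        · have := hTedge d he
          tauto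
    have hst' : ∀ v, (g' v = s ∨ g' v = t) ↔ (f v = s ∨ f v = t) := by
      intro v
      obtain ⟨w, hw⟩ := hne v
      by_cases hSv : ¬(S ⟨(v, w), hw⟩ ↔ T ⟨(v, w), hw⟩)
      · rw [show g' v = _ from hg'.apply_of _ hSv]
        rw [Equiv.swap_apply_eq_iff, Equiv.swap_apply_eq_iff]
        simp [or_comm]
      · rw [show g' v = _ from hg'.apply_of_not _ hSv]
    have h2 : P.IsSwap g' g s t T := by
      refine ⟨h.ne, P.reflTransGen_sideStep_next D d₀, fun d hd => hedge2 d ((hst' _).1 hd), ?_, ?_⟩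
      · intro d hd
        by_cases hS : S d
        · rw [h.apply_of d hS, hg'.apply_of_not d (by tauto)]
        · rw [h.apply_of_not d hS, hg'.apply_of d (by tauto), Equiv.swap_apply_self]
      · intro d hd
        by_cases hS : S d
        · rw [h.apply_of d hS, hg'.apply_of d (by tauto)]
        · rw [h.apply_of_not d hS, hg'.apply_of_not d (by tauto)]
    refine h1.tail (Or.inl (h2.sigmaStep hne hD fun v hv => ?_))
    have := mt (hst' v).1 (by have := hDst v hv; tauto)
    tauto
  · push Not at h0
    -- With empty boundary, S is everything or nothing: the swap is a global permutation of the
    -- colours or trivial.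
    have hconst := P.faceFunction_const hG S (fun d => propext (h.face d)) fun d => propext (h0 d)
    by_cases hS : ∃ d, S d
    · obtain ⟨d₀, hd₀⟩ := hS
      refine Relation.ReflTransGen.single (Or.inr ⟨Equiv.swap s t, fun v => ?_⟩)
      obtain ⟨w, hw⟩ := hne v
      exact h.apply_of ⟨(v, w), hw⟩ (hconst d₀ _ ▸ hd₀)
    · push Not at hS
      have : g = f := by
        ext1 v
        obtain ⟨w, hw⟩ := hne v
        exact h.apply_of_not ⟨(v, w), hw⟩ (hS _)
      rw [this]
      exact Relation.ReflTransGen.refl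

end PlaneEmbedding
end SimpleGraph

/-! ### Two-coloured chains and crossing paths in a 4-face. -/

namespace SimpleGraph

variable {V : Type u} {G : SimpleGraph V}

/-- `v` is joined to `u` by a chain of vertices coloured `a` or `b`. -/
def ColourChain (G : SimpleGraph V) (f : V → Fin 4) (a b : Fin 4) : V → V → Prop :=
  Relation.ReflTransGen fun u v => G.Adj u v ∧ (f u = a ∨ f u = b) ∧ (f v = a ∨ f v = b)

namespace ColourChain

variable {f : V → Fin 4} {a b : Fin 4} {u v w : V}

theorem colour (h : G.ColourChain f a b u v) (hu : f u = a ∨ f u = b) : f v = a ∨ f v = b := by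
  induction h with
  | refl => exact hu
  | tail _ h _ => exact h.2.2

theorem step (h : G.ColourChain f a b u v) (hu : f u = a ∨ f u = b) (hvw : G.Adj v w)
    (hw : f w = a ∨ f w = b) : G.ColourChain f a b u w :=
  h.tail ⟨hvw, h.colour hu, hw⟩

theorem symm (h : G.ColourChain f a b u v) : G.ColourChain f a b v u := by
  induction h with
  | refl => exact .refl
  | tail _ h ih => exact .head ⟨h.1.symm, h.2.2, h.2.1⟩ ih

theorem exists_walk (h : G.ColourChain f a b u v) (hu : f u = a ∨ f u = b) :
    ∃ p : G.Walk u v, ∀ x ∈ p.support, f x = a ∨ f x = b := by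
  induction h with
  | refl => exact ⟨.nil, by simpa using hu⟩
  | tail _ h ih =>
    obtain ⟨p, hp⟩ := ih
    refine ⟨p.concat h.1, fun x hx => ?_⟩
    rw [Walk.support_concat, List.mem_append] at hx
    rcases hx with hx | hx
    · exact hp x hx
    · rw [List.mem_singleton.1 hx]
      exact h.2.2

theorem of_walk (p : G.Walk u v) (hp : ∀ x ∈ p.support, f x = a ∨ f x = b) :
    G.ColourChain f a b u v := by
  induction p with
  | nil => exact .refl
  | cons h p ih =>
    simp only [Walk.support_cons, List.mem_cons, forall_eq_or_imp] at hp
    exact .head ⟨h, hp.1, hp.2 _ p.start_mem_support⟩ (ih hp.2)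

theorem congr {f' : V → Fin 4} {a' b' : Fin 4} (h : G.ColourChain f a b u v)
    (hf : ∀ x, f x = a ∨ f x = b → f' x = a' ∨ f' x = b') : G.ColourChain f' a' b' u v := by
  induction h with
  | refl => exact .refl
  | tail _ h ih => exact ih.tail ⟨h.1, hf _ h.2.1, hf _ h.2.2⟩

theorem map {W : Type*} {K : SimpleGraph W} {f : W → Fin 4} (ι : G →g K)
    (h : G.ColourChain (fun x => f (ι x)) a b u v) : K.ColourChain f a b (ι u) (ι v) := by
  induction h with
  | refl => exact .refl
  | tail _ h ih => exact ih.tail ⟨ι.map_adj h.1, h.2⟩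

end ColourChain

theorem hasEndpointPath_iff {f : G.Coloring (Fin 4)} {u v : V} {i : Fin 4} :
    HasEndpointPath f u v i ↔ G.ColourChain f (f u) i u v := by
  classical
  constructor
  · rintro ⟨p, -, hp⟩
    exact .of_walk p hp
  · intro h
    obtain ⟨p, hp⟩ := h.exists_walk (Or.inl rfl)
    exact ⟨p.bypass, p.bypass_isPath, fun x hx => hp x (p.support_bypass_subset_support hx)⟩

theorem isBichromatic_fourCycle_iff {f : G.Coloring (Fin 4)} {v₁ v₂ v₃ v₄ : V} (h₁₂ : G.Adj v₁ v₂)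
    (h₂₃ : G.Adj v₂ v₃) (h₃₄ : G.Adj v₃ v₄) (h₄₁ : G.Adj v₄ v₁) :
    IsBichromatic f (fourCycle h₁₂ h₂₃ h₃₄ h₄₁) ↔ f v₃ = f v₁ ∧ f v₄ = f v₂ := by
  have himg : f '' {v | v ∈ (fourCycle h₁₂ h₂₃ h₃₄ h₄₁).support} =
      (({f v₁, f v₂, f v₃, f v₄} : Finset (Fin 4)) : Set (Fin 4)) := by
    ext c
    simp only [fourCycle, Walk.support_cons, Walk.support_nil, List.mem_cons, List.not_mem_nil,
      or_false, Set.mem_image, Set.mem_ofPred_eq, Finset.coe_insert, Finset.coe_singleton,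
      Set.mem_insert_iff, Set.mem_singleton_iff]
    constructor
    · rintro ⟨v, rfl | rfl | rfl | rfl | rfl, rfl⟩ <;> simp
    · rintro (rfl | rfl | rfl | rfl)
      exacts [⟨v₁, by simp⟩, ⟨v₂, by simp⟩, ⟨v₃, by simp⟩, ⟨v₄, by simp⟩]
  rw [IsBichromatic, himg, Set.ncard_coe_finset]
  have a := f.valid h₁₂
  have b := f.valid h₂₃
  have c := f.valid h₃₄
  have d := f.valid h₄₁
  generalize f v₁ = c₁ at *
  generalize f v₂ = c₂ at *
  generalize f v₃ = c₃ at *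
  generalize f v₄ = c₄ at *
  clear himg
  revert c₁ c₂ c₃ c₄
  decide

namespace PlaneEmbedding

/-- The four darts of a 4-cycle bound a face. -/
structure IsFourFace (P : G.PlaneEmbedding) {v₁ v₂ v₃ v₄ : V} (h₁₂ : G.Adj v₁ v₂)
    (h₂₃ : G.Adj v₂ v₃) (h₃₄ : G.Adj v₃ v₄) (h₄₁ : G.Adj v₄ v₁) : Prop where
  ne₁₃ : v₁ ≠ v₃
  ne₂₄ : v₂ ≠ v₄
  next₁ : P.next ⟨(v₁, v₂), h₁₂⟩ = ⟨(v₂, v₃), h₂₃⟩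
  next₂ : P.next ⟨(v₂, v₃), h₂₃⟩ = ⟨(v₃, v₄), h₃₄⟩
  next₃ : P.next ⟨(v₃, v₄), h₃₄⟩ = ⟨(v₄, v₁), h₄₁⟩
  next₄ : P.next ⟨(v₄, v₁), h₄₁⟩ = ⟨(v₁, v₂), h₁₂⟩

section

variable {P : G.PlaneEmbedding} {v₁ v₂ v₃ v₄ : V} {h₁₂ : G.Adj v₁ v₂} {h₂₃ : G.Adj v₂ v₃}
  {h₃₄ : G.Adj v₃ v₄} {h₄₁ : G.Adj v₄ v₁}

theorem mem_darts_fourCycle {d : G.Dart} : d ∈ (fourCycle h₁₂ h₂₃ h₃₄ h₄₁).darts ↔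
    d = ⟨(v₁, v₂), h₁₂⟩ ∨ d = ⟨(v₂, v₃), h₂₃⟩ ∨ d = ⟨(v₃, v₄), h₃₄⟩ ∨ d = ⟨(v₄, v₁), h₄₁⟩ := by
  simp [fourCycle]

theorem isCycle_fourCycle (h₁₃ : v₁ ≠ v₃) (h₂₄ : v₂ ≠ v₄) :
    (fourCycle h₁₂ h₂₃ h₃₄ h₄₁).IsCycle := by
  have := h₁₂.ne
  have := h₂₃.ne
  have := h₃₄.ne
  have := h₄₁.ne
  rw [fourCycle, Walk.cons_isCycle_iff]
  simp [Walk.isPath_def]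
  grind

/-- `next` maps darts of the cycle to darts of the cycle, and only one of these leaves each vertex.
-/
theorem IsSemiMaximal.isFourFace (h : P.IsSemiMaximal (fourCycle h₁₂ h₂₃ h₃₄ h₄₁)) :
    P.IsFourFace h₁₂ h₂₃ h₃₄ h₄₁ := by
  have hnd := h.isCycle.support_nodup
  simp only [fourCycle, Walk.support_cons, Walk.support_nil, List.tail_cons, List.nodup_cons,
    List.mem_cons, List.not_mem_nil, or_false, not_or, not_false_eq_true, List.nodup_nil,
        and_true] at hnd
  have key : ∀ {a b c : V} (hab : G.Adj a b) (hbc : G.Adj b c),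
      ⟨(a, b), hab⟩ ∈ (fourCycle h₁₂ h₂₃ h₃₄ h₄₁).darts →
      (∀ d ∈ (fourCycle h₁₂ h₂₃ h₃₄ h₄₁).darts, d.fst = b → d = ⟨(b, c), hbc⟩) →
      P.next ⟨(a, b), hab⟩ = ⟨(b, c), hbc⟩ := fun hab hbc h1 h2 =>
    h2 _ (h.outer _ h1) (P.next_fst _)
  refine ⟨fun h' => hnd.2.1.2 h'.symm, hnd.1.2.1, ?_, ?_, ?_, ?_⟩ <;>
  · apply key
    · simp [mem_darts_fourCycle]
    · intro d hd hb
      rw [mem_darts_fourCycle] at hd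
      rcases hd with rfl | rfl | rfl | rfl <;> simp_all

end

/-- A face label that changes only across edges with both ends in A is carried along a walk avoiding
A before z; the dart found at z points back along the walk. -/
theorem exists_dart_of_walk [Finite V] {α : Type*} (P : G.PlaneEmbedding) (S : G.Dart → α)
    (hS : ∀ d, S (P.next d) = S d) (A : Set V) (hA : ∀ d : G.Dart, d.fst ∉ A → S d.symm = S d)
    {u z : V} (q : G.Walk u z) (huz : u ≠ z) (hq : ∀ x ∈ q.support, x ≠ z → x ∉ A) (α : α)
    (hu : ∀ e : G.Dart, e.fst = u → S e = α) :
    ∃ e : G.Dart, e.fst = z ∧ e.snd ∈ q.support ∧ e.snd ≠ z ∧ S e = α := by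
  induction q with
  | nil => exact absurd rfl huz
  | @cons u w z h q ih =>
    have h1 : S (⟨(u, w), h⟩ : G.Dart).symm = α := by
      rw [hA _ (hq u (by simp) huz)]
      exact hu _ rfl
    by_cases hw : w = z
    · exact ⟨_, hw, by simp [Dart.symm], huz, h1⟩
    · obtain ⟨e, he1, he2, he3⟩ := ih hw (fun x hx => hq x (by simp [hx])) fun e he => by
        rw [← h1]
        refine P.faceFunction_rot S hS _ (fun e he => hA e ?_) e he
        rw [he]
        exact hq w (by simp) hw
      exact ⟨e, he1, by simp [he2], he3⟩

section

variable {P : G.PlaneEmbedding} {v₁ v₂ v₃ v₄ : V} {h₁₂ : G.Adj v₁ v₂} {h₂₃ : G.Adj v₂ v₃}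
  {h₃₄ : G.Adj v₃ v₄} {h₄₁ : G.Adj v₄ v₁}

/-- Paths joining opposite vertices of a 4-face of a plane graph intersect. -/
theorem IsFourFace.exists_mem_support [Finite V] (h : P.IsFourFace h₁₂ h₂₃ h₃₄ h₄₁)
    (hG : G.Connected) (p : G.Walk v₁ v₃) (q : G.Walk v₂ v₄) :
    ∃ x ∈ p.support, x ∈ q.support := by
  classical
  by_contra! hpq
  have := Fintype.ofFinite G.Dart
  -- Close p through v₄, with two edges of the 4-face. The closed walk c bounds a set of faces S,
  -- and q can meet c only at its end v₄.
  let c : G.Walk v₁ v₁ := p.append (.cons h₃₄ (.cons h₄₁ .nil))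
  have hc : ∀ x, x ∈ c.support → x ∈ p.support ∨ x = v₄ := by
    intro x hx
    simp only [c, Walk.mem_support_append_iff, Walk.support_cons, Walk.support_nil, List.mem_cons,
      List.not_mem_nil, or_false] at hx
    rcases hx with hx | rfl | rfl | rfl
    exacts [Or.inl hx, Or.inl p.end_mem_support, Or.inr rfl, Or.inl p.start_mem_support]
  have h4p : v₄ ∉ p.support := fun h => hpq _ h q.end_mem_support
  obtain ⟨S, hS, hcS⟩ := P.exists_faceFunction hG c.parity c.parity_symm fun v => by
    rw [Walk.vertexSum_parity]; exact CharTwo.add_self_eq_zero _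
  have hzero : ∀ d : G.Dart, d.edge ∉ c.edges → S d.symm = S d := by
    intro d hd
    have := hcS d
    rw [c.parity_eq_zero _ hd] at this
    exact (CharTwo.add_eq_zero.1 this.symm).symm
  have hA : ∀ d : G.Dart, d.fst ∉ {x | x ∈ c.support} → S d.symm = S d :=
    fun d hd => hzero d (edge_notMem_edges hd)
  have hqc : ∀ x ∈ q.support, x ≠ v₄ → x ∉ {x | x ∈ c.support} := by
    intro x hx hx4 hxc
    rcases hc x hxc with h | h
    · exact hpq x h hx
    · exact hx4 h
  have hout3 : S ⟨(v₃, v₄), h₃₄⟩ = S ⟨(v₂, v₃), h₂₃⟩ := by rw [← h.next₂, hS]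
  have hout4 : S ⟨(v₄, v₁), h₄₁⟩ = S ⟨(v₂, v₃), h₂₃⟩ := by rw [← h.next₃, hS, hout3]
  -- The label of the 4-face, read at v₂, is transported along q to a dart at v₄.
  obtain ⟨e, he1, he2, he3, he4⟩ := P.exists_dart_of_walk S hS _ hA q h.ne₂₄ hqc
    (S ⟨(v₂, v₃), h₂₃⟩) fun e he => P.faceFunction_rot S hS _ (fun e he => hA e (by
      rw [he]; exact hqc _ q.start_mem_support h.ne₂₄)) e he
  have hpar : c.parity ⟨(v₄, v₁), h₄₁⟩ = 1 := by
    have h1 : s(v₄, v₁) ∉ p.edges := fun h' => h4p (p.fst_mem_support_of_mem_edges h')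
    have h2 : s(v₃, v₄) ≠ s(v₄, v₁) := by
      intro h'
      rw [Sym2.eq_swap, Sym2.congr_right] at h'
      exact h.ne₁₃ h'.symm
    simp [c, Walk.parity, Walk.edges_append, List.count_eq_zero_of_not_mem h1,
      Dart.edge, h2]
  have hjump : S (⟨(v₄, v₁), h₄₁⟩ : G.Dart).symm = S ⟨(v₂, v₃), h₂₃⟩ + 1 := by
    have := hcS ⟨(v₄, v₁), h₄₁⟩
    rw [hpar, hout4] at this
    rw [this, ← add_assoc, CharTwo.add_self_eq_zero, zero_add]
  have hrot : P.rot (⟨(v₃, v₄), h₃₄⟩ : G.Dart).symm = ⟨(v₄, v₁), h₄₁⟩ := by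
    rw [P.rot_eq_next_symm, Dart.symm_symm, h.next₃]
  -- At v₄ the walk c has only the edges to v₃ and v₁. Turning from v₁ round to v₃ therefore never
  -- leaves the side opposite to the 4-face, so every dart at v₄ except the one to v₁ has the
  -- opposite label, and q cannot arrive.
  have hall := P.forall_fst_of_rot
    (fun d => d = ⟨(v₄, v₁), h₄₁⟩ ∨ S d = S ⟨(v₂, v₃), h₂₃⟩ + 1) ⟨(v₄, v₁), h₄₁⟩ (Or.inl rfl) (by
      intro d hd hdp hne
      right
      rw [P.rot_eq_next_symm, hS]
      rcases hdp with rfl | hdp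
      · exact hjump
      · rw [← hdp]
        refine hzero d fun hmem => ?_
        have hedge : d.edge = s(v₃, v₄) ∨ d.edge = s(v₄, v₁) := by
          simp only [c, Walk.edges_append, Walk.edges_cons, Walk.edges_nil, List.mem_append,
            List.mem_cons, List.not_mem_nil, or_false] at hmem
          rcases hmem with h' | h'
          · exact absurd ((show d.fst = v₄ from hd) ▸ Walk.fst_mem_support_of_mem_edges p h') h4p
          · exact h'
        rcases hedge with h' | h'
        · rcases (dart_edge_eq_iff d ⟨(v₃, v₄), h₃₄⟩).1 h' with rfl | rfl
          · exact h₃₄.ne hd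
          · exact hne hrot
        · rcases (dart_edge_eq_iff d ⟨(v₄, v₁), h₄₁⟩).1 h' with rfl | rfl
          · rw [hdp] at hout4
            simp at hout4
          · exact h₄₁.ne hd.symm) e he1
  rcases hall with rfl | hall
  · exact hpq _ p.start_mem_support he2
  · rw [he4] at hall
    simp at hall

/-- The two colour pairs are disjoint, so the chains cannot share the vertex that planarity forces.
-/
theorem IsFourFace.not_colourChain [Finite V] (h : P.IsFourFace h₁₂ h₂₃ h₃₄ h₄₁)
    (hG : G.Connected) {f : V → Fin 4} {a b c d : Fin 4} (hac : a ≠ c) (had : a ≠ d) (hbc : b ≠ c)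
    (hbd : b ≠ d) (h1 : f v₁ = a) (h2 : f v₂ = c) (hp : G.ColourChain f a b v₁ v₃) :
    ¬ G.ColourChain f c d v₂ v₄ := by
  intro hq
  obtain ⟨p, hp⟩ := hp.exists_walk (Or.inl h1)
  obtain ⟨q, hq⟩ := hq.exists_walk (Or.inl h2)
  obtain ⟨x, hx, hx'⟩ := h.exists_mem_support hG p q
  have := hp x hx
  have := hq x hx'
  grind

end

end PlaneEmbedding
end SimpleGraph

/-! ### Kempe components in triangulated regions. -/

namespace SimpleGraph

variable {V : Type u} {G : SimpleGraph V}

namespace PlaneEmbedding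

/-- Some vertex of the triangular face of a dart satisfies `U`. -/
def FaceMeets (P : G.PlaneEmbedding) (U : V → Prop) (d : G.Dart) : Prop :=
  U d.fst ∨ U d.snd ∨ U (P.next d).snd

section

variable {P : G.PlaneEmbedding} {d : G.Dart} {U : V → Prop}

theorem next_next_snd (hd : P.next (P.next (P.next d)) = d) :
    (P.next (P.next d)).snd = d.fst := by
  rw [← P.next_fst, hd]

theorem adj_next_snd (hd : P.next (P.next (P.next d)) = d) : G.Adj (P.next d).snd d.fst := by
  have := (P.next (P.next d)).adj
  rwa [next_next_snd hd, P.next_fst] at this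

theorem faceMeets_next (hd : P.next (P.next (P.next d)) = d) :
    P.FaceMeets U (P.next d) ↔ P.FaceMeets U d := by
  rw [FaceMeets, FaceMeets, P.next_fst, next_next_snd hd]
  tauto

/-- The vertices of a triangle are pairwise adjacent, so if U is closed under moving to neighbours
coloured a or b, a triangle meeting U has all its vertices of these colours in U. -/
theorem faceMeets_iff_fst (hd : P.next (P.next (P.next d)) = d) {f : V → Fin 4} {a b : Fin 4}
    (hU : ∀ x y, G.Adj x y → U x → f y = a ∨ f y = b → U y) (hda : f d.fst = a ∨ f d.fst = b) :
    P.FaceMeets U d ↔ U d.fst := by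
  refine ⟨?_, Or.inl⟩
  rintro (h | h | h)
  · exact h
  · exact hU _ _ d.adj.symm h hda
  · exact hU _ _ (adj_next_snd hd) h hda

theorem faceMeets_iff_snd (hd : P.next (P.next (P.next d)) = d) {f : V → Fin 4} {a b : Fin 4}
    (hU : ∀ x y, G.Adj x y → U x → f y = a ∨ f y = b → U y) (hda : f d.snd = a ∨ f d.snd = b) :
    P.FaceMeets U d ↔ U d.snd := by
  have h3 : P.next (P.next (P.next (P.next d))) = P.next d := by rw [hd]
  rw [← faceMeets_next hd]
  have := faceMeets_iff_fst h3 hU (by rwa [P.next_fst])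
  rwa [P.next_fst] at this

end

/-- In a plane triangulation, the colours in a Kempe component can be interchanged by
`σ`-operations. -/
theorem exists_kempeEquiv_of_not_colourChain [Finite V] (P : G.PlaneEmbedding) (hG : G.Connected)
    (hne : ∀ v, ∃ w, G.Adj v w) (h3 : ∀ d, P.next (P.next (P.next d)) = d)
    (f : G.Coloring (Fin 4)) {a b : Fin 4} (hab : a ≠ b) {u v : V} (hu : f u = a)
    (hv : f v = a) (huv : ¬ G.ColourChain f a b u v) :
    ∃ g : G.Coloring (Fin 4), P.KempeEquiv f g ∧ g u = b ∧ g v = a := by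
  have hU : ∀ x y, G.Adj x y → G.ColourChain f a b u x → f y = a ∨ f y = b →
      G.ColourChain f a b u y := fun x y hxy hx hy => hx.step (Or.inl hu) hxy hy
  -- The region consists of all triangles meeting the Kempe component of u; whether a triangle at an
  -- a/b vertex belongs to it depends only on that vertex, so no edge at such a vertex is on the
  -- boundary.
  obtain ⟨g, hg⟩ := P.exists_isSwap hne f hab (P.FaceMeets (G.ColourChain f a b u))
    (fun d => faceMeets_next (h3 d)) (fun d hd => by
      rw [faceMeets_iff_fst (h3 d) hU hd, faceMeets_iff_snd (h3 d.symm) hU hd]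
      rfl)
  refine ⟨g, hg.kempeEquiv hG hne, ?_, ?_⟩
  · obtain ⟨w, hw⟩ := hne u
    have := hg.apply_of ⟨(u, w), hw⟩ (Or.inl .refl)
    rwa [show f (u, w).1 = a from hu, Equiv.swap_apply_left] at this
  · obtain ⟨w, hw⟩ := hne v
    have := hg.apply_of_not ⟨(v, w), hw⟩ (by
      rw [faceMeets_iff_fst (h3 _) hU (Or.inl hv)]
      exact huv)
    exact this.trans hv

theorem IsSemiMaximal.next_mem_iff [Finite V] {P : G.PlaneEmbedding} {x : V} {C : G.Walk x x}
    (h : P.IsSemiMaximal C) (d : G.Dart) : P.next d ∈ C.darts ↔ d ∈ C.darts := by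
  refine ⟨fun hd => ?_, h.outer d⟩
  obtain ⟨n, hn⟩ := (show P.next.SameCycle (P.next d) d from ⟨-1, by simp⟩).exists_nat_pow_eq
  rw [← hn]
  clear hn
  induction n with
  | zero => exact hd
  | succ n ih =>
    rw [pow_succ', Equiv.Perm.mul_apply]
    exact h.outer _ ih

theorem IsSemiMaximal.symm_notMem {P : G.PlaneEmbedding} {x : V} {C : G.Walk x x}
    (h : P.IsSemiMaximal C) {d : G.Dart} (hd : d ∈ C.darts) : d.symm ∉ C.darts := fun hd' =>
  d.symm_ne (List.inj_on_of_nodup_map (f := Dart.edge) h.isCycle.edges_nodup hd' hd d.edge_symm)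

section

variable {P : G.PlaneEmbedding} {v₁ v₂ v₃ v₄ : V} {h₁₂ : G.Adj v₁ v₂} {h₂₃ : G.Adj v₂ v₃}
  {h₃₄ : G.Adj v₃ v₄} {h₄₁ : G.Adj v₄ v₁}

/-- If opposite vertices of the outer 4-cycle of a semi-maximal plane graph are not joined by a
chain in two colours, the other two vertices are joined by a chain in the other two colours. -/
theorem IsSemiMaximal.colourChain_of_not [Finite V]
    (h : P.IsSemiMaximal (fourCycle h₁₂ h₂₃ h₃₄ h₄₁)) (f : G.Coloring (Fin 4)) {a b c d : Fin 4}
    (hac : a ≠ c) (hcover : ∀ x, x = a ∨ x = b ∨ x = c ∨ x = d) (hdab : d ≠ a)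
    (h1 : f v₁ = a) (h2 : f v₂ = c) (h3 : f v₃ = a)
    (hn : ¬ G.ColourChain f a b v₁ v₃) : G.ColourChain f c d v₂ v₄ := by
  classical
  have := Fintype.ofFinite G.Dart
  by_contra hX
  set C := fourCycle h₁₂ h₂₃ h₃₄ h₄₁ with hC
  have hU : ∀ x y, G.Adj x y → G.ColourChain f a b v₁ x → f y = a ∨ f y = b →
      G.ColourChain f a b v₁ y := fun x y hxy hx hy => hx.step (Or.inl h1) hxy hy
  let S : G.Dart → Prop := fun e => e ∉ C.darts ∧ P.FaceMeets (G.ColourChain f a b v₁) e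
  have hS : ∀ e, S (P.next e) ↔ S e := by
    intro e
    simp only [S, h.next_mem_iff]
    refine and_congr_right fun he => faceMeets_next (h.inner e he)
  let s : G.Dart → ZMod 2 := fun e => if S e then 1 else 0
  have hsum := sum_leaving_eq_zero (fun e => s e + s e.symm) (fun e => by simp [add_comm])
    (P.vertexSum_faceFunction s fun e => by simp only [s, hS]) {v | G.ColourChain f c d v₂ v}
  have hXc : ∀ v, G.ColourChain f c d v₂ v → f v ≠ a := by
    intro v hv hva
    rcases hv.colour (Or.inl h2) with h' | h'
    · exact hac (hva.symm.trans h')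
    · exact hdab (h'.symm.trans hva)
  -- A dart leaving that chain ends in colour a or b, so S does not change across it if both its
  -- faces are inner. On the cycle, v₂v₁ has S only on its inner side, v₂v₃ on neither side since v₃
  -- is not in the chain of v₁, and v₄ is outside the cut. One crossing is odd.
  rw [Finset.sum_eq_single ⟨(v₂, v₁), h₁₂.symm⟩] at hsum
  · have e1 : S ⟨(v₂, v₁), h₁₂.symm⟩ := by
      refine ⟨?_, Or.inr (Or.inl .refl)⟩
      exact h.symm_notMem (d := ⟨(v₁, v₂), h₁₂⟩) (by simp [C, mem_darts_fourCycle])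
    have e2 : ¬ S ⟨(v₁, v₂), h₁₂⟩ := fun h' => h'.1 (by simp [C, mem_darts_fourCycle])
    have e3 : ¬ G.ColourChain f c d v₂ v₁ := fun h' => hXc _ h' h1
    have e4 : G.ColourChain f c d v₂ v₂ := .refl
    simp [s, e1, e2, e3, e4, Dart.symm] at hsum
  · intro e _ he
    simp only [Set.mem_ofPred_eq, ite_eq_right_iff, and_imp]
    intro hfst hsnd
    suffices S e.symm ↔ S e by
      simp only [s, this]
      exact CharTwo.add_self_eq_zero _
    have hsc : f e.snd = a ∨ f e.snd = b := by
      by_contra h'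
      refine hsnd (hfst.step (Or.inl h2) e.adj ?_)
      have := hcover (f e.snd)
      tauto
    by_cases he1 : e ∈ C.darts
    · rw [hC, mem_darts_fourCycle] at he1
      rcases he1 with rfl | rfl | rfl | rfl
      · exact absurd h1 (hXc _ hfst)
      · refine iff_of_false ?_ fun h' => h'.1 (by simp [C, mem_darts_fourCycle])
        rintro ⟨h', h''⟩
        exact hn ((faceMeets_iff_fst (h.inner _ h') hU (Or.inl h3)).1 h'')
      · exact absurd h3 (hXc _ hfst)
      · exact absurd hfst hX
    · by_cases he2 : e.symm ∈ C.darts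
      · rw [hC, mem_darts_fourCycle] at he2
        rcases he2 with h' | h' | h' | h' <;>
          obtain rfl := (Dart.symm_symm e).symm.trans (congrArg Dart.symm h')
        · exact absurd rfl he
        · exact absurd h3 (hXc _ hfst)
        · exact absurd hfst hX
        · exact absurd h1 (hXc _ hfst)
      · simp only [S, he1, he2, not_false_eq_true, true_and]
        rw [faceMeets_iff_snd (h.inner e he1) hU hsc, faceMeets_iff_fst (h.inner _ he2) hU hsc]
        rfl
  · simp

end

end PlaneEmbedding
end SimpleGraph

/-! ### Darts and faces of a gluing along a 4-cycle. -/

namespace SimpleGraph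

variable {V V₁ W : Type u} {H : SimpleGraph V} {H₁ : SimpleGraph V₁} {G : SimpleGraph W}

theorem Walk.exists_dart_of_mem_edges {V : Type*} {G : SimpleGraph V} {a b : V} {p : G.Walk a b}
    {d : G.Dart} (h : d.edge ∈ p.edges) : d ∈ p.darts ∨ d.symm ∈ p.darts := by
  obtain ⟨e, he, hed⟩ := List.mem_map.1 h
  rcases (dart_edge_eq_iff e d).1 hed with rfl | rfl
  exacts [Or.inl he, Or.inr he]

theorem Walk.toSubgraph_map_adj {V W : Type*} {H : SimpleGraph V} {G : SimpleGraph W} {ι : H →g G}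
    (hι : Function.Injective ι) {a b : V} (p : H.Walk a b) (d : H.Dart) :
    (p.map ι).toSubgraph.Adj (ι d.fst) (ι d.snd) ↔ d ∈ p.darts ∨ d.symm ∈ p.darts := by
  rw [Walk.adj_toSubgraph_iff_mem_edges, Walk.edges_map,
    show s(ι d.fst, ι d.snd) = Sym2.map ι d.edge from rfl,
    List.mem_map_of_injective (Sym2.map.injective hι)]
  refine ⟨Walk.exists_dart_of_mem_edges, ?_⟩
  rintro (h | h)
  · exact List.mem_map_of_mem h
  · rw [← d.edge_symm]
    exact List.mem_map_of_mem h

theorem Hom.mapDart_injective {ι : H →g G} (hι : Function.Injective ι) :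
    Function.Injective ι.mapDart := by
  intro d e h
  have h' := congrArg Dart.toProd h
  exact Dart.ext _ _ (Function.Injective.prodMap hι hι h')

theorem Hom.mapDart_symm (ι : H →g G) (d : H.Dart) : ι.mapDart d.symm = (ι.mapDart d).symm := rfl

namespace PlaneEmbedding

variable {P : H.PlaneEmbedding} {P₁ : H₁.PlaneEmbedding} {Q : G.PlaneEmbedding}
  {v₁ v₂ v₃ v₄ : V} {h₁₂ : H.Adj v₁ v₂} {h₂₃ : H.Adj v₂ v₃} {h₃₄ : H.Adj v₃ v₄} {h₄₁ : H.Adj v₄ v₁}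
  {x₁ : V₁} {C₁ : H₁.Walk x₁ x₁} {ι : H →g G} {ι₁ : H₁ →g G}

namespace IsGluing

section

variable {x : V} {C : H.Walk x x}

theorem mem_darts_of_eq (h : IsGluing P P₁ Q C C₁ ι ι₁) {d : H.Dart} {d' : H₁.Dart}
    (hd : ι.mapDart d = ι₁.mapDart d') : d ∈ C.darts ∨ d.symm ∈ C.darts := by
  rw [← Walk.toSubgraph_map_adj h.injective, ← h.inter, Subgraph.inf_adj]
  have h1 : ι d.fst = ι₁ d'.fst := congrArg (fun e => e.fst) hd
  have h2 : ι d.snd = ι₁ d'.snd := congrArg (fun e => e.snd) hd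
  exact ⟨⟨d.fst, d.snd, d.adj, rfl, rfl⟩, ⟨d'.fst, d'.snd, d'.adj, h1.symm, h2.symm⟩⟩

theorem mem_darts_of_eq₁ (h : IsGluing P P₁ Q C C₁ ι ι₁) {d : H.Dart} {d' : H₁.Dart}
    (hd : ι.mapDart d = ι₁.mapDart d') : d' ∈ C₁.darts ∨ d'.symm ∈ C₁.darts := by
  rw [← Walk.toSubgraph_map_adj h.injective₁, h.cycle, ← h.inter, Subgraph.inf_adj]
  have h1 : ι d.fst = ι₁ d'.fst := congrArg (fun e => e.fst) hd
  have h2 : ι d.snd = ι₁ d'.snd := congrArg (fun e => e.snd) hd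
  exact ⟨⟨d.fst, d.snd, d.adj, h1, h2⟩, ⟨d'.fst, d'.snd, d'.adj, rfl, rfl⟩⟩

theorem exists_dart₁ (h : IsGluing P P₁ Q C C₁ ι ι₁) {d : H.Dart} (hd : d ∈ C.darts) :
    ∃ d' : H₁.Dart, ι.mapDart d = ι₁.mapDart d' := by
  have := (Walk.toSubgraph_map_adj h.injective C d).2 (Or.inl hd)
  rw [← h.inter, Subgraph.inf_adj] at this
  obtain ⟨a, b, hab, ha, hb⟩ := this.2
  exact ⟨⟨(a, b), hab⟩, Dart.ext _ _ (Prod.ext ha.symm hb.symm)⟩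

theorem exists_dart (h : IsGluing P P₁ Q C C₁ ι ι₁) {d' : H₁.Dart} (hd : d' ∈ C₁.darts) :
    ∃ d : H.Dart, ι.mapDart d = ι₁.mapDart d' := by
  have := (Walk.toSubgraph_map_adj h.injective₁ C₁ d').2 (Or.inl hd)
  rw [h.cycle, ← h.inter, Subgraph.inf_adj] at this
  obtain ⟨a, b, hab, ha, hb⟩ := this.1
  exact ⟨⟨(a, b), hab⟩, Dart.ext _ _ (Prod.ext ha hb)⟩

theorem exists_dart_or (h : IsGluing P P₁ Q C C₁ ι ι₁) (e : G.Dart) :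
    (∃ d, e = ι.mapDart d) ∨ ∃ d', e = ι₁.mapDart d' := by
  have : (⊤ : G.Subgraph).Adj e.fst e.snd := e.adj
  rw [← h.union, Subgraph.sup_adj] at this
  rcases this with ⟨a, b, hab, ha, hb⟩ | ⟨a, b, hab, ha, hb⟩
  · exact Or.inl ⟨⟨(a, b), hab⟩, Dart.ext _ _ (Prod.ext ha.symm hb.symm)⟩
  · exact Or.inr ⟨⟨(a, b), hab⟩, Dart.ext _ _ (Prod.ext ha.symm hb.symm)⟩

theorem mem_support_of_eq (h : IsGluing P P₁ Q C C₁ ι ι₁) {v : V} {w : V₁} (hv : ι v = ι₁ w) :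
    v ∈ C.support := by
  have : ι v ∈ (C.map ι).toSubgraph.verts := by
    rw [← h.inter, Subgraph.verts_inf]
    exact ⟨⟨v, trivial, rfl⟩, ⟨w, trivial, hv.symm⟩⟩
  rw [Walk.mem_verts_toSubgraph, Walk.support_map, List.mem_map_of_injective h.injective] at this
  exact this

theorem connected (h : IsGluing P P₁ Q C C₁ ι ι₁) (hP : H.Connected) (hP₁ : H₁.Connected) :
    G.Connected := by
  have hx : ι x ∈ ((⊤ : H.Subgraph).map ι ⊓ (⊤ : H₁.Subgraph).map ι₁).verts := by
    rw [h.inter]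
    exact (Walk.mem_verts_toSubgraph _).2 (Walk.start_mem_support _)
  rw [Subgraph.verts_inf] at hx
  obtain ⟨y, -, hy⟩ := hx.2
  rw [connected_iff_exists_forall_reachable]
  refine ⟨ι x, fun w => ?_⟩
  have hw : w ∈ (⊤ : G.Subgraph).verts := trivial
  rw [← h.union, Subgraph.verts_sup] at hw
  rcases hw with ⟨v, -, rfl⟩ | ⟨v, -, rfl⟩
  · exact (hP.preconnected x v).map ι
  · rw [← hy]
    exact (hP₁.preconnected y v).map ι₁

end

section

variable [Finite V] [Finite V₁]

/-- Otherwise the inner triangles of both pieces at this edge would be the same face of the glued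
graph; all three of its edges would be common, and the 4-cycle would contain a triangle. -/
theorem notMem_of_mem (h : IsGluing P P₁ Q (fourCycle h₁₂ h₂₃ h₃₄ h₄₁) C₁ ι ι₁)
    (hP : P.IsSemiMaximal (fourCycle h₁₂ h₂₃ h₃₄ h₄₁)) (hP₁ : P₁.IsSemiMaximal C₁)
    {d : H.Dart} {d' : H₁.Dart} (hd : ι.mapDart d = ι₁.mapDart d')
    (hdC : d ∈ (fourCycle h₁₂ h₂₃ h₃₄ h₄₁).darts) : d' ∉ C₁.darts := by
  intro hdC₁
  have hF := hP.isFourFace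
  set C := fourCycle h₁₂ h₂₃ h₃₄ h₄₁ with hC
  have n1 := hP.symm_notMem hdC
  have n1' := hP₁.symm_notMem hdC₁
  have e1 : ι.mapDart (P.next d.symm) = ι₁.mapDart (P₁.next d'.symm) := by
    rw [← h.face _ n1, ← h.face₁ _ n1', Hom.mapDart_symm, hd, Hom.mapDart_symm]
  have n2 := mt (hP.next_mem_iff _).1 n1
  have n2' := mt (hP₁.next_mem_iff _).1 n1'
  have e2 : ι.mapDart (P.next (P.next d.symm)) = ι₁.mapDart (P₁.next (P₁.next d'.symm)) := by
    rw [← h.face _ n2, ← h.face₁ _ n2', e1]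
  have n3 := mt (hP.next_mem_iff _).1 n2
  have m2 := (h.mem_darts_of_eq e1).resolve_left n2
  have m3 := (h.mem_darts_of_eq e2).resolve_left n3
  have t := next_next_snd (hP.inner _ n1)
  have t1 := P.next_fst d.symm
  have t2 := P.next_fst (P.next d.symm)
  have hmem : ∀ e : H.Dart, e ∈ C.darts → (e.fst = v₁ ∧ e.snd = v₂) ∨ (e.fst = v₂ ∧ e.snd = v₃) ∨
      (e.fst = v₃ ∧ e.snd = v₄) ∨ (e.fst = v₄ ∧ e.snd = v₁) := by
    intro e he
    rw [hC, mem_darts_fourCycle] at he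
    rcases he with rfl | rfl | rfl | rfl <;> simp
  have k1 := hmem _ hdC
  have k2 := hmem _ m2
  have k3 := hmem _ m3
  change (P.next d.symm).snd = _ ∧ (P.next d.symm).fst = _ ∨ _ at k2
  simp only [Dart.symm, Prod.fst_swap, Prod.snd_swap] at k2 k3 t t1 t2
  have i1 := hF.ne₁₃
  have i2 := hF.ne₂₄
  have i3 := h₁₂.ne
  have i4 := h₂₃.ne
  have i5 := h₃₄.ne
  have i6 := h₄₁.ne
  rw [t, t2] at k3
  rw [t1] at k2
  generalize d.fst = a at *
  generalize d.snd = b at *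
  generalize (P.next _).snd = c at *
  clear * - k1 k2 k3 i1 i2 i3 i4 i5 i6
  grind

/-- Each piece fills the outer face of the other, so a common dart is outer in exactly one of them.
Consequently every dart of the glued graph lies on an inner face of a piece, and all its faces are
triangles. -/
theorem mem_iff_notMem (h : IsGluing P P₁ Q (fourCycle h₁₂ h₂₃ h₃₄ h₄₁) C₁ ι ι₁)
    (hP : P.IsSemiMaximal (fourCycle h₁₂ h₂₃ h₃₄ h₄₁)) (hP₁ : P₁.IsSemiMaximal C₁)
    {d : H.Dart} {d' : H₁.Dart} (hd : ι.mapDart d = ι₁.mapDart d') :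
    d ∈ (fourCycle h₁₂ h₂₃ h₃₄ h₄₁).darts ↔ d' ∉ C₁.darts := by
  refine ⟨h.notMem_of_mem hP hP₁ hd, fun hd' => by_contra fun hn => ?_⟩
  have h1 := (h.mem_darts_of_eq hd).resolve_left hn
  have h2 := (h.mem_darts_of_eq₁ hd).resolve_left hd'
  exact h.notMem_of_mem hP hP₁ (by rw [Hom.mapDart_symm, hd, Hom.mapDart_symm]) h1 h2

theorem exists_inner_dart_or (h : IsGluing P P₁ Q (fourCycle h₁₂ h₂₃ h₃₄ h₄₁) C₁ ι ι₁)
    (hP : P.IsSemiMaximal (fourCycle h₁₂ h₂₃ h₃₄ h₄₁)) (hP₁ : P₁.IsSemiMaximal C₁) (e : G.Dart) :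
    (∃ d, d ∉ (fourCycle h₁₂ h₂₃ h₃₄ h₄₁).darts ∧ e = ι.mapDart d) ∨
      ∃ d', d' ∉ C₁.darts ∧ e = ι₁.mapDart d' := by
  rcases h.exists_dart_or e with ⟨d, rfl⟩ | ⟨d', rfl⟩
  · by_cases hd : d ∈ (fourCycle h₁₂ h₂₃ h₃₄ h₄₁).darts
    · obtain ⟨d', hd'⟩ := h.exists_dart₁ hd
      exact Or.inr ⟨d', (h.mem_iff_notMem hP hP₁ hd').1 hd, hd'⟩
    · exact Or.inl ⟨d, hd, rfl⟩
  · by_cases hd : d' ∈ C₁.darts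
    · obtain ⟨d, hd'⟩ := h.exists_dart hd
      exact Or.inl ⟨d, fun h' => (h.mem_iff_notMem hP hP₁ hd').1 h' hd, hd'.symm⟩
    · exact Or.inr ⟨d', hd, rfl⟩

theorem next_next_next (h : IsGluing P P₁ Q (fourCycle h₁₂ h₂₃ h₃₄ h₄₁) C₁ ι ι₁)
    (hP : P.IsSemiMaximal (fourCycle h₁₂ h₂₃ h₃₄ h₄₁)) (hP₁ : P₁.IsSemiMaximal C₁) (e : G.Dart) :
    Q.next (Q.next (Q.next e)) = e := by
  rcases h.exists_inner_dart_or hP hP₁ e with ⟨d, hd, rfl⟩ | ⟨d, hd, rfl⟩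
  · have hd1 := mt (hP.next_mem_iff _).1 hd
    have hd2 := mt (hP.next_mem_iff _).1 hd1
    rw [h.face _ hd, h.face _ hd1, h.face _ hd2, hP.inner _ hd]
  · have hd1 := mt (hP₁.next_mem_iff _).1 hd
    have hd2 := mt (hP₁.next_mem_iff _).1 hd1
    rw [h.face₁ _ hd, h.face₁ _ hd1, h.face₁ _ hd2, hP₁.inner _ hd]

/-- The other side of the cycle carries a copy of the cycle with the reverse direction. -/
theorem exists_isFourFace (h : IsGluing P P₁ Q (fourCycle h₁₂ h₂₃ h₃₄ h₄₁) C₁ ι ι₁)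
    (hP : P.IsSemiMaximal (fourCycle h₁₂ h₂₃ h₃₄ h₄₁)) (hP₁ : P₁.IsSemiMaximal C₁) :
    ∃ (w₁ w₂ w₃ w₄ : V₁) (k₁₄ : H₁.Adj w₁ w₄) (k₄₃ : H₁.Adj w₄ w₃) (k₃₂ : H₁.Adj w₃ w₂)
      (k₂₁ : H₁.Adj w₂ w₁), ι v₁ = ι₁ w₁ ∧ ι v₂ = ι₁ w₂ ∧ ι v₃ = ι₁ w₃ ∧ ι v₄ = ι₁ w₄ ∧
        P₁.IsFourFace k₁₄ k₄₃ k₃₂ k₂₁ := by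
  have hF := hP.isFourFace
  have hmem : ∀ {a b : V} (hab : H.Adj a b), (⟨(a, b), hab⟩ : H.Dart)
      ∈ (fourCycle h₁₂ h₂₃ h₃₄ h₄₁).darts →
      ∃ (w z : V₁) (k : H₁.Adj w z), ι a = ι₁ w ∧ ι b = ι₁ z ∧
        (⟨(z, w), k.symm⟩ : H₁.Dart) ∈ C₁.darts := by
    intro a b hab hd
    obtain ⟨d', hd'⟩ := h.exists_dart₁ hd
    refine ⟨d'.fst, d'.snd, d'.adj, congrArg (fun e => e.fst) hd', congrArg (fun e => e.snd) hd',
        ?_⟩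
    exact (h.mem_darts_of_eq₁ hd').resolve_left (h.notMem_of_mem hP hP₁ hd' hd)
  obtain ⟨w₁, w₂, k₁₂, e1, e2, m1⟩ := hmem h₁₂ (by simp [mem_darts_fourCycle])
  obtain ⟨w₂', w₃, k₂₃, e2', e3, m2⟩ := hmem h₂₃ (by simp [mem_darts_fourCycle])
  obtain rfl : w₂ = w₂' := h.injective₁ (e2.symm.trans e2')
  obtain ⟨w₃', w₄, k₃₄, e3', e4, m3⟩ := hmem h₃₄ (by simp [mem_darts_fourCycle])
  obtain rfl : w₃ = w₃' := h.injective₁ (e3.symm.trans e3')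
  obtain ⟨w₄', w₁', k₄₁, e4', e1', m4⟩ := hmem h₄₁ (by simp [mem_darts_fourCycle])
  obtain rfl : w₄ = w₄' := h.injective₁ (e4.symm.trans e4')
  obtain rfl : w₁ = w₁' := h.injective₁ (e1.symm.trans e1')
  have hnext : ∀ {d' : H₁.Dart} {a b : V} {w z : V₁} (k : H₁.Adj w z), d' ∈ C₁.darts →
      ι a = ι₁ w → ι b = ι₁ z → d'.snd = w →
      (∀ d ∈ (fourCycle h₁₂ h₂₃ h₃₄ h₄₁).darts, d.snd = a → d.fst = b) →
      P₁.next d' = ⟨(w, z), k⟩ := by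
    intro d' a b w z k hd' ha hb hw huniq
    have hn := hP₁.outer _ hd'
    have hfst := (P₁.next_fst d').trans hw
    obtain ⟨d, hd⟩ := h.exists_dart hn
    have hd1 : d ∉ (fourCycle h₁₂ h₂₃ h₃₄ h₄₁).darts := fun h' => h.notMem_of_mem hP hP₁ hd h' hn
    have hd2 := (h.mem_darts_of_eq hd).resolve_left hd1
    have i1 : ι d.fst = ι₁ (P₁.next d').fst := congrArg (fun e => e.fst) hd
    have i2 : ι d.snd = ι₁ (P₁.next d').snd := congrArg (fun e => e.snd) hd
    have i3 : d.fst = a := h.injective (by rw [i1, hfst, ha])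
    have i4 : d.snd = b := huniq _ hd2 i3
    refine Dart.ext _ _ (Prod.ext hfst (h.injective₁ ?_))
    rw [← i2, i4, hb]
  have n1 := hF.ne₁₃
  have n2 := hF.ne₂₄
  have n3 := h₁₂.ne
  have n4 := h₂₃.ne
  have n5 := h₃₄.ne
  have n6 := h₄₁.ne
  refine ⟨w₁, w₂, w₃, w₄, k₄₁.symm, k₃₄.symm, k₂₃.symm, k₁₂.symm, e1, e2, e3, e4, ?_, ?_, ?_, ?_,
    ?_, ?_⟩
  · rintro rfl
    exact n1 (h.injective (e1.trans e3.symm))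
  · rintro rfl
    exact n2 (h.injective (e2.trans e4.symm))
  · refine hnext _ m4 e4 e3 rfl fun d hd hda => ?_
    rw [mem_darts_fourCycle] at hd
    rcases hd with rfl | rfl | rfl | rfl <;> simp_all
  · refine hnext _ m3 e3 e2 rfl fun d hd hda => ?_
    rw [mem_darts_fourCycle] at hd
    rcases hd with rfl | rfl | rfl | rfl <;> simp_all
  · refine hnext _ m2 e2 e1 rfl fun d hd hda => ?_
    rw [mem_darts_fourCycle] at hd
    rcases hd with rfl | rfl | rfl | rfl <;> simp_all
  · refine hnext _ m1 e1 e4 rfl fun d hd hda => ?_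
    rw [mem_darts_fourCycle] at hd
    rcases hd with rfl | rfl | rfl | rfl <;> simp_all

end

end IsGluing

end PlaneEmbedding
end SimpleGraph

/-! ### Lifting Kempe changes to a gluing, and splitting its chains. -/

namespace SimpleGraph

variable {V V₁ W : Type u} {H : SimpleGraph V} {H₁ : SimpleGraph V₁} {G : SimpleGraph W}

/-- A colouring after a permutation of the colours. -/
def Coloring.permute (f : H.Coloring (Fin 4)) (π : Equiv.Perm (Fin 4)) : H.Coloring (Fin 4) :=
  Coloring.mk (fun v => π (f v)) fun hab h => f.valid hab (π.injective h)

namespace PlaneEmbedding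

/-- Invariants of a Kempe class need only be checked for swaps on sets of faces and for permutations
of the colours. -/
theorem KempeEquiv.induction {P : H.PlaneEmbedding} [Finite V]
    {p : H.Coloring (Fin 4) → Prop} {f g : H.Coloring (Fin 4)} (h : P.KempeEquiv f g) (hf : p f)
    (hswap : ∀ f g s t S, p f → P.IsSwap f g s t S → p g)
    (hperm : ∀ (f g : H.Coloring (Fin 4)) (π : Equiv.Perm (Fin 4)), p f → (∀ v, g v = π (f v)) →
        p g) :
    p g := by
  induction h with
  | refl => exact hf
  | tail _ hstep ih =>
    rcases hstep with hstep | ⟨π, hπ⟩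
    · obtain ⟨s, t, S, hS⟩ := hstep.exists_isSwap
      exact hswap _ _ s t S ih hS
    · exact hperm _ _ π ih hπ

variable {P : H.PlaneEmbedding} {P₁ : H₁.PlaneEmbedding} {Q : G.PlaneEmbedding}
  {v₁ v₂ v₃ v₄ : V} {h₁₂ : H.Adj v₁ v₂} {h₂₃ : H.Adj v₂ v₃} {h₃₄ : H.Adj v₃ v₄} {h₄₁ : H.Adj v₄ v₁}
  {x₁ : V₁} {C₁ : H₁.Walk x₁ x₁} {ι : H →g G} {ι₁ : H₁ →g G}

namespace IsGluing

section

variable [Finite V] [Finite V₁] [Finite W]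

/-- The whole second piece lies in the outer face of the first. Giving all its faces the value of S
on that outer face makes the swap there either global or absent, hence a permutation of the colours.
-/
theorem exists_isSwap_lift (h : IsGluing P P₁ Q (fourCycle h₁₂ h₂₃ h₃₄ h₄₁) C₁ ι ι₁)
    (hP : P.IsSemiMaximal (fourCycle h₁₂ h₂₃ h₃₄ h₄₁)) (hP₁ : P₁.IsSemiMaximal C₁)
    {f g : H.Coloring (Fin 4)} {s t : Fin 4} {S : H.Dart → Prop} (hS : P.IsSwap f g s t S)
    (F : G.Coloring (Fin 4)) (hF : ∀ v, F (ι v) = f v) :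
    ∃ F' : G.Coloring (Fin 4), Q.KempeEquiv F F' ∧ (∀ v, F' (ι v) = g v) ∧
      ∃ π : Equiv.Perm (Fin 4), ∀ w, F' (ι₁ w) = π (F (ι₁ w)) := by
  classical
  have hG := h.connected hP.connected hP₁.connected
  have hneG := hG.exists_adj_of_dart (ι.mapDart ⟨(v₁, v₂), h₁₂⟩)
  have hne := hP.connected.exists_adj_of_dart ⟨(v₁, v₂), h₁₂⟩
  obtain ⟨w₁, w₂, w₃, w₄, k₁₄, -⟩ := h.exists_isFourFace hP hP₁
  have hne₁ := hP₁.connected.exists_adj_of_dart ⟨(w₁, w₄), k₁₄⟩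
  have hFF := hP.isFourFace
  let o : H.Dart := ⟨(v₁, v₂), h₁₂⟩
  have ho : ∀ d ∈ (fourCycle h₁₂ h₂₃ h₃₄ h₄₁).darts, S d ↔ S o := by
    intro d hd
    rw [mem_darts_fourCycle] at hd
    rcases hd with rfl | rfl | rfl | rfl
    · rfl
    · rw [← hFF.next₁, hS.face]
    · rw [← hFF.next₂, hS.face, ← hFF.next₁, hS.face]
    · rw [← hFF.next₃, hS.face, ← hFF.next₂, hS.face, ← hFF.next₁, hS.face]
  let T : G.Dart → Prop := fun e => if h : ∃ d, e = ι.mapDart d then S h.choose else S o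
  have hT : ∀ d, T (ι.mapDart d) ↔ S d := by
    intro d
    have hex : ∃ d', ι.mapDart d = ι.mapDart d' := ⟨d, rfl⟩
    have : hex.choose = d := Hom.mapDart_injective h.injective hex.choose_spec.symm
    simp only [T, dif_pos hex, this]
  have hT₁ : ∀ d', d' ∉ C₁.darts → (T (ι₁.mapDart d') ↔ S o) := by
    intro d' hd'
    by_cases hex : ∃ d, ι₁.mapDart d' = ι.mapDart d
    · obtain ⟨d, hd⟩ := hex
      rw [hd, hT, ho _ ((h.mem_iff_notMem hP hP₁ hd.symm).2 hd')]
    · simp only [T, dif_neg hex]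
  have hTface : ∀ e, T (Q.next e) ↔ T e := by
    intro e
    rcases h.exists_inner_dart_or hP hP₁ e with ⟨d, hd, rfl⟩ | ⟨d, hd, rfl⟩
    · rw [h.face _ hd, hT, hT, hS.face]
    · rw [h.face₁ _ hd, hT₁ _ hd, hT₁ _ (mt (hP₁.next_mem_iff _).1 hd)]
  have hTedge : ∀ e : G.Dart, F e.fst = s ∨ F e.fst = t → (T e.symm ↔ T e) := by
    intro e he
    by_cases hex : ∃ d, e = ι.mapDart d
    · obtain ⟨d, rfl⟩ := hex
      rw [← Hom.mapDart_symm, hT, hT]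
      exact hS.edge d (by rwa [← hF])
    · have hex' : ¬ ∃ d, e.symm = ι.mapDart d := by
        rintro ⟨d, hd⟩
        exact hex ⟨d.symm, by rw [Hom.mapDart_symm, ← hd, Dart.symm_symm]⟩
      simp only [T, dif_neg hex, dif_neg hex']
  obtain ⟨F', hF'⟩ := Q.exists_isSwap hneG F hS.ne T hTface hTedge
  refine ⟨F', hF'.kempeEquiv hG hneG, fun v => ?_, ?_⟩
  · obtain ⟨w, hw⟩ := hne v
    by_cases hSd : S ⟨(v, w), hw⟩
    · rw [show g v = _ from hS.apply_of _ hSd, ← hF]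
      exact hF'.apply_of _ ((hT _).2 hSd)
    · rw [show g v = _ from hS.apply_of_not _ hSd, ← hF]
      exact hF'.apply_of_not _ (mt (hT _).1 hSd)
  · have key : ∀ w, F' (ι₁ w) = if S o then Equiv.swap s t (F (ι₁ w)) else F (ι₁ w) := by
      intro w
      obtain ⟨z, hz⟩ := hne₁ w
      by_cases hst : F (ι₁ w) = s ∨ F (ι₁ w) = t
      · have hTo : T (ι₁.mapDart ⟨(w, z), hz⟩) ↔ S o := by
          by_cases hd : (⟨(w, z), hz⟩ : H₁.Dart) ∈ C₁.darts
          · rw [← hTedge _ hst, ← Hom.mapDart_symm, hT₁ _ (hP₁.symm_notMem hd)]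
          · exact hT₁ _ hd
        split_ifs with hSo
        · exact hF'.apply_of _ (hTo.2 hSo)
        · exact hF'.apply_of_not _ (mt hTo.1 hSo)
      · push Not at hst
        have hfix := Equiv.swap_apply_of_ne_of_ne hst.1 hst.2
        rw [hfix, ite_self]
        by_cases hTd : T (ι₁.mapDart ⟨(w, z), hz⟩)
        · exact (hF'.apply_of _ hTd).trans hfix
        · exact hF'.apply_of_not _ hTd
    by_cases hSo : S o
    · exact ⟨Equiv.swap s t, fun w => by rw [key, if_pos hSo]⟩
    · exact ⟨1, fun w => by rw [key, if_neg hSo]; rfl⟩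

/-- Kempe equivalences on one side of the gluing lift to the glued graph, fixing the other side up
to a permutation of the colours. -/
theorem exists_kempeEquiv_lift (h : IsGluing P P₁ Q (fourCycle h₁₂ h₂₃ h₃₄ h₄₁) C₁ ι ι₁)
    (hP : P.IsSemiMaximal (fourCycle h₁₂ h₂₃ h₃₄ h₄₁)) (hP₁ : P₁.IsSemiMaximal C₁)
    {f g : H.Coloring (Fin 4)} (hfg : P.KempeEquiv f g)
    (F : G.Coloring (Fin 4)) (hF : ∀ v, F (ι v) = f v) :
    ∃ F' : G.Coloring (Fin 4), Q.KempeEquiv F F' ∧ (∀ v, F' (ι v) = g v) ∧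
      ∃ π : Equiv.Perm (Fin 4), ∀ w, F' (ι₁ w) = π (F (ι₁ w)) := by
  refine hfg.induction (p := fun g => ∃ F' : G.Coloring (Fin 4), Q.KempeEquiv F F' ∧
    (∀ v, F' (ι v) = g v) ∧ ∃ π : Equiv.Perm (Fin 4), ∀ w, F' (ι₁ w) = π (F (ι₁ w)))
    ⟨F, .refl, hF, 1, fun _ => rfl⟩ ?_ ?_
  · rintro f g s t S ⟨F', h1, h2, π, hπ⟩ hS
    obtain ⟨F'', h3, h4, π', hπ'⟩ := h.exists_isSwap_lift hP hP₁ hS F' h2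
    exact ⟨F'', h1.trans h3, h4, π' * π, fun w => by rw [hπ', hπ]; rfl⟩
  · rintro f g ρ ⟨F', h1, h2, π, hπ⟩ hρ
    refine ⟨F'.permute ρ, h1.tail (Or.inr ⟨ρ, fun _ => rfl⟩), fun v => ?_, ρ * π, fun w => ?_⟩
    · rw [hρ, ← h2]; rfl
    · exact congrArg ρ (hπ w)

/-- The `σ`-operation on the glued graph with respect to the common cycle. -/
theorem exists_kempeEquiv_swap_inl (h : IsGluing P P₁ Q (fourCycle h₁₂ h₂₃ h₃₄ h₄₁) C₁ ι ι₁)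
    (hP : P.IsSemiMaximal (fourCycle h₁₂ h₂₃ h₃₄ h₄₁)) (hP₁ : P₁.IsSemiMaximal C₁)
    (F : G.Coloring (Fin 4)) {s t : Fin 4} (hst : s ≠ t)
    (hC : ∀ v ∈ (fourCycle h₁₂ h₂₃ h₃₄ h₄₁).support, F (ι v) ≠ s ∧ F (ι v) ≠ t) :
    ∃ F' : G.Coloring (Fin 4), Q.KempeEquiv F F' ∧
      (∀ v, F' (ι v) = Equiv.swap s t (F (ι v))) ∧ ∀ w, F' (ι₁ w) = F (ι₁ w) := by
  have hG := h.connected hP.connected hP₁.connected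
  have hneG := hG.exists_adj_of_dart (ι.mapDart ⟨(v₁, v₂), h₁₂⟩)
  have hne := hP.connected.exists_adj_of_dart ⟨(v₁, v₂), h₁₂⟩
  obtain ⟨w₁, w₂, w₃, w₄, k₁₄, -⟩ := h.exists_isFourFace hP hP₁
  have hne₁ := hP₁.connected.exists_adj_of_dart ⟨(w₁, w₄), k₁₄⟩
  set C := fourCycle h₁₂ h₂₃ h₃₄ h₄₁ with hCdef
  -- The region is the set of inner faces of the first piece; its boundary is the common cycle,
  -- which avoids s and t.
  let T : G.Dart → Prop := fun e => ∃ d, d ∉ C.darts ∧ e = ι.mapDart d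
  have hT₁ : ∀ d', d' ∉ C₁.darts → ¬ T (ι₁.mapDart d') := by
    rintro d' hd' ⟨d, hd, hdd'⟩
    exact hd ((h.mem_iff_notMem hP hP₁ hdd'.symm).2 hd')
  have hTface : ∀ e, T (Q.next e) ↔ T e := by
    intro e
    rcases h.exists_inner_dart_or hP hP₁ e with ⟨d, hd, rfl⟩ | ⟨d, hd, rfl⟩
    · rw [h.face _ hd]
      exact iff_of_true ⟨_, mt (hP.next_mem_iff _).1 hd, rfl⟩ ⟨_, hd, rfl⟩
    · rw [h.face₁ _ hd]
      exact iff_of_false (hT₁ _ (mt (hP₁.next_mem_iff _).1 hd)) (hT₁ _ hd)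
  have hnotC : ∀ d : H.Dart, F (ι d.fst) = s ∨ F (ι d.fst) = t → d ∉ C.darts ∧ d.symm ∉ C.darts :=
      by
    intro d hd
    refine ⟨fun h' => ?_, fun h' => ?_⟩
    · have := hC _ (Walk.dart_fst_mem_support_of_mem_darts _ h')
      tauto
    · have := hC _ (Walk.dart_snd_mem_support_of_mem_darts _ h')
      change F (ι d.fst) ≠ s ∧ F (ι d.fst) ≠ t at this
      tauto
  have hTι : ∀ d : H.Dart, F (ι d.fst) = s ∨ F (ι d.fst) = t →
      T (ι.mapDart d) ∧ T (ι.mapDart d.symm) := fun d hd =>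
    ⟨⟨d, (hnotC d hd).1, rfl⟩, ⟨d.symm, (hnotC d hd).2, rfl⟩⟩
  have hTι₁ : ∀ d' : H₁.Dart, F (ι₁ d'.fst) = s ∨ F (ι₁ d'.fst) = t →
      ¬ T (ι₁.mapDart d') := by
    rintro d' hd' ⟨d, hd, hdd'⟩
    have h1 : ι d.fst = ι₁ d'.fst := congrArg (fun e => e.fst) hdd'.symm
    have h2 := hnotC d (by rwa [h1])
    have := h.mem_darts_of_eq hdd'.symm
    tauto
  have hTedge : ∀ e : G.Dart, F e.fst = s ∨ F e.fst = t → (T e.symm ↔ T e) := by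
    intro e he
    rcases h.exists_dart_or e with ⟨d, rfl⟩ | ⟨d', rfl⟩
    · have := hTι d he
      exact iff_of_true this.2 this.1
    · refine iff_of_false ?_ (hTι₁ d' he)
      rintro ⟨d, hd, hdd'⟩
      have hdd : ι.mapDart d.symm = ι₁.mapDart d' := by
        rw [Hom.mapDart_symm, ← hdd', Dart.symm_symm]
      have h1 : ι d.symm.fst = ι₁ d'.fst := congrArg (fun e => e.fst) hdd
      refine hTι₁ d' he (hdd ▸ (hTι d.symm ?_).1)
      rw [h1]
      exact he
  obtain ⟨F', hF'⟩ := Q.exists_isSwap hneG F hst T hTface hTedge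
  refine ⟨F', hF'.kempeEquiv hG hneG, fun v => ?_, fun w => ?_⟩
  · obtain ⟨w, hw⟩ := hne v
    by_cases hc : F (ι v) = s ∨ F (ι v) = t
    · exact hF'.apply_of _ (hTι ⟨(v, w), hw⟩ hc).1
    · push Not at hc
      have hfix := Equiv.swap_apply_of_ne_of_ne hc.1 hc.2
      rw [hfix]
      by_cases hTd : T (ι.mapDart ⟨(v, w), hw⟩)
      · exact (hF'.apply_of _ hTd).trans hfix
      · exact hF'.apply_of_not _ hTd
  · obtain ⟨z, hz⟩ := hne₁ w
    by_cases hc : F (ι₁ w) = s ∨ F (ι₁ w) = t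
    · exact hF'.apply_of_not _ (hTι₁ ⟨(w, z), hz⟩ hc)
    · push Not at hc
      have hfix := Equiv.swap_apply_of_ne_of_ne hc.1 hc.2
      by_cases hTd : T (ι₁.mapDart ⟨(w, z), hz⟩)
      · exact (hF'.apply_of _ hTd).trans hfix
      · exact hF'.apply_of_not _ hTd

end

/-- A chain can change piece only at a cycle vertex coloured a or b, hence at u or z. Changing at u
amounts to starting again there; a change at z means that one piece already contains a full chain.
-/
theorem colourChain_or (h : IsGluing P P₁ Q (fourCycle h₁₂ h₂₃ h₃₄ h₄₁) C₁ ι ι₁)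
    {F : W → Fin 4} {a b : Fin 4} {u z : V} {u' z' : V₁} (hu : ι u = ι₁ u') (hz : ι z = ι₁ z')
    (hshared : ∀ v ∈ (fourCycle h₁₂ h₂₃ h₃₄ h₄₁).support, F (ι v) = a ∨ F (ι v) = b → v = u ∨ v = z)
    (hc : G.ColourChain F a b (ι u) (ι z)) :
    H.ColourChain (fun v => F (ι v)) a b u z ∨ H₁.ColourChain (fun w => F (ι₁ w)) a b u' z' := by
  have key : ∀ y, G.ColourChain F a b (ι u) y →
      (H.ColourChain (fun v => F (ι v)) a b u z ∨ H₁.ColourChain (fun w => F (ι₁ w)) a b u' z') ∨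
      (∃ v, y = ι v ∧ H.ColourChain (fun v => F (ι v)) a b u v) ∨
      ∃ w, y = ι₁ w ∧ H₁.ColourChain (fun w => F (ι₁ w)) a b u' w := by
    intro y hy
    induction hy with
    | refl => exact Or.inr (Or.inl ⟨u, rfl, .refl⟩)
    | @tail y y' _ hstep ih =>
      obtain ⟨hadj, hy, hy'⟩ := hstep
      rcases ih with ih | ih
      · exact Or.inl ih
      rcases h.exists_dart_or ⟨(y, y'), hadj⟩ with ⟨d, hd⟩ | ⟨d', hd'⟩
      · have e1 : y = ι d.fst := congrArg (fun e => e.fst) hd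
        have e2 : y' = ι d.snd := congrArg (fun e => e.snd) hd
        subst e1 e2
        have hd : H.ColourChain (fun v => F (ι v)) a b u d.fst →
            ∃ v, ι d.snd = ι v ∧ H.ColourChain (fun v => F (ι v)) a b u v :=
          fun h' => ⟨_, rfl, h'.tail ⟨d.adj, hy, hy'⟩⟩
        rcases ih with ⟨v, hv, hv'⟩ | ⟨w, hw, hw'⟩
        · rw [← h.injective hv] at hv'
          exact Or.inr (Or.inl (hd hv'))
        · rcases hshared _ (h.mem_support_of_eq hw) hy with h' | h'
          · exact Or.inr (Or.inl (hd (h' ▸ .refl)))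
          · rw [h', hz] at hw
            rw [← h.injective₁ hw] at hw'
            exact Or.inl (Or.inr hw')
      · have e1 : y = ι₁ d'.fst := congrArg (fun e => e.fst) hd'
        have e2 : y' = ι₁ d'.snd := congrArg (fun e => e.snd) hd'
        subst e1 e2
        have hd : H₁.ColourChain (fun v => F (ι₁ v)) a b u' d'.fst →
            ∃ v, ι₁ d'.snd = ι₁ v ∧ H₁.ColourChain (fun v => F (ι₁ v)) a b u' v :=
          fun h' => ⟨_, rfl, h'.tail ⟨d'.adj, hy, hy'⟩⟩
        rcases ih with ⟨v, hv, hv'⟩ | ⟨w, hw, hw'⟩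
        · rcases hshared _ (h.mem_support_of_eq hv.symm) (hv ▸ hy) with h' | h'
          · rw [h', hu] at hv
            exact Or.inr (Or.inr (hd (h.injective₁ hv ▸ .refl)))
          · exact Or.inl (Or.inl (h' ▸ hv'))
        · rw [← h.injective₁ hw] at hw'
          exact Or.inr (Or.inr (hd hw'))
  rcases key _ hc with h' | ⟨v, hv, hv'⟩ | ⟨w, hw, hw'⟩
  · exact h'
  · exact Or.inl (h.injective hv ▸ hv')
  · rw [hz] at hw
    exact Or.inr (h.injective₁ hw ▸ hw')

end IsGluing

end PlaneEmbedding
end SimpleGraph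

/-! ### Necessity: the side carrying the chains is an invariant. -/

namespace SimpleGraph

variable {V V₁ W : Type u} {H : SimpleGraph V} {H₁ : SimpleGraph V₁} {G : SimpleGraph W}

theorem isBichromatic_map_fourCycle_iff {ι : H →g G} {F : G.Coloring (Fin 4)} {v₁ v₂ v₃ v₄ : V}
    (h₁₂ : H.Adj v₁ v₂) (h₂₃ : H.Adj v₂ v₃) (h₃₄ : H.Adj v₃ v₄) (h₄₁ : H.Adj v₄ v₁) :
    IsBichromatic F ((fourCycle h₁₂ h₂₃ h₃₄ h₄₁).map ι) ↔
      F (ι v₃) = F (ι v₁) ∧ F (ι v₄) = F (ι v₂) :=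
  isBichromatic_fourCycle_iff (ι.map_adj h₁₂) (ι.map_adj h₂₃) (ι.map_adj h₃₄) (ι.map_adj h₄₁)

theorem exists_fourth_colour (a b c : Fin 4) : ∃ d, d ≠ a ∧ d ≠ b ∧ d ≠ c := by
  revert a b c
  decide

namespace PlaneEmbedding

variable {P : H.PlaneEmbedding} {P₁ : H₁.PlaneEmbedding} {Q : G.PlaneEmbedding}
  {v₁ v₂ v₃ v₄ : V} {h₁₂ : H.Adj v₁ v₂} {h₂₃ : H.Adj v₂ v₃} {h₃₄ : H.Adj v₃ v₄} {h₄₁ : H.Adj v₄ v₁}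
  {x₁ : V₁} {C₁ : H₁.Walk x₁ x₁} {ι : H →g G} {ι₁ : H₁ →g G}

theorem mem_support_fourCycle {v : V} : v ∈ (fourCycle h₁₂ h₂₃ h₃₄ h₄₁).support ↔
    v = v₁ ∨ v = v₂ ∨ v = v₃ ∨ v = v₄ := by
  simp only [fourCycle, Walk.support_cons, Walk.support_nil, List.mem_cons, List.not_mem_nil,
    or_false]
  tauto

section

variable [Finite V] [Finite V₁] [Finite W]

/-- In a gluing whose common 4-cycle stays bichromatic, opposite vertices of the cycle are joined by
a two-coloured chain on exactly one of the two sides. -/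
theorem IsGluing.colourChain_iff_not
    (h : IsGluing P P₁ Q (fourCycle h₁₂ h₂₃ h₃₄ h₄₁) C₁ ι ι₁)
    (hP : P.IsSemiMaximal (fourCycle h₁₂ h₂₃ h₃₄ h₄₁)) (hP₁ : P₁.IsSemiMaximal C₁)
    {w₁ w₂ w₃ w₄ : V₁} {k₁₄ : H₁.Adj w₁ w₄} {k₄₃ : H₁.Adj w₄ w₃} {k₃₂ : H₁.Adj w₃ w₂}
    {k₂₁ : H₁.Adj w₂ w₁} (e₁ : ι v₁ = ι₁ w₁) (e₂ : ι v₂ = ι₁ w₂) (e₃ : ι v₃ = ι₁ w₃)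
    (e₄ : ι v₄ = ι₁ w₄) (hF₁ : P₁.IsFourFace k₁₄ k₄₃ k₃₂ k₂₁) (F : G.Coloring (Fin 4))
    (hF : ∀ F' : G.Coloring (Fin 4), Q.KempeEquiv F F' →
      F' (ι v₃) = F' (ι v₁) ∧ F' (ι v₄) = F' (ι v₂))
    {c : Fin 4} (hca : c ≠ F (ι v₁)) (hcb : c ≠ F (ι v₂)) :
    H.ColourChain (fun v => F (ι v)) (F (ι v₁)) c v₁ v₃ ↔
      ¬ H₁.ColourChain (fun w => F (ι₁ w)) (F (ι v₁)) c w₁ w₃ := by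
  have hG := h.connected hP.connected hP₁.connected
  have hneG := hG.exists_adj_of_dart (ι.mapDart ⟨(v₁, v₂), h₁₂⟩)
  have h3 := h.next_next_next hP hP₁
  have hab : F (ι v₁) ≠ F (ι v₂) := F.valid (ι.map_adj h₁₂)
  obtain ⟨b1, b2⟩ := hF F .refl
  obtain ⟨d, hda, hdb, hdc⟩ := exists_fourth_colour (F (ι v₁)) (F (ι v₂)) c
  have hFF := hP.isFourFace
  constructor
  · intro hc hc₁
    -- Without this chain, a Kempe change at v₂ alone would give v₂ and v₄ different colours. The
    -- chain lies in one piece, where it crosses the given chain between v₁ and v₃.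
    have hchain : G.ColourChain F (F (ι v₂)) d (ι v₂) (ι v₄) := by
      by_contra hn
      obtain ⟨g, hg, g1, g2⟩ := Q.exists_kempeEquiv_of_not_colourChain hG hneG h3 F hdb.symm rfl b2
          hn
      exact hdb (by rw [← g1, ← g2, (hF g hg).2])
    rcases h.colourChain_or e₂ e₄ (fun v hv hvc => by
        rw [mem_support_fourCycle] at hv
        rcases hv with rfl | rfl | rfl | rfl
        · grind
        · exact Or.inl rfl
        · grind
        · exact Or.inr rfl) hchain with h' | h'
    · exact hFF.not_colourChain hP.connected hab hda.symm hcb hdc.symm rfl rfl hc h'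
    · exact hF₁.not_colourChain hP₁.connected hab hda.symm hcb hdc.symm
        (congrArg F e₁.symm) ((congrArg F e₄.symm).trans b2) hc₁ h'.symm
  · intro hn₁
    have hchain : G.ColourChain F (F (ι v₁)) c (ι v₁) (ι v₃) := by
      by_contra hn
      obtain ⟨g, hg, g1, g2⟩ := Q.exists_kempeEquiv_of_not_colourChain hG hneG h3 F hca.symm rfl b1
          hn
      exact hca (by rw [← g1, ← g2, (hF g hg).1])
    refine (h.colourChain_or e₁ e₃ (fun v hv hvc => ?_) hchain).resolve_right hn₁
    rw [mem_support_fourCycle] at hv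
    rcases hv with rfl | rfl | rfl | rfl
    · exact Or.inl rfl
    · grind
    · exact Or.inr rfl
    · grind

/-- Interchanging c and d on the first piece alone turns its c-chains into d-chains and leaves the
second piece as it is. Before and after, the first piece has a d-chain exactly when the second has
none. -/
theorem IsGluing.colourChain_iff_of_ne
    (h : IsGluing P P₁ Q (fourCycle h₁₂ h₂₃ h₃₄ h₄₁) C₁ ι ι₁)
    (hP : P.IsSemiMaximal (fourCycle h₁₂ h₂₃ h₃₄ h₄₁)) (hP₁ : P₁.IsSemiMaximal C₁)
    (F : G.Coloring (Fin 4))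
    (hF : ∀ F' : G.Coloring (Fin 4), Q.KempeEquiv F F' →
      F' (ι v₃) = F' (ι v₁) ∧ F' (ι v₄) = F' (ι v₂))
    {c d : Fin 4} (hca : c ≠ F (ι v₁)) (hcb : c ≠ F (ι v₂)) (hda : d ≠ F (ι v₁))
    (hdb : d ≠ F (ι v₂)) :
    H.ColourChain (fun v => F (ι v)) (F (ι v₁)) c v₁ v₃ ↔
      H.ColourChain (fun v => F (ι v)) (F (ι v₁)) d v₁ v₃ := by
  by_cases hcd : c = d
  · rw [hcd]
  obtain ⟨w₁, w₂, w₃, w₄, k₁₄, k₄₃, k₃₂, k₂₁, e₁, e₂, e₃, e₄, hF₁⟩ := h.exists_isFourFace hP hP₁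
  have hb := hF F .refl
  obtain ⟨F', hFF', hι, hι₁⟩ := h.exists_kempeEquiv_swap_inl hP hP₁ F hcd fun v hv => by
    rw [mem_support_fourCycle] at hv
    rcases hv with rfl | rfl | rfl | rfl
    · exact ⟨hca.symm, hda.symm⟩
    · exact ⟨hcb.symm, hdb.symm⟩
    · exact ⟨fun h => hca (h.symm.trans hb.1), fun h => hda (h.symm.trans hb.1)⟩
    · exact ⟨fun h => hcb (h.symm.trans hb.2), fun h => hdb (h.symm.trans hb.2)⟩
  have hF'₁ : F' (ι v₁) = F (ι v₁) := by rw [hι, Equiv.swap_apply_of_ne_of_ne hca.symm hda.symm]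
  have hF'₂ : F' (ι v₂) = F (ι v₂) := by rw [hι, Equiv.swap_apply_of_ne_of_ne hcb.symm hdb.symm]
  have h1 := h.colourChain_iff_not hP hP₁ e₁ e₂ e₃ e₄ hF₁ F hF hda hdb
  have h2 := h.colourChain_iff_not hP hP₁ e₁ e₂ e₃ e₄ hF₁ F' (fun F'' h' => hF F'' (hFF'.trans h'))
    (c := d) (by rwa [hF'₁]) (by rwa [hF'₂])
  rw [hF'₁] at h2
  simp only [hι₁] at h2
  rw [h1, ← h2]
  simp only [hι]
  constructor <;> intro h' <;> refine h'.congr fun x hx => ?_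
  · rcases hx with hx | hx
    · exact Or.inl (by rw [hx, Equiv.swap_apply_of_ne_of_ne hca.symm hda.symm])
    · exact Or.inr (by rw [hx, Equiv.swap_apply_left])
  · rcases hx with hx | hx
    · rw [Equiv.swap_apply_eq_iff, Equiv.swap_apply_of_ne_of_ne hca.symm hda.symm] at hx
      exact Or.inl hx
    · rw [Equiv.swap_apply_eq_iff, Equiv.swap_apply_right] at hx
      exact Or.inr hx

end

/-- Whether the other piece has a chain from v₁ to v₃ in the colour of v₁ and one fixed missing
colour decides everything: Kempe changes of the given piece change the other only by a permutation,
and the complementary answer holds for both missing colours. -/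
theorem IsBaseModule.exists_forall_isSharedEndpoint [Finite V] {P : H.PlaneEmbedding}
    (h : P.IsBaseModule (fourCycle h₁₂ h₂₃ h₃₄ h₄₁)) :
    ∃ f₀ : H.Coloring (Fin 4), IsBichromatic f₀ (fourCycle h₁₂ h₂₃ h₃₄ h₄₁) ∧
      ((∀ f : H.Coloring (Fin 4), P.KempeEquiv f₀ f → IsSharedEndpoint₂₄ f h₁₂ h₂₃ h₃₄ h₄₁) ∨
        ∀ f : H.Coloring (Fin 4), P.KempeEquiv f₀ f → IsSharedEndpoint₁₃ f h₁₂ h₂₃ h₃₄ h₄₁) := by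
  obtain ⟨hP, V₁, _, H₁, P₁, x₁, C₁, W, _, G, Q, ι, ι₁, hP₁, hgl, hub⟩ := h
  obtain ⟨F, -, hFb⟩ := hub.unchanged
  have hFb' : ∀ F' : G.Coloring (Fin 4), Q.KempeEquiv F F' →
      F' (ι v₃) = F' (ι v₁) ∧ F' (ι v₄) = F' (ι v₂) :=
    fun F' h' => (isBichromatic_map_fourCycle_iff h₁₂ h₂₃ h₃₄ h₄₁).1 (hFb F' h')
  obtain ⟨w₁, w₂, w₃, w₄, k₁₄, k₄₃, k₃₂, k₂₁, e₁, e₂, e₃, e₄, hF₁⟩ := hgl.exists_isFourFace hP hP₁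
  obtain ⟨c₀, hc₀⟩ := exists_fourth_colour (F (ι v₁)) (F (ι v₂)) (F (ι v₂))
  have hbich : ∀ F' : G.Coloring (Fin 4), Q.KempeEquiv F F' → ∀ f : H.Coloring (Fin 4),
      (∀ v, F' (ι v) = f v) → IsBichromatic f (fourCycle h₁₂ h₂₃ h₃₄ h₄₁) := by
    intro F' h' f hf
    rw [isBichromatic_fourCycle_iff, ← hf, ← hf, ← hf, ← hf]
    exact hFb' F' h'
  let f₀ : H.Coloring (Fin 4) := Coloring.mk (fun v => F (ι v)) fun hab => F.valid (ι.map_adj hab)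
  have key : ∀ f : H.Coloring (Fin 4), P.KempeEquiv f₀ f →
      IsBichromatic f (fourCycle h₁₂ h₂₃ h₃₄ h₄₁) ∧ ∀ i, i ≠ f v₁ → i ≠ f v₂ →
        (HasEndpointPath f v₁ v₃ i ↔
          ¬ H₁.ColourChain (fun w => F (ι₁ w)) (F (ι v₁)) c₀ w₁ w₃) := by
    intro f hf
    obtain ⟨F', hFF', hι, π, hπ⟩ := hgl.exists_kempeEquiv_lift hP hP₁ hf F fun _ => rfl
    refine ⟨hbich F' hFF' f hι, fun i hi₁ hi₂ => ?_⟩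
    have hF'b := fun F'' (h' : Q.KempeEquiv F' F'') => hFb' F'' (hFF'.trans h')
    have p1 : F' (ι v₁) = π (F (ι v₁)) := by rw [e₁, hπ]
    have p2 : F' (ι v₂) = π (F (ι v₂)) := by rw [e₂, hπ]
    have q1 : π c₀ ≠ F' (ι v₁) := by rw [p1]; exact fun h' => hc₀.1 (π.injective h')
    have q2 : π c₀ ≠ F' (ι v₂) := by rw [p2]; exact fun h' => hc₀.2.1 (π.injective h')
    have h1 := hgl.colourChain_iff_of_ne hP hP₁ F' hF'b (by rwa [hι]) (by rwa [hι]) q1 q2 (c := i)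
    have h2 := hgl.colourChain_iff_not hP hP₁ e₁ e₂ e₃ e₄ hF₁ F' hF'b q1 q2
    rw [h2] at h1
    simp only [hι] at h1
    rw [hasEndpointPath_iff, h1, not_iff_not, ← hι, p1]
    constructor <;> intro h' <;> refine h'.congr fun x hx => ?_
    · rw [hπ, π.injective.eq_iff, π.injective.eq_iff] at hx
      exact hx
    · rw [hπ, π.injective.eq_iff, π.injective.eq_iff]
      exact hx
  refine ⟨f₀, (key f₀ .refl).1, ?_⟩
  by_cases hc : H₁.ColourChain (fun w => F (ι₁ w)) (F (ι v₁)) c₀ w₁ w₃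
  · exact Or.inl fun f hf => ⟨(key f hf).1, fun i hi₁ hi₂ h' => ((key f hf).2 i hi₁ hi₂).1 h' hc⟩
  · exact Or.inr fun f hf => ⟨(key f hf).1, fun i hi₁ hi₂ => ((key f hf).2 i hi₁ hi₂).2 hc⟩

end PlaneEmbedding
end SimpleGraph

/-! ### Counting faces; triangulations are maximal planar. -/

namespace SimpleGraph

/-- Every orbit contributes one when each of its elements is weighted by the reciprocal of the
orbit's size. Bounds on face lengths thus become bounds on the number of faces. -/
theorem card_quotient_sameCycle {X : Type*} [Fintype X] [DecidableEq X] (σ : Equiv.Perm X)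
    (T : X → Finset X) (hT : ∀ x y, y ∈ T x ↔ σ.SameCycle x y) :
    (Nat.card (Quotient (Equiv.Perm.SameCycle.setoid σ)) : ℚ) = ∑ x, 1 / ((T x).card : ℚ) := by
  classical
  let q : X → Quotient (Equiv.Perm.SameCycle.setoid σ) := fun x => Quotient.mk _ x
  have := Fintype.ofFinite (Quotient (Equiv.Perm.SameCycle.setoid σ))
  have hq : ∀ x y, q x = q y ↔ σ.SameCycle x y := fun x y =>
    Quotient.eq (r := Equiv.Perm.SameCycle.setoid σ)
  rw [← Finset.sum_fiberwise (s := Finset.univ) (g := q), Nat.card_eq_fintype_card, Fintype.card,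
    Finset.cast_card]
  refine Finset.sum_congr rfl fun c _ => ?_
  induction c using Quotient.inductionOn with | _ a =>
  have hfib : (Finset.univ.filter fun x => q x = q a) = T a := by
    ext x
    simp only [Finset.mem_filter, Finset.mem_univ, true_and, hq, hT]
    exact ⟨fun h => h.symm, fun h => h.symm⟩
  change 1 = ∑ x ∈ Finset.univ.filter fun x => q x = q a, _
  rw [hfib]
  have hcongr : ∀ x ∈ T a, T x = T a := by
    intro x hx
    rw [hT] at hx
    ext y
    rw [hT, hT]
    exact ⟨hx.trans, hx.symm.trans⟩
  rw [Finset.sum_congr rfl fun x hx => by rw [hcongr x hx], Finset.sum_const, nsmul_eq_mul]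
  have : ((T a).card : ℚ) ≠ 0 := by
    have : a ∈ T a := (hT a a).2 ⟨0, rfl⟩
    exact_mod_cast (Finset.card_pos.2 ⟨a, this⟩).ne'
  field_simp

theorem sameCycle_iff_mem {X : Type*} [Finite X] {σ : Equiv.Perm X} {x : X} {T : Set X} (hx : x ∈ T)
    (hT : ∀ y ∈ T, σ y ∈ T) (hTx : ∀ y ∈ T, σ.SameCycle x y) (y : X) : y ∈ T ↔ σ.SameCycle x y := by
  refine ⟨hTx y, fun h => ?_⟩
  obtain ⟨n, rfl⟩ := h.exists_nat_pow_eq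
  clear h
  induction n with
  | zero => exact hx
  | succ n ih =>
    rw [pow_succ', Equiv.Perm.mul_apply]
    exact hT _ ih

theorem card_sameCycle_eq_three {X : Type*} [Fintype X] [DecidableEq X] {σ : Equiv.Perm X} {x : X}
    (h3 : σ (σ (σ x)) = x) (hne : σ x ≠ x) (T : Finset X) (hT : ∀ y, y ∈ T ↔ σ.SameCycle x y) :
    T.card = 3 := by
  have hT' : T = {x, σ x, σ (σ x)} := by
    ext y
    rw [hT, ← sameCycle_iff_mem (T := {x, σ x, σ (σ x)})]
    · simp
    · simp
    · rintro y (rfl | rfl | rfl) <;> simp [h3]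
    · rintro y (rfl | rfl | rfl)
      exacts [⟨0, rfl⟩, ⟨1, rfl⟩, ⟨2, rfl⟩]
  have h1 : σ (σ x) ≠ σ x := fun h => hne (σ.injective h)
  have h2 : σ (σ x) ≠ x := fun h => by
    rw [h] at h3
    exact hne h3
  rw [hT', Finset.card_eq_three]
  exact ⟨x, σ x, σ (σ x), hne.symm, h2.symm, h1.symm, rfl⟩

theorem three_mul_card_quotient_sameCycle {X : Type*} [Finite X] (σ : Equiv.Perm X)
    (h3 : ∀ x, σ (σ (σ x)) = x) (hne : ∀ x, σ x ≠ x) :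
    3 * Nat.card (Quotient (Equiv.Perm.SameCycle.setoid σ)) = Nat.card X := by
  classical
  have := Fintype.ofFinite X
  have h := card_quotient_sameCycle σ (fun x => Finset.univ.filter (σ.SameCycle x)) (by simp)
  rw [Finset.sum_congr rfl fun x _ => by
    rw [card_sameCycle_eq_three (h3 x) (hne x) (Finset.univ.filter (σ.SameCycle x)) (by simp)]] at h
  rw [Finset.sum_const, nsmul_eq_mul, Finset.card_univ, ← Nat.card_eq_fintype_card] at h
  have h' : (3 * Nat.card (Quotient (Equiv.Perm.SameCycle.setoid σ)) : ℚ) = Nat.card X := by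
    rw [h]
    push_cast
    ring
  exact_mod_cast h'

theorem three_mul_card_quotient_sameCycle_add_one {X : Type*} [Finite X] (σ : Equiv.Perm X)
    {x₁ x₂ x₃ x₄ : X} (h₁ : σ x₁ = x₂) (h₂ : σ x₂ = x₃) (h₃ : σ x₃ = x₄) (h₄ : σ x₄ = x₁)
    (h₁₃ : x₁ ≠ x₃) (h3 : ∀ x, x = x₁ ∨ x = x₂ ∨ x = x₃ ∨ x = x₄ ∨ σ (σ (σ x)) = x)
    (hne : ∀ x, σ x ≠ x) :
    3 * Nat.card (Quotient (Equiv.Perm.SameCycle.setoid σ)) + 1 = Nat.card X := by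
  classical
  have := Fintype.ofFinite X
  let T : Finset X := {x₁, x₂, x₃, x₄}
  have h₁₂ : x₁ ≠ x₂ := fun h => hne x₁ (h₁.trans h.symm)
  have h₂₃ : x₂ ≠ x₃ := fun h => hne x₂ (h₂.trans h.symm)
  have h₃₄ : x₃ ≠ x₄ := fun h => hne x₃ (h₃.trans h.symm)
  have h₄₁ : x₄ ≠ x₁ := fun h => hne x₄ (h₄.trans h.symm)
  have h₂₄ : x₂ ≠ x₄ := fun h => h₁₃ (σ.injective (h₁.trans (h.trans h₃.symm)))
  have hcard : T.card = 4 := by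
    simp [T, h₁₂, h₁₃, h₄₁.symm, h₂₃, h₂₄, h₃₄]
  have hT : ∀ x ∈ T, ∀ y, y ∈ T ↔ σ.SameCycle x y := by
    intro x hx y
    have h1 : ∀ y ∈ T, σ.SameCycle x₁ y := by
      intro y hy
      simp only [T, Finset.mem_insert, Finset.mem_singleton] at hy
      rcases hy with rfl | rfl | rfl | rfl
      · exact ⟨0, rfl⟩
      · exact ⟨1, h₁⟩
      · exact ⟨2, (congrArg σ h₁).trans h₂⟩
      · exact ⟨3, (congrArg σ ((congrArg σ h₁).trans h₂)).trans h₃⟩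
    refine sameCycle_iff_mem (T := {y | y ∈ T}) hx ?_ (fun y hy => (h1 x hx).symm.trans (h1 y hy)) y
    intro y hy
    simp only [T, Finset.mem_insert, Finset.mem_singleton, Set.mem_ofPred_eq] at hy ⊢
    rcases hy with rfl | rfl | rfl | rfl <;> simp [*]
  have hq := card_quotient_sameCycle σ (fun x => Finset.univ.filter (σ.SameCycle x)) (by simp)
  -- The correction is 1/3 − 1/4 = 1/12 for each of the four darts of the quadrilateral.
  have hterm : ∀ x, 1 / (((Finset.univ.filter (σ.SameCycle x)).card : ℕ) : ℚ) =
      1 / 3 - if x ∈ T then 1 / 12 else 0 := by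
    intro x
    by_cases hx : x ∈ T
    · have : Finset.univ.filter (σ.SameCycle x) = T := by
        ext y
        rw [hT x hx]
        simp
      rw [this, hcard, if_pos hx]
      norm_num
    · have hx3 : σ (σ (σ x)) = x := by
        have := h3 x
        simp only [T, Finset.mem_insert, Finset.mem_singleton] at hx
        tauto
      rw [card_sameCycle_eq_three hx3 (hne x) _ (by simp), if_neg hx]
      norm_num
  rw [Finset.sum_congr rfl fun d _ => hterm d, Finset.sum_sub_distrib, Finset.sum_const,
    Finset.sum_ite_mem, Finset.univ_inter, Finset.sum_const, hcard, Finset.card_univ,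
    ← Nat.card_eq_fintype_card] at hq
  have : (3 * Nat.card (Quotient (Equiv.Perm.SameCycle.setoid σ)) + 1 : ℚ) = Nat.card X := by
    rw [hq]
    simp only [nsmul_eq_mul]
    push_cast
    ring
  exact_mod_cast this

variable {V : Type u} {G : SimpleGraph V}

theorem card_dart [Finite V] : Nat.card G.Dart = 2 * G.edgeSet.ncard := by
  classical
  have := Fintype.ofFinite V
  rw [Nat.card_eq_fintype_card, G.dart_card_eq_twice_card_edges, ← coe_edgeFinset,
    Set.ncard_coe_finset]

namespace PlaneEmbedding

theorem next_ne (P : G.PlaneEmbedding) (d : G.Dart) : P.next d ≠ d := fun h =>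
  d.fst_ne_snd (by rw [← P.next_fst, h])

/-- One quadrilateral and otherwise triangles give 3F + 1 = 2E, to be combined with V + F = E + 2.
-/
theorem IsSemiMaximal.ncard_edgeSet [Finite V] {P : G.PlaneEmbedding} {v₁ v₂ v₃ v₄ : V}
    {h₁₂ : G.Adj v₁ v₂} {h₂₃ : G.Adj v₂ v₃} {h₃₄ : G.Adj v₃ v₄} {h₄₁ : G.Adj v₄ v₁}
    (h : P.IsSemiMaximal (fourCycle h₁₂ h₂₃ h₃₄ h₄₁)) :
    G.edgeSet.ncard + 7 = 3 * Nat.card V := by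
  have hF := h.isFourFace
  have hq := three_mul_card_quotient_sameCycle_add_one P.next hF.next₁ hF.next₂ hF.next₃ hF.next₄
    (fun h' => hF.ne₁₃ (congrArg (fun d => d.fst) h')) (fun d => by
      by_cases hd : d ∈ (fourCycle h₁₂ h₂₃ h₃₄ h₄₁).darts
      · rw [mem_darts_fourCycle] at hd
        tauto
      · simp only [h.inner d hd, or_true]) P.next_ne
  have he := P.card_face_add_card h.connected ⟨(v₁, v₂), h₁₂⟩
  rw [Nat.card_coe_set_eq] at he
  rw [card_dart] at hq
  omega

/-- A connected plane triangulation is a maximal planar graph. -/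
theorem isMaximalPlanar [Finite V] (P : G.PlaneEmbedding) (hG : G.Connected)
    (h3 : ∀ d, P.next (P.next (P.next d)) = d) (hdeg : ∀ v, 2 ≤ (G.neighborSet v).ncard) :
    G.IsMaximalPlanar := by
  classical
  refine ⟨⟨P⟩, fun G' hlt => ?_⟩
  rintro ⟨R⟩
  have := Fintype.ofFinite V
  have := Fintype.ofFinite G'.Dart
  have hd : ∀ v, ∃ a b, a ≠ b ∧ G.Adj v a ∧ G.Adj v b := by
    intro v
    obtain ⟨a, ha, b, hb, hab⟩ := (Set.one_lt_ncard (Set.toFinite _)).1 (hdeg v)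
    exact ⟨a, b, hab, ha, hb⟩
  obtain ⟨v₀⟩ := hG.nonempty
  obtain ⟨w₀, -, -, hw₀, -⟩ := hd v₀
  have hG' : G'.Connected := hG.mono hlt.le
  have e1 := P.card_face_add_card hG ⟨(v₀, w₀), hw₀⟩
  have e2 := R.card_face_add_card hG' ⟨(v₀, w₀), hlt.le hw₀⟩
  have e3 := three_mul_card_quotient_sameCycle P.next h3 P.next_ne
  -- In any drawing of `G'` the faces have length at least three, so `G'` has at most 3V − 6 edges,
  -- which is already the number of edges of G.
  have e4 : 3 * Nat.card (Quotient (Equiv.Perm.SameCycle.setoid R.next)) ≤ Nat.card G'.Dart := by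
    have h := card_quotient_sameCycle R.next (fun d => Finset.univ.filter (R.next.SameCycle d))
      (by simp)
    have hle : ∀ d : G'.Dart,
        1 / (((Finset.univ.filter (R.next.SameCycle d)).card : ℕ) : ℚ) ≤ 1 / 3 := by
      intro d
      have n1 := R.next_ne d
      have n2 := R.next_ne (R.next d)
      -- A face of length two would make `d.symm` a fixed point of the rotation, so `d.snd` would
      -- have only one neighbour.
      have n3 : R.next (R.next d) ≠ d := by
        intro h'
        have hs : R.next d = d.symm :=
          Dart.ext _ _ (Prod.ext (R.next_fst d) ((R.next_fst _).symm.trans (by rw [h']; rfl)))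
        have hfix : R.rot d.symm = d.symm := by rw [R.rot_eq_next_symm, Dart.symm_symm, hs]
        have huniq : ∀ e : G'.Dart, e.fst = d.snd → e = d.symm := by
          intro e he
          obtain ⟨n, hn⟩ := R.rot_sameCycle d.symm e he.symm
          rw [← hn, Equiv.Perm.zpow_apply_eq_self_of_apply_eq_self hfix]
        obtain ⟨a, b, hab, ha, hb⟩ := hd d.snd
        have h1 := huniq ⟨(d.snd, a), hlt.le ha⟩ rfl
        have h2 := huniq ⟨(d.snd, b), hlt.le hb⟩ rfl
        exact hab (congrArg (fun e => e.snd) (h1.trans h2.symm))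
      have hsub : ({d, R.next d, R.next (R.next d)} : Finset G'.Dart) ⊆
          Finset.univ.filter (R.next.SameCycle d) := by
        intro e he
        simp only [Finset.mem_insert, Finset.mem_singleton] at he
        simp only [Finset.mem_filter, Finset.mem_univ, true_and]
        rcases he with rfl | rfl | rfl
        exacts [⟨0, rfl⟩, ⟨1, rfl⟩, ⟨2, rfl⟩]
      have hc := Finset.card_le_card hsub
      rw [Finset.card_eq_three.2 ⟨_, _, _, n1.symm, n3.symm, n2.symm, rfl⟩] at hc
      exact one_div_le_one_div_of_le (by norm_num) (by exact_mod_cast hc)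
    have hs := Finset.sum_le_sum fun d (_ : d ∈ Finset.univ) => hle d
    rw [← h, Finset.sum_const, nsmul_eq_mul, Finset.card_univ, ← Nat.card_eq_fintype_card] at hs
    have : (3 * Nat.card (Quotient (Equiv.Perm.SameCycle.setoid R.next)) : ℚ) ≤ Nat.card G'.Dart :=
        by
      linarith
    exact_mod_cast this
  rw [card_dart] at e3 e4
  rw [Nat.card_coe_set_eq] at e1 e2
  have := Set.ncard_lt_ncard (edgeSet_ssubset_edgeSet.2 hlt) (Set.toFinite _)
  omega

end PlaneEmbedding
end SimpleGraph

/-! ### Drawing the union of two semi-maximal graphs. -/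

namespace SimpleGraph

variable {V V₁ W : Type u} {H : SimpleGraph V} {H₁ : SimpleGraph V₁} {G : SimpleGraph W}

namespace PlaneEmbedding

theorem IsSemiMaximal.eq_of_snd_eq {P : H.PlaneEmbedding} {x : V} {C : H.Walk x x}
    (h : P.IsSemiMaximal C) {d e : H.Dart} (hd : d ∈ C.darts) (he : e ∈ C.darts)
    (hde : d.snd = e.snd) : d = e := by
  refine List.inj_on_of_nodup_map (f := fun d => d.snd) ?_ hd he hde
  rw [Walk.map_snd_darts]
  exact h.isCycle.support_nodup

/-- The new rotation agrees with the old one except where the old one passes through the outer face,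
which happens at most once around a vertex. Starting just after that gap, all darts are reached
without crossing it. -/
theorem IsSemiMaximal.sameCycle_mapDart [Finite V] {P : H.PlaneEmbedding} {x : V} {C : H.Walk x x}
    (h : P.IsSemiMaximal C) (ι : H →g G) (rot : Equiv.Perm G.Dart)
    (hrot : ∀ d : H.Dart, d.symm ∉ C.darts → rot (ι.mapDart d) = ι.mapDart (P.rot d))
    {d e : H.Dart} (hde : d.fst = e.fst) : rot.SameCycle (ι.mapDart d) (ι.mapDart e) := by
  have hstep : ∀ d : H.Dart, d.symm ∉ C.darts →
      rot.SameCycle (ι.mapDart d) (ι.mapDart (P.rot d)) := fun d hd => ⟨1, hrot d hd⟩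
  by_cases hex : ∃ d₀ : H.Dart, d₀.fst = d.fst ∧ d₀.symm ∈ C.darts
  · obtain ⟨d₀, hd₀, hd₀C⟩ := hex
    have hy : (P.rot d₀).fst = d.fst := (P.rot_fst _).trans hd₀
    have key := P.forall_fst_of_rot
      (fun e => rot.SameCycle (ι.mapDart (P.rot d₀)) (ι.mapDart e)) (P.rot d₀) ⟨0, rfl⟩ (by
        intro e he hee hne
        refine hee.trans (hstep e fun heC => hne ?_)
        have : e.symm = d₀.symm := h.eq_of_snd_eq heC hd₀C (he.trans (hy.trans hd₀.symm))
        rw [Dart.symm_involutive.injective this])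
    exact (key d hy.symm).symm.trans (key e (hde.symm.trans hy.symm))
  · push Not at hex
    exact P.forall_fst_of_rot (fun e => rot.SameCycle (ι.mapDart d) (ι.mapDart e)) d ⟨0, rfl⟩
      (fun e he hee _ => hee.trans (hstep e (hex e he))) e hde.symm

theorem ncard_darts_fourCycle {P : H.PlaneEmbedding} {v₁ v₂ v₃ v₄ : V}
    {h₁₂ : H.Adj v₁ v₂} {h₂₃ : H.Adj v₂ v₃} {h₃₄ : H.Adj v₃ v₄} {h₄₁ : H.Adj v₄ v₁}
    [Finite V] (h : P.IsSemiMaximal (fourCycle h₁₂ h₂₃ h₃₄ h₄₁)) :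
    Nat.card {d : H.Dart // d ∉ (fourCycle h₁₂ h₂₃ h₃₄ h₄₁).darts} + 4 = 2 * H.edgeSet.ncard := by
  classical
  have := Fintype.ofFinite H.Dart
  rw [← card_dart, Nat.card_eq_fintype_card, Nat.card_eq_fintype_card, Fintype.card_subtype_compl]
  have : Fintype.card {d : H.Dart // d ∈ (fourCycle h₁₂ h₂₃ h₃₄ h₄₁).darts} = 4 := by
    rw [Fintype.card_of_subtype (fourCycle h₁₂ h₂₃ h₃₄ h₄₁).darts.toFinset (by simp),
      List.toFinset_card_of_nodup]
    · simp [fourCycle]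
    · exact List.Nodup.of_map Dart.edge h.isCycle.edges_nodup
  have h4 : 4 ≤ Fintype.card H.Dart := by
    rw [← this]
    exact Fintype.card_subtype_le _
  rw [this]
  omega

/-- Two semi-maximal plane graphs glued along a common 4-cycle form a plane graph. -/
theorem exists_planeEmbedding_of_cover [Finite V] [Finite V₁] [Finite W] {P : H.PlaneEmbedding}
    {P₁ : H₁.PlaneEmbedding}
    {v₁ v₂ v₃ v₄ : V} {h₁₂ : H.Adj v₁ v₂} {h₂₃ : H.Adj v₂ v₃} {h₃₄ : H.Adj v₃ v₄}
        {h₄₁ : H.Adj v₄ v₁}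
    {w₁ w₂ w₃ w₄ : V₁} {k₁₂ : H₁.Adj w₁ w₂} {k₂₃ : H₁.Adj w₂ w₃} {k₃₄ : H₁.Adj w₃ w₄}
    {k₄₁ : H₁.Adj w₄ w₁} {ι : H →g G} {ι₁ : H₁ →g G}
    (hP : P.IsSemiMaximal (fourCycle h₁₂ h₂₃ h₃₄ h₄₁))
    (hP₁ : P₁.IsSemiMaximal (fourCycle k₁₂ k₂₃ k₃₄ k₄₁))
    (hι : Function.Injective ι) (hι₁ : Function.Injective ι₁) (hG : G.Connected)
    (hcover : ∀ e : G.Dart, (∃ d, e = ι.mapDart d) ∨ ∃ d', e = ι₁.mapDart d')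
    (hdisj : ∀ (d : H.Dart) (d' : H₁.Dart), ι.mapDart d = ι₁.mapDart d' →
      (d ∈ (fourCycle h₁₂ h₂₃ h₃₄ h₄₁).darts ↔ d' ∉ (fourCycle k₁₂ k₂₃ k₃₄ k₄₁).darts))
    (hin : ∀ d ∈ (fourCycle h₁₂ h₂₃ h₃₄ h₄₁).darts, ∃ d', ι.mapDart d = ι₁.mapDart d')
    (hin₁ : ∀ d' ∈ (fourCycle k₁₂ k₂₃ k₃₄ k₄₁).darts, ∃ d, ι.mapDart d = ι₁.mapDart d')
    (hshare : ∀ v w, ι v = ι₁ w → v ∈ (fourCycle h₁₂ h₂₃ h₃₄ h₄₁).support)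
    (hcard : Nat.card W + 4 = Nat.card V + Nat.card V₁) :
    ∃ Q : G.PlaneEmbedding,
      (∀ d, d ∉ (fourCycle h₁₂ h₂₃ h₃₄ h₄₁).darts → Q.next (ι.mapDart d) = ι.mapDart (P.next d)) ∧
      ∀ d', d' ∉ (fourCycle k₁₂ k₂₃ k₃₄ k₄₁).darts →
        Q.next (ι₁.mapDart d') = ι₁.mapDart (P₁.next d') := by
  classical
  set C := fourCycle h₁₂ h₂₃ h₃₄ h₄₁ with hC
  set C₁ := fourCycle k₁₂ k₂₃ k₃₄ k₄₁ with hC₁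
  -- The darts of the union are the disjoint union of the inner darts of the two pieces, so the two
  -- face permutations combine into one whose orbits are the inner triangles.
  let θ : {d : H.Dart // d ∉ C.darts} ⊕ {d' : H₁.Dart // d' ∉ C₁.darts} → G.Dart :=
    Sum.elim (fun d => ι.mapDart d) fun d' => ι₁.mapDart d'
  have hinj := Hom.mapDart_injective hι
  have hinj₁ := Hom.mapDart_injective hι₁
  have hθ : Function.Bijective θ := by
    constructor
    · rintro (⟨d, hd⟩ | ⟨d, hd⟩) (⟨e, he⟩ | ⟨e, he⟩) hde
      · exact congrArg Sum.inl (Subtype.ext (hinj hde))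
      · exact absurd ((hdisj d e hde).2 he) hd
      · exact absurd ((hdisj e d hde.symm).2 hd) he
      · exact congrArg Sum.inr (Subtype.ext (hinj₁ hde))
    · intro e
      rcases hcover e with ⟨d, rfl⟩ | ⟨d', rfl⟩
      · by_cases hd : d ∈ C.darts
        · obtain ⟨d', hd'⟩ := hin d hd
          exact ⟨Sum.inr ⟨d', (hdisj d d' hd').1 hd⟩, hd'.symm⟩
        · exact ⟨Sum.inl ⟨d, hd⟩, rfl⟩
      · by_cases hd : d' ∈ C₁.darts
        · obtain ⟨d, hd'⟩ := hin₁ d' hd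
          exact ⟨Sum.inl ⟨d, fun h => (hdisj d d' hd').1 h hd⟩, hd'⟩
        · exact ⟨Sum.inr ⟨d', hd⟩, rfl⟩
  let Θ := Equiv.ofBijective θ hθ
  let n : Equiv.Perm G.Dart := Θ.permCongr (Equiv.sumCongr
    (P.next.subtypePerm fun d => not_congr (hP.next_mem_iff d))
    (P₁.next.subtypePerm fun d => not_congr (hP₁.next_mem_iff d)))
  have hn : ∀ d, d ∉ C.darts → n (ι.mapDart d) = ι.mapDart (P.next d) := by
    intro d hd
    have : Θ.symm (ι.mapDart d) = Sum.inl ⟨d, hd⟩ := Θ.symm_apply_eq.2 rfl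
    simp only [n, Equiv.permCongr_apply, this]
    rfl
  have hn₁ : ∀ d, d ∉ C₁.darts → n (ι₁.mapDart d) = ι₁.mapDart (P₁.next d) := by
    intro d hd
    have : Θ.symm (ι₁.mapDart d) = Sum.inr ⟨d, hd⟩ := Θ.symm_apply_eq.2 rfl
    simp only [n, Equiv.permCongr_apply, this]
    rfl
  have hcases : ∀ e : G.Dart, (∃ d, d ∉ C.darts ∧ e = ι.mapDart d) ∨
      ∃ d', d' ∉ C₁.darts ∧ e = ι₁.mapDart d' := by
    intro e
    obtain ⟨⟨d, hd⟩ | ⟨d, hd⟩, rfl⟩ := hθ.2 e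
    · exact Or.inl ⟨d, hd, rfl⟩
    · exact Or.inr ⟨d, hd, rfl⟩
  have hnfst : ∀ e, (n e).fst = e.snd := by
    intro e
    rcases hcases e with ⟨d, hd, rfl⟩ | ⟨d, hd, rfl⟩
    · rw [hn d hd]
      exact congrArg ι (P.next_fst d)
    · rw [hn₁ d hd]
      exact congrArg ι₁ (P₁.next_fst d)
  have hn3 : ∀ e, n (n (n e)) = e := by
    intro e
    rcases hcases e with ⟨d, hd, rfl⟩ | ⟨d, hd, rfl⟩
    · have hd1 := mt (hP.next_mem_iff _).1 hd
      have hd2 := mt (hP.next_mem_iff _).1 hd1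
      rw [hn _ hd, hn _ hd1, hn _ hd2, hP.inner _ hd]
    · have hd1 := mt (hP₁.next_mem_iff _).1 hd
      have hd2 := mt (hP₁.next_mem_iff _).1 hd1
      rw [hn₁ _ hd, hn₁ _ hd1, hn₁ _ hd2, hP₁.inner _ hd]
  let i : Equiv.Perm G.Dart := Function.Involutive.toPerm Dart.symm Dart.symm_involutive
  let ρ : Equiv.Perm G.Dart := i.trans n
  have hin_symm : i.trans (i.trans n) = n := by
    ext1 e
    change n e.symm.symm = n e
    rw [Dart.symm_symm]
  have hsc : ∀ {d e : H.Dart}, d.fst = e.fst →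
      ρ.SameCycle (ι.mapDart d) (ι.mapDart e) := fun hde =>
    hP.sameCycle_mapDart ι ρ (fun d hd => (hn d.symm hd).trans (by
      rw [P.rot_eq_next_symm])) hde
  have hsc₁ : ∀ {d e : H₁.Dart}, d.fst = e.fst →
      ρ.SameCycle (ι₁.mapDart d) (ι₁.mapDart e) := fun hde =>
    hP₁.sameCycle_mapDart ι₁ ρ (fun d hd => (hn₁ d.symm hd).trans (by
      rw [P₁.rot_eq_next_symm])) hde
  -- At a common vertex the dart of the cycle leaving it belongs to both pieces and links their
  -- rotations.
  have hmix : ∀ (d : H.Dart) (d' : H₁.Dart), ι d.fst = ι₁ d'.fst →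
      ρ.SameCycle (ι.mapDart d) (ι₁.mapDart d') := by
    intro d d' hdd'
    obtain ⟨e, heC, he⟩ : ∃ e ∈ C.darts, e.fst = d.fst := by
      have := hshare _ _ hdd'
      rw [hC, mem_support_fourCycle] at this
      simp only [hC, mem_darts_fourCycle]
      rcases this with h | h | h | h <;> rw [h] <;> simp
    obtain ⟨e', he'⟩ := hin e heC
    have h1 := hsc he.symm
    rw [he'] at h1
    refine h1.trans (hsc₁ (hι₁ ?_))
    rw [← hdd', ← he]
    exact (congrArg (fun x => x.fst) he').symm
  -- Euler's formula by counting: E = E₀ + E₁ − 4 = 3(V₀ + V₁) − 18 = 3V − 6, and 3F = 2E.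
  have hE := hP.ncard_edgeSet
  have hE₁ := hP₁.ncard_edgeSet
  have hD : Nat.card {d : H.Dart // d ∉ C.darts} + 4 = _ := ncard_darts_fourCycle hP
  have hD₁ : Nat.card {d' : H₁.Dart // d' ∉ C₁.darts} + 4 = _ := ncard_darts_fourCycle hP₁
  have hDG : Nat.card G.Dart = Nat.card {d : H.Dart // d ∉ C.darts} +
      Nat.card {d' : H₁.Dart // d' ∉ C₁.darts} := by
    rw [← Nat.card_sum]
    exact (Nat.card_congr Θ).symm
  have hq := three_mul_card_quotient_sameCycle n hn3 fun e h => e.fst_ne_snd (by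
    rw [← hnfst, h])
  rw [card_dart] at hDG hq
  obtain ⟨z1, z2⟩ := hG.euler_left (ι.mapDart ⟨(v₁, v₂), h₁₂⟩)
  let Q : G.PlaneEmbedding :=
    { rot := ρ
      rot_fst := fun e => hnfst e.symm
      rot_sameCycle := by
        intro e e' hee
        rcases hcases e with ⟨d, -, rfl⟩ | ⟨d, -, rfl⟩ <;>
          rcases hcases e' with ⟨d', -, rfl⟩ | ⟨d', -, rfl⟩
        · exact hsc (hι hee)
        · exact hmix _ _ hee
        · exact (hmix _ _ hee.symm).symm
        · exact hsc₁ (hι₁ hee)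
      euler := by
        change _ + (Nat.card (Quotient (Equiv.Perm.SameCycle.setoid (i.trans (i.trans n)))) + _) = _
        rw [hin_symm, z1, z2]
        omega }
  have hQ : Q.next = n := hin_symm
  exact ⟨Q, by rwa [hQ], by rwa [hQ]⟩

end PlaneEmbedding
end SimpleGraph

/-! ### The cap: a fixed semi-maximal graph on six vertices. -/

namespace SimpleGraph

/-- Adjacency in the 4-cycle `0 1 2 3` with two adjacent vertices `4` and `5` inside, both of which
are adjacent to `0` and `2`. -/
def capAdj (a b : Fin 6) : Bool :=
  ![![false, true, false, true, true, true], ![true, false, true, false, true, false],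
    ![false, true, false, true, true, true], ![true, false, true, false, false, true],
    ![true, true, true, false, false, true], ![true, false, true, true, true, false]] a b

/-- The end of the dart that follows the dart from `a` to `b` along a face. -/
def capNext (a b : Fin 6) : Fin 6 :=
  -- Entries at nonadjacent pairs are placeholders.
  ![![0, 4, 0, 2, 5, 3], ![3, 0, 4, 0, 0, 0], ![0, 0, 0, 5, 1, 4], ![5, 0, 1, 0, 0, 2],
    ![1, 2, 5, 0, 0, 0], ![4, 0, 3, 0, 2, 0]] a b

/-- The start of the dart that precedes the dart from `a` to `b` along a face. -/
def capPrev (a b : Fin 6) : Fin 6 :=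
  ![![0, 4, 0, 1, 5, 3], ![2, 0, 4, 0, 0, 0], ![0, 3, 0, 5, 1, 4], ![5, 0, 0, 0, 0, 2],
    ![1, 2, 5, 0, 0, 0], ![4, 0, 3, 0, 2, 0]] a b

theorem capAdj_next : ∀ a b, capAdj a b → capAdj b (capNext a b) := by decide
theorem capAdj_prev : ∀ a b, capAdj a b → capAdj (capPrev a b) a := by decide
theorem capPrev_next : ∀ a b, capAdj a b → capPrev b (capNext a b) = a := by decide
theorem capNext_prev : ∀ a b, capAdj a b → capNext (capPrev a b) a = b := by decide

/-- The graph of `capAdj`. -/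
def cap : SimpleGraph (ULift.{u} (Fin 6)) where
  Adj a b := capAdj a.down b.down
  symm := ⟨by
    rintro ⟨a⟩ ⟨b⟩
    revert a b
    decide⟩
  loopless := ⟨by
    rintro ⟨a⟩
    revert a
    decide⟩

namespace cap

/-- The permutation of the darts along the faces. -/
def next : Equiv.Perm cap.{u}.Dart where
  toFun d := ⟨(d.snd, ⟨capNext d.fst.down d.snd.down⟩), capAdj_next _ _ d.adj⟩
  invFun d := ⟨(⟨capPrev d.fst.down d.snd.down⟩, d.fst), capAdj_prev _ _ d.adj⟩
  left_inv d := Dart.ext _ _ (Prod.ext (congrArg ULift.up (capPrev_next _ _ d.adj)) rfl)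
  right_inv d := Dart.ext _ _ (Prod.ext rfl (congrArg ULift.up (capNext_prev _ _ d.adj)))

theorem adj₀₁ : cap.{u}.Adj ⟨0⟩ ⟨1⟩ := rfl
theorem adj₀₃ : cap.{u}.Adj ⟨0⟩ ⟨3⟩ := rfl
theorem adj₃₂ : cap.{u}.Adj ⟨3⟩ ⟨2⟩ := rfl
theorem adj₂₁ : cap.{u}.Adj ⟨2⟩ ⟨1⟩ := rfl
theorem adj₁₀ : cap.{u}.Adj ⟨1⟩ ⟨0⟩ := rfl

theorem connected : cap.{u}.Connected := by
  rw [connected_iff_exists_forall_reachable]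
  refine ⟨⟨0⟩, ?_⟩
  rintro ⟨i⟩
  have : ∀ i : Fin 6, i = 0 ∨ capAdj 0 i ∨ capAdj 1 i := by decide
  have h01 : cap.{u}.Reachable ⟨0⟩ ⟨1⟩ := Adj.reachable adj₀₁.{u}
  rcases this i with rfl | h | h
  · exact .refl _
  · exact Adj.reachable (show cap.{u}.Adj ⟨0⟩ ⟨i⟩ from h)
  · exact h01.trans (Adj.reachable (show cap.{u}.Adj ⟨1⟩ ⟨i⟩ from h))

theorem card_dart_eq : Nat.card cap.{u}.Dart = 22 := by
  let e : cap.{u}.Dart ≃ {p : Fin 6 × Fin 6 // capAdj p.1 p.2} :=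
    { toFun := fun d => ⟨(d.fst.down, d.snd.down), d.adj⟩
      invFun := fun p => ⟨(⟨p.1.1⟩, ⟨p.1.2⟩), p.2⟩
      left_inv := fun _ => rfl
      right_inv := fun _ => rfl }
  rw [Nat.card_congr e, Nat.card_eq_fintype_card]
  decide

theorem next_ne (d : cap.{u}.Dart) : next d ≠ d := fun h =>
  d.snd_ne_fst (congrArg (fun e => e.fst) h)

theorem next_next_next (d : cap.{u}.Dart) : d = ⟨(⟨0⟩, ⟨3⟩), adj₀₃.{u}⟩ ∨ d = ⟨(⟨3⟩, ⟨2⟩),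
    adj₃₂.{u}⟩ ∨ d = ⟨(⟨2⟩, ⟨1⟩), adj₂₁.{u}⟩ ∨
    d = ⟨(⟨1⟩, ⟨0⟩), adj₁₀.{u}⟩ ∨ next (next (next d)) = d := by
  obtain ⟨⟨⟨a⟩, ⟨b⟩⟩, hab⟩ := d
  have key : ∀ a b, capAdj a b → (a = 0 ∧ b = 3) ∨ (a = 3 ∧ b = 2) ∨ (a = 2 ∧ b = 1) ∨
      (a = 1 ∧ b = 0) ∨ (capNext b (capNext a b) = a ∧ capNext (capNext a b) a = b) := by decide
  rcases key a b hab with ⟨rfl, rfl⟩ | ⟨rfl, rfl⟩ | ⟨rfl, rfl⟩ | ⟨rfl, rfl⟩ | ⟨h1, h2⟩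
  · exact Or.inl rfl
  · exact Or.inr (Or.inl rfl)
  · exact Or.inr (Or.inr (Or.inl rfl))
  · exact Or.inr (Or.inr (Or.inr (Or.inl rfl)))
  · refine Or.inr (Or.inr (Or.inr (Or.inr (Dart.ext _ _ (Prod.ext ?_ ?_)))))
    · exact congrArg ULift.up h1
    · refine congrArg ULift.up ?_
      change capNext (capNext a b) (capNext b (capNext a b)) = b
      rw [h1, h2]

/-- The drawing of the graph in the plane. -/
def planeEmbedding : cap.{u}.PlaneEmbedding where
  rot := (Function.Involutive.toPerm Dart.symm Dart.symm_involutive).trans next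
  rot_fst _ := rfl
  rot_sameCycle := by
    rintro ⟨⟨⟨a⟩, ⟨b⟩⟩, hab⟩ ⟨⟨⟨a'⟩, ⟨c⟩⟩, hac⟩ h
    obtain rfl : a = a' := congrArg ULift.down h
    -- At most three turns are needed, since no vertex has more than four neighbours.
    have key : ∀ a b c, capAdj a b → capAdj a c →
        ∃ k : Fin 4, (fun x => capNext x a)^[k] b = c := by decide
    obtain ⟨k, hk⟩ := key a b c hab hac
    refine ⟨k, ?_⟩
    rw [zpow_natCast]
    have : ∀ k : ℕ, ∀ b (hab : cap.{u}.Adj ⟨a⟩ ⟨b⟩),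
        ((((Function.Involutive.toPerm Dart.symm Dart.symm_involutive).trans next :
          Equiv.Perm cap.{u}.Dart) ^ k) ⟨(⟨a⟩, ⟨b⟩), hab⟩).toProd =
          (⟨a⟩, ⟨(fun x => capNext x a)^[k] b⟩) := by
      intro k
      induction k with
      | zero => exact fun _ _ => rfl
      | succ k ih =>
        intro b hab
        rw [pow_succ, Equiv.Perm.mul_apply, Function.iterate_succ_apply]
        exact ih (capNext b a) (capAdj_next _ _ hab.symm)
    exact Dart.ext _ _ ((this k b hab).trans (by rw [hk]))
  euler := by
    have hs : (Function.Involutive.toPerm Dart.symm Dart.symm_involutive).trans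
        ((Function.Involutive.toPerm Dart.symm Dart.symm_involutive).trans next) =
          (next : Equiv.Perm cap.{u}.Dart) := by
      ext1 e
      change next e.symm.symm = next e
      rw [Dart.symm_symm]
    -- The 22 darts give 3F + 1 = 22, so F = 7, and 6 + 7 = 11 + 2.
    have h1 := three_mul_card_quotient_sameCycle_add_one next.{u} (x₁ := ⟨(⟨0⟩, ⟨3⟩), adj₀₃.{u}⟩)
        (x₂ := ⟨(⟨3⟩, ⟨2⟩), adj₃₂.{u}⟩)
      (x₃ := ⟨(⟨2⟩, ⟨1⟩), adj₂₁.{u}⟩) (x₄ := ⟨(⟨1⟩, ⟨0⟩), adj₁₀.{u}⟩) rfl rfl rfl rfl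
      (fun h => absurd (congrArg (fun d => d.fst.down) h) (by decide : (0 : Fin 6) ≠ 2))
          next_next_next next_ne
    have h2 := card_dart_eq.{u}
    have h3 := card_dart (G := cap.{u})
    obtain ⟨h4, h5⟩ := connected.{u}.euler_left ⟨(⟨0⟩, ⟨1⟩), adj₀₁.{u}⟩
    have h6 : Nat.card (ULift.{u} (Fin 6)) = 6 := by simp
    rw [hs, h4, h5, h6]
    omega

theorem planeEmbedding_next : planeEmbedding.{u}.next = next := by
  ext1 e
  change next e.symm.symm = next e
  rw [Dart.symm_symm]

/-- The outer cycle is listed as 0, 3, 2, 1, because the two sides of a common cycle traverse it in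
opposite directions. -/
theorem isSemiMaximal : planeEmbedding.{u}.IsSemiMaximal
    (fourCycle adj₀₃.{u} adj₃₂.{u} adj₂₁.{u} adj₁₀.{u}) where
  connected := connected
  isCycle := PlaneEmbedding.isCycle_fourCycle (fun h => absurd (congrArg ULift.down h) (by decide))
    fun h => absurd (congrArg ULift.down h) (by decide)
  four_le_length := le_rfl
  outer d hd := by
    rw [PlaneEmbedding.mem_darts_fourCycle] at hd ⊢
    rw [planeEmbedding_next]
    rcases hd with rfl | rfl | rfl | rfl
    exacts [Or.inr (Or.inl rfl), Or.inr (Or.inr (Or.inl rfl)), Or.inr (Or.inr (Or.inr rfl)),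
      Or.inl rfl]
  inner d hd := by
    rw [PlaneEmbedding.mem_darts_fourCycle] at hd
    rw [planeEmbedding_next]
    have := next_next_next d
    tauto

end cap

end SimpleGraph

/-! ### Restricting swaps of a gluing to one piece. -/

namespace SimpleGraph

variable {V V₁ W : Type u} {H : SimpleGraph V} {H₁ : SimpleGraph V₁} {G : SimpleGraph W}

namespace PlaneEmbedding

variable {P : H.PlaneEmbedding} {P₁ : H₁.PlaneEmbedding} {Q : G.PlaneEmbedding}
  {x : V} {C : H.Walk x x} {x₁ : V₁} {C₁ : H₁.Walk x₁ x₁} {ι : H →g G} {ι₁ : H₁ →g G}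

/-- Neither the edges nor the rotations at vertices coloured s or t change S, so an s/t chain lies
wholly inside or wholly outside the region. -/
theorem IsSwap.iff_of_colourChain [Finite W] {F F' : G.Coloring (Fin 4)} {s t : Fin 4}
    {S : G.Dart → Prop} (h : Q.IsSwap F F' s t S) {u v : W} (huv : G.ColourChain F s t u v)
    (hu : F u = s ∨ F u = t) {d e : G.Dart} (hd : d.fst = u) (he : e.fst = v) : S e ↔ S d := by
  induction huv generalizing e with
  | refl => exact Q.iff_of_fst_eq h.face h.edge (he.trans hd.symm) (by rwa [hd])
  | @tail v w _ hvw ih =>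
    have h1 : F (⟨(v, w), hvw.1⟩ : G.Dart).symm.fst = s ∨ F (⟨(v, w), hvw.1⟩ : G.Dart).symm.fst =
        t :=
      hvw.2.2
    rw [← ih (e := ⟨(v, w), hvw.1⟩) rfl, ← h.edge ⟨(v, w), hvw.1⟩ hvw.2.1]
    exact Q.iff_of_fst_eq h.face h.edge he h1

/-- The restriction of an interchange of colours to one of the two parts of a gluing, if the
vertices in these colours on the common cycle are joined by chains. -/
theorem IsGluing.exists_kempeEquiv_of_isSwap [Finite V] [Finite W]
    (h : IsGluing P P₁ Q C C₁ ι ι₁) (hP : P.IsSemiMaximal C)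
    {F F' : G.Coloring (Fin 4)} {f : H.Coloring (Fin 4)} (hf : ∀ v, F (ι v) = f v) {s t : Fin 4}
    {S : G.Dart → Prop} (hS : Q.IsSwap F F' s t S)
    (hC : ∀ u ∈ C.support, ∀ v ∈ C.support, f u = s ∨ f u = t → f v = s ∨ f v = t →
      G.ColourChain F s t (ι u) (ι v)) :
    ∃ g : H.Coloring (Fin 4), P.KempeEquiv f g ∧ ∀ v, F' (ι v) = g v := by
  let g : H.Coloring (Fin 4) := F'.comp ι
  refine ⟨g, ?_, fun _ => rfl⟩
  -- τ is the value to be used on the outer face of the piece: the common value of S at the cycle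
  -- vertices coloured s or t, well defined by the chains, and false if there are none.
  let τ : Prop := ∃ v ∈ C.support, (f v = s ∨ f v = t) ∧ ∃ e : G.Dart, e.fst = ι v ∧ S e
  have hτ : ∀ d : H.Dart, d.fst ∈ C.support → f d.fst = s ∨ f d.fst = t → (S (ι.mapDart d) ↔ τ) :=
      by
    intro d hd hst
    refine ⟨fun h' => ⟨d.fst, hd, hst, _, rfl, h'⟩, ?_⟩
    rintro ⟨v, hv, hvst, e, he, hSe⟩
    exact (hS.iff_of_colourChain (hC v hv d.fst hd hvst hst) (by rwa [hf]) he rfl).2 hSe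
  clear_value τ
  have hedge : ∀ d : H.Dart, f d.fst = s ∨ f d.fst = t →
      (S (ι.mapDart d.symm) ↔ S (ι.mapDart d)) := fun d hd =>
    hS.edge (ι.mapDart d) ((hf d.fst).symm ▸ hd)
  have hin : ∀ d : H.Dart, S (ι.mapDart d) → g d.fst = Equiv.swap s t (f d.fst) := fun d hd =>
    (hS.apply_of _ hd).trans (congrArg _ (hf _))
  have hout : ∀ d : H.Dart, ¬ S (ι.mapDart d) → g d.fst = f d.fst := fun d hd =>
    (hS.apply_of_not _ hd).trans (hf _)
  have hfix : ∀ d : H.Dart, ¬ (f d.fst = s ∨ f d.fst = t) →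
      Equiv.swap s t (f d.fst) = f d.fst ∧ g d.fst = f d.fst := by
    intro d hd
    rw [not_or] at hd
    have h1 := Equiv.swap_apply_of_ne_of_ne hd.1 hd.2
    refine ⟨h1, ?_⟩
    by_cases hSd : S (ι.mapDart d)
    · rw [hin d hSd, h1]
    · exact hout d hSd
  have hswap : P.IsSwap f g s t fun d => (d ∈ C.darts ∧ τ) ∨ (d ∉ C.darts ∧ S (ι.mapDart d)) := by
    refine ⟨hS.ne, fun d => ?_, fun d hd => ?_, fun d hd => ?_, fun d hd => ?_⟩
    · rw [hP.next_mem_iff]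
      refine or_congr_right (and_congr_right fun hd => ?_)
      rw [← h.face d hd, hS.face]
    · by_cases hdC : d ∈ C.darts
      · have h1 := hP.symm_notMem hdC
        have h2 := hτ d (C.dart_fst_mem_support_of_mem_darts hdC) hd
        have h3 := hedge d hd
        tauto
      · by_cases hdC' : d.symm ∈ C.darts
        · have h2 := hτ d (C.dart_snd_mem_support_of_mem_darts hdC') hd
          tauto
        · have h3 := hedge d hd
          tauto
    · rcases hd with ⟨hdC, h1⟩ | ⟨-, h1⟩
      · by_cases hst : f d.fst = s ∨ f d.fst = t
        · exact hin d ((hτ d (C.dart_fst_mem_support_of_mem_darts hdC) hst).2 h1)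
        · rw [(hfix d hst).1, (hfix d hst).2]
      · exact hin d h1
    · by_cases hst : f d.fst = s ∨ f d.fst = t
      · refine hout d fun h1 => hd ?_
        by_cases hdC : d ∈ C.darts
        · exact Or.inl ⟨hdC, (hτ d (C.dart_fst_mem_support_of_mem_darts hdC) hst).1 h1⟩
        · exact Or.inr ⟨hdC, h1⟩
      · exact (hfix d hst).2
  exact hswap.kempeEquiv hP.connected fun v =>
    hP.connected.exists_adj_of_dart (C.firstDart hP.isCycle.not_nil) v

/-- Every edge of the outer cycle lies on a triangle. -/
theorem IsSemiMaximal.exists_adj_adj (hP : P.IsSemiMaximal C) {d : H.Dart} (hd : d ∈ C.darts) :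
    ∃ z, H.Adj d.fst z ∧ H.Adj d.snd z := by
  refine ⟨_, ?_, (adj_next_snd (hP.inner _ (hP.symm_notMem hd))).symm⟩
  have := (P.next d.symm).adj
  rwa [P.next_fst] at this

variable {v₁ v₂ v₃ v₄ : V} {h₁₂ : H.Adj v₁ v₂} {h₂₃ : H.Adj v₂ v₃} {h₃₄ : H.Adj v₃ v₄}
  {h₄₁ : H.Adj v₄ v₁}

/-- Here w and z play the two inner vertices of the cap. Together v₁, v₂, w and z carry all four
colours, so v₁ and v₃ have a common neighbour in whichever other colour is asked for. The vertices
v₂ and v₄ are joined through v₁, or by the assumed chains if the other colour is missing on the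
cycle. -/
theorem colourChain_fourCycle {F : G.Coloring (Fin 4)} {ι : H →g G} {w z : W} {s t : Fin 4}
    (hb₁ : F (ι v₃) = F (ι v₁)) (hb₂ : F (ι v₄) = F (ι v₂)) (h₁w : G.Adj (ι v₁) w)
    (h₁z : G.Adj (ι v₁) z) (h₃w : G.Adj (ι v₃) w) (h₃z : G.Adj (ι v₃) z) (hwz : G.Adj w z)
    (h₂w : F (ι v₂) ≠ F w) (h₂z : F (ι v₂) ≠ F z)
    (hch : ∀ c, c ≠ F (ι v₁) → c ≠ F (ι v₂) → G.ColourChain F (F (ι v₂)) c (ι v₂) (ι v₄))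
    (hst : s ≠ t) {u v : V} (hu : u ∈ (fourCycle h₁₂ h₂₃ h₃₄ h₄₁).support)
    (hv : v ∈ (fourCycle h₁₂ h₂₃ h₃₄ h₄₁).support)
    (hus : F (ι u) = s ∨ F (ι u) = t) (hvs : F (ι v) = s ∨ F (ι v) = t) :
    G.ColourChain F s t (ι u) (ι v) := by
  have n1w := F.valid h₁w
  have n1z := F.valid h₁z
  have nwz := F.valid hwz
  have n12 := F.valid (ι.map_adj h₁₂)
  have hadj : ∀ {p q : W}, G.Adj p q → (F p = s ∨ F p = t) → (F q = s ∨ F q = t) →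
      G.ColourChain F s t p q := fun hpq hp hq => .single ⟨hpq, hp, hq⟩
  have hvia : ∀ {p q r : W}, G.Adj p q → G.Adj r q → (F p = s ∨ F p = t) → (F q = s ∨ F q = t) →
      (F r = s ∨ F r = t) → G.ColourChain F s t p r := fun hpq hrq hp hq hr =>
    (hadj hpq hp hq).trans (hadj hrq hr hq).symm
  have h13 : (F (ι v₁) = s ∨ F (ι v₁) = t) → G.ColourChain F s t (ι v₁) (ι v₃) := by
    intro h1
    have h3 := hb₁.symm ▸ h1
    have : (F (ι v₂) = s ∨ F (ι v₂) = t) ∨ (F w = s ∨ F w = t) ∨ (F z = s ∨ F z = t) := by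
      generalize F (ι v₁) = c₁ at *
      generalize F (ι v₂) = c₂ at *
      generalize F w = c₃ at *
      generalize F z = c₄ at *
      clear hch hadj hvia hus hvs h3 hb₁ hb₂
      revert c₁ c₂ c₃ c₄ s t
      decide
    rcases this with h | h | h
    · exact hvia (ι.map_adj h₁₂) (ι.map_adj h₂₃.symm) h1 h h3
    · exact hvia h₁w h₃w h1 h h3
    · exact hvia h₁z h₃z h1 h h3
  have h24 : (F (ι v₂) = s ∨ F (ι v₂) = t) → G.ColourChain F s t (ι v₂) (ι v₄) := by
    intro h2
    by_cases h1 : F (ι v₁) = s ∨ F (ι v₁) = t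
    · exact hvia (ι.map_adj h₁₂.symm) (ι.map_adj h₄₁) h2 h1 (hb₂.symm ▸ h2)
    · rw [not_or] at h1
      rcases h2 with h2 | h2
      · exact (hch t (Ne.symm h1.2) (h2 ▸ hst.symm)).congr fun x hx => h2 ▸ hx
      · exact (hch s (Ne.symm h1.1) (h2 ▸ hst)).congr fun x hx => (h2 ▸ hx).symm
  rw [mem_support_fourCycle] at hu hv
  rcases hu with rfl | rfl | rfl | rfl <;> rcases hv with rfl | rfl | rfl | rfl
  · exact .refl
  · exact hadj (ι.map_adj h₁₂) hus hvs
  · exact h13 hus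
  · exact hadj (ι.map_adj h₄₁.symm) hus hvs
  · exact hadj (ι.map_adj h₁₂.symm) hus hvs
  · exact .refl
  · exact hadj (ι.map_adj h₂₃) hus hvs
  · exact h24 hus
  · exact (h13 hvs).symm
  · exact hadj (ι.map_adj h₂₃.symm) hus hvs
  · exact .refl
  · exact hadj (ι.map_adj h₃₄) hus hvs
  · exact hadj (ι.map_adj h₄₁) hus hvs
  · exact (h24 hvs).symm
  · exact hadj (ι.map_adj h₃₄.symm) hus hvs
  · exact .refl

end PlaneEmbedding

end SimpleGraph

/-! ### The capped graph, its colouring and its drawing. -/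

namespace SimpleGraph

variable {V : Type u} {H : SimpleGraph V}

/-- The positions of the vertices of the cap on the outside of a 4-cycle. -/
def capMap (v₁ v₂ v₃ v₄ : V) (i : ULift.{u} (Fin 6)) : V ⊕ ULift.{u} (Fin 2) :=
  ![.inl v₁, .inl v₂, .inl v₃, .inl v₄, .inr ⟨0⟩, .inr ⟨1⟩] i.down

theorem capMap_injective {v₁ v₂ v₃ v₄ : V} (h₁₂ : v₁ ≠ v₂) (h₁₃ : v₁ ≠ v₃) (h₁₄ : v₁ ≠ v₄)
    (h₂₃ : v₂ ≠ v₃) (h₂₄ : v₂ ≠ v₄) (h₃₄ : v₃ ≠ v₄) :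
    Function.Injective (capMap v₁ v₂ v₃ v₄) := by
  rintro ⟨i⟩ ⟨j⟩ hij
  fin_cases i <;> fin_cases j <;> simp_all [capMap]

theorem capMap_eq_inl {v₁ v₂ v₃ v₄ v : V} {i : Fin 6} (h : capMap v₁ v₂ v₃ v₄ ⟨i⟩ = .inl v) :
    (i = 0 ∧ v = v₁) ∨ (i = 1 ∧ v = v₂) ∨ (i = 2 ∧ v = v₃) ∨ (i = 3 ∧ v = v₄) := by
  fin_cases i <;> simp_all [capMap]

/-- A graph together with a cap on the outside of a 4-cycle. -/
def capped (H : SimpleGraph V) {v₁ v₂ v₃ v₄ : V}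
    (hinj : Function.Injective (capMap v₁ v₂ v₃ v₄)) : SimpleGraph (V ⊕ ULift.{u} (Fin 2)) where
  Adj a b := (∃ x y, H.Adj x y ∧ .inl x = a ∧ .inl y = b) ∨
    ∃ i j, cap.{u}.Adj i j ∧ capMap v₁ v₂ v₃ v₄ i = a ∧ capMap v₁ v₂ v₃ v₄ j = b
  symm := ⟨by
    rintro a b (⟨x, y, h, hx, hy⟩ | ⟨x, y, h, hx, hy⟩)
    · exact Or.inl ⟨y, x, h.symm, hy, hx⟩
    · exact Or.inr ⟨y, x, h.symm, hy, hx⟩⟩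
  loopless := ⟨by
    rintro a (⟨x, y, h, hx, hy⟩ | ⟨x, y, h, hx, hy⟩)
    · exact h.ne (Sum.inl_injective (hx.trans hy.symm))
    · exact h.ne (hinj (hx.trans hy.symm))⟩

namespace capped

variable {v₁ v₂ v₃ v₄ : V}

/-- The embedding of the graph. -/
def inl (H : SimpleGraph V) (hinj : Function.Injective (capMap v₁ v₂ v₃ v₄))
    : H →g capped H hinj where
  toFun := Sum.inl
  map_rel' h := Or.inl ⟨_, _, h, rfl, rfl⟩

/-- The embedding of the cap. -/
def inr (H : SimpleGraph V) (hinj : Function.Injective (capMap v₁ v₂ v₃ v₄)) : cap.{u}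
    →g capped H hinj where
  toFun := capMap v₁ v₂ v₃ v₄
  map_rel' h := Or.inr ⟨_, _, h, rfl, rfl⟩

theorem exists_eq (H : SimpleGraph V) (hinj : Function.Injective (capMap v₁ v₂ v₃ v₄))
    (w : V ⊕ ULift.{u} (Fin 2)) :
    (∃ v, inl H hinj v = w) ∨ inr H hinj ⟨4⟩ = w ∨ inr H hinj ⟨5⟩ = w := by
  rcases w with v | ⟨i⟩
  · exact Or.inl ⟨v, rfl⟩
  · fin_cases i
    · exact Or.inr (Or.inl rfl)
    · exact Or.inr (Or.inr rfl)

theorem connected (hinj : Function.Injective (capMap v₁ v₂ v₃ v₄)) (hH : H.Connected) :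
    (capped H hinj).Connected := by
  rw [connected_iff_exists_forall_reachable]
  refine ⟨inl H hinj v₁, fun w => ?_⟩
  rcases exists_eq H hinj w with ⟨v, rfl⟩ | rfl | rfl
  · exact (hH.preconnected _ _).map _
  · exact (cap.connected.preconnected ⟨0⟩ ⟨4⟩).map (inr H hinj)
  · exact (cap.connected.preconnected ⟨0⟩ ⟨5⟩).map (inr H hinj)

/-- The two new vertices receive the two colours missing on the cycle. -/
theorem exists_coloring (hinj : Function.Injective (capMap v₁ v₂ v₃ v₄)) (f : H.Coloring (Fin 4))
    (h₁₂ : f v₁ ≠ f v₂) (h₃ : f v₃ = f v₁) (h₄ : f v₄ = f v₂) :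
    ∃ F : (capped H hinj).Coloring (Fin 4), ∀ v, F (inl H hinj v) = f v := by
  obtain ⟨c, hc⟩ := exists_fourth_colour (f v₁) (f v₂) (f v₂)
  obtain ⟨d, hd⟩ := exists_fourth_colour (f v₁) (f v₂) c
  have hF : ∀ i : Fin 6, (Sum.elim f (fun j => ![c, d] j.down) : V ⊕ ULift.{u} (Fin 2) → Fin 4)
      (capMap v₁ v₂ v₃ v₄ ⟨i⟩) = ![f v₁, f v₂, f v₁, f v₂, c, d] i := by
    intro i
    fin_cases i <;> simp [capMap, h₃, h₄]
  refine ⟨Coloring.mk (Sum.elim f fun j => ![c, d] j.down) ?_, fun _ => rfl⟩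
  rintro _ _ (⟨x, y, h, rfl, rfl⟩ | ⟨⟨i⟩, ⟨j⟩, h, rfl, rfl⟩)
  · exact f.valid h
  · rw [hF, hF]
    have hij : capAdj i j := h
    clear hF h
    generalize f v₁ = a at *
    generalize f v₂ = b at *
    fin_cases i <;> fin_cases j <;> simp_all [capAdj] <;> grind

end capped

namespace PlaneEmbedding

variable {P : H.PlaneEmbedding} {v₁ v₂ v₃ v₄ : V} {h₁₂ : H.Adj v₁ v₂} {h₂₃ : H.Adj v₂ v₃}
  {h₃₄ : H.Adj v₃ v₄} {h₄₁ : H.Adj v₄ v₁}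

/-- A cap can be glued to a semi-maximal plane graph along its outer 4-cycle. -/
theorem IsSemiMaximal.exists_isGluing_cap [Finite V]
    (hP : P.IsSemiMaximal (fourCycle h₁₂ h₂₃ h₃₄ h₄₁))
    (hinj : Function.Injective (capMap v₁ v₂ v₃ v₄)) :
    ∃ Q : (capped H hinj).PlaneEmbedding,
      IsGluing P cap.planeEmbedding.{u} Q (fourCycle h₁₂ h₂₃ h₃₄ h₄₁)
        (fourCycle cap.adj₀₃.{u} cap.adj₃₂.{u} cap.adj₂₁.{u} cap.adj₁₀.{u})
        (capped.inl H hinj) (capped.inr H hinj) := by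
  have hI := hP.isFourFace
  have hι : Function.Injective (capped.inl H hinj) := Sum.inl_injective
  have hdisj : ∀ (d : H.Dart) (d' : cap.{u}.Dart),
      (capped.inl H hinj).mapDart d = (capped.inr H hinj).mapDart d' →
      (d ∈ (fourCycle h₁₂ h₂₃ h₃₄ h₄₁).darts ↔
        d' ∉ (fourCycle cap.adj₀₃.{u} cap.adj₃₂.{u} cap.adj₂₁.{u} cap.adj₁₀.{u}).darts) := by
    rintro ⟨⟨x, y⟩, hxy⟩ ⟨⟨⟨i⟩, ⟨j⟩⟩, hij⟩ h
    have hx := capMap_eq_inl (congrArg (fun d => d.fst) h).symm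
    have hy := capMap_eq_inl (congrArg (fun d => d.snd) h).symm
    have hij' : capAdj i j := hij
    clear h
    have n1 := hI.ne₁₃
    have n2 := hI.ne₂₄
    have n3 := h₁₂.ne
    have n4 := h₂₃.ne
    have n5 := h₃₄.ne
    have n6 := h₄₁.ne
    have n1' := n1.symm
    have n2' := n2.symm
    have n3' := n3.symm
    have n4' := n4.symm
    have n5' := n5.symm
    have n6' := n6.symm
    rcases hx with ⟨rfl, rfl⟩ | ⟨rfl, rfl⟩ | ⟨rfl, rfl⟩ | ⟨rfl, rfl⟩ <;>
    rcases hy with ⟨rfl, rfl⟩ | ⟨rfl, rfl⟩ | ⟨rfl, rfl⟩ | ⟨rfl, rfl⟩ <;>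
    first
    | exact absurd hij' (by decide)
    | simp [mem_darts_fourCycle, Dart.ext_iff, *]
  have hin : ∀ d ∈ (fourCycle h₁₂ h₂₃ h₃₄ h₄₁).darts, ∃ d',
      (capped.inl H hinj).mapDart d = (capped.inr H hinj).mapDart d' := by
    intro d hd
    rcases mem_darts_fourCycle.1 hd with rfl | rfl | rfl | rfl
    · exact ⟨⟨(⟨0⟩, ⟨1⟩), cap.adj₁₀.{u}.symm⟩, rfl⟩
    · exact ⟨⟨(⟨1⟩, ⟨2⟩), cap.adj₂₁.{u}.symm⟩, rfl⟩
    · exact ⟨⟨(⟨2⟩, ⟨3⟩), cap.adj₃₂.{u}.symm⟩, rfl⟩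
    · exact ⟨⟨(⟨3⟩, ⟨0⟩), cap.adj₀₃.{u}.symm⟩, rfl⟩
  have hshare : ∀ v w, capped.inl H hinj v = capped.inr H hinj w →
      v ∈ (fourCycle h₁₂ h₂₃ h₃₄ h₄₁).support := by
    intro v w h
    rw [mem_support_fourCycle]
    have := capMap_eq_inl h.symm
    tauto
  have hinter : ∀ (d : H.Dart) (d' : cap.{u}.Dart),
      (capped.inl H hinj).mapDart d = (capped.inr H hinj).mapDart d' →
      d ∈ (fourCycle h₁₂ h₂₃ h₃₄ h₄₁).darts ∨ d.symm ∈ (fourCycle h₁₂ h₂₃ h₃₄ h₄₁).darts := by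
    intro d d' h
    by_cases hd' : d' ∈ (fourCycle cap.adj₀₃.{u} cap.adj₃₂.{u} cap.adj₂₁.{u} cap.adj₁₀.{u}).darts
    · refine Or.inr ((hdisj d.symm d'.symm ?_).2 (cap.isSemiMaximal.symm_notMem hd'))
      rw [Hom.mapDart_symm, h, Hom.mapDart_symm]
    · exact Or.inl ((hdisj d d' h).2 hd')
  obtain ⟨Q, hQ, hQ'⟩ := exists_planeEmbedding_of_cover hP cap.isSemiMaximal.{u} hι
    (show Function.Injective (capped.inr H hinj) from hinj) (capped.connected hinj hP.connected)
    (by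
      rintro ⟨_, ⟨x, y, h, hx, hy⟩ | ⟨i, j, h, hi, hj⟩⟩
      · exact Or.inl ⟨⟨(x, y), h⟩, Dart.ext _ _ (Prod.ext hx.symm hy.symm)⟩
      · exact Or.inr ⟨⟨(i, j), h⟩, Dart.ext _ _ (Prod.ext hi.symm hj.symm)⟩) hdisj hin
    (by
      intro d hd
      rcases mem_darts_fourCycle.1 hd with rfl | rfl | rfl | rfl
      · exact ⟨⟨(v₁, v₄), h₄₁.symm⟩, rfl⟩
      · exact ⟨⟨(v₄, v₃), h₃₄.symm⟩, rfl⟩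
      · exact ⟨⟨(v₃, v₂), h₂₃.symm⟩, rfl⟩
      · exact ⟨⟨(v₂, v₁), h₁₂.symm⟩, rfl⟩) hshare
    (by simp [Nat.card_sum])
  refine ⟨Q, hι, hinj, ?_, ?_, ?_, hQ, hQ'⟩
  · refine Subgraph.ext (Set.eq_univ_of_forall fun w => ?_) ?_
    · rcases capped.exists_eq H hinj w with ⟨v, rfl⟩ | rfl | rfl
      · exact Or.inl ⟨v, trivial, rfl⟩
      · exact Or.inr ⟨_, trivial, rfl⟩
      · exact Or.inr ⟨_, trivial, rfl⟩
    · rfl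
  · refine Subgraph.ext ?_ ?_
    · ext w
      rw [Walk.mem_verts_toSubgraph, Walk.support_map]
      constructor
      · rintro ⟨⟨v, -, rfl⟩, ⟨i, -, hi⟩⟩
        exact List.mem_map_of_mem (hshare v i hi.symm)
      · intro hw
        obtain ⟨v, hv, rfl⟩ := List.mem_map.1 hw
        refine ⟨⟨v, trivial, rfl⟩, ?_⟩
        rcases mem_support_fourCycle.1 hv with rfl | rfl | rfl | rfl
        exacts [⟨⟨0⟩, trivial, rfl⟩, ⟨⟨1⟩, trivial, rfl⟩, ⟨⟨2⟩, trivial, rfl⟩, ⟨⟨3⟩, trivial, rfl⟩]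
    · ext a b
      constructor
      · rintro ⟨⟨x, y, h, rfl, rfl⟩, ⟨i, j, h', hi, hj⟩⟩
        exact (Walk.toSubgraph_map_adj hι _ ⟨(x, y), h⟩).2
          (hinter _ ⟨(i, j), h'⟩ (Dart.ext _ _ (Prod.ext hi.symm hj.symm)))
      · intro h
        rw [Walk.adj_toSubgraph_iff_mem_edges] at h
        obtain ⟨e, he, hea⟩ := List.mem_map.1 h
        rw [Walk.darts_map] at he
        obtain ⟨d, hd, rfl⟩ := List.mem_map.1 he
        obtain ⟨d', hd'⟩ := hin d hd
        rcases (dart_edge_eq_mk'_iff' (d := ((capped.inl H hinj).mapDart d))).1 hea with ⟨rfl, rfl⟩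
            | ⟨rfl, rfl⟩
        · exact ⟨⟨_, _, d.adj, rfl, rfl⟩, ⟨_, _, d'.adj, congrArg (fun e => e.fst) hd'.symm,
            congrArg (fun e => e.snd) hd'.symm⟩⟩
        · exact ⟨⟨_, _, d.adj.symm, rfl, rfl⟩, ⟨_, _, d'.adj.symm,
            congrArg (fun e => e.snd) hd'.symm, congrArg (fun e => e.fst) hd'.symm⟩⟩
  -- The cap traverses the common cycle in the reverse order.
  · rw [← Walk.toSubgraph_reverse]
    rfl

end PlaneEmbedding

end SimpleGraph

/-! ### Sufficiency: the capped graph is a UBCMPG. -/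

namespace SimpleGraph

variable {V V₁ W : Type u} {H : SimpleGraph V} {H₁ : SimpleGraph V₁} {G : SimpleGraph W}

theorem four_le_ncard_neighborSet [Finite W] {w : W} {a : Fin 4 → W} (ha : Function.Injective a)
    (h : ∀ i, G.Adj w (a i)) : 4 ≤ (G.neighborSet w).ncard := by
  have h1 : (Set.range a).ncard = 4 := by
    rw [← Set.image_univ, Set.ncard_image_of_injective _ ha, Set.ncard_univ,
        Nat.card_eq_fintype_card,
      Fintype.card_fin]
  rw [← h1]
  exact Set.ncard_le_ncard (Set.range_subset_iff.2 h)

theorem four_le_ncard_neighborSet_of_adj [Finite W] {w a b c d : W} (ha : G.Adj w a)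
    (hb : G.Adj w b) (hc : G.Adj w c) (hd : G.Adj w d) (hab : a ≠ b) (hac : a ≠ c) (had : a ≠ d)
    (hbc : b ≠ c) (hbd : b ≠ d) (hcd : c ≠ d) : 4 ≤ (G.neighborSet w).ncard := by
  refine four_le_ncard_neighborSet (a := ![a, b, c, d]) ?_ ?_
  · intro i j hij
    fin_cases i <;> fin_cases j <;> simp_all
  · intro i
    fin_cases i <;> assumption

theorem ncard_neighborSet_le_of_injective [Finite W] {ι : H →g G} (hι : Function.Injective ι)
    (v : V) :
    (H.neighborSet v).ncard ≤ (G.neighborSet (ι v)).ncard := by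
  rw [← Set.ncard_image_of_injective _ hι]
  refine Set.ncard_le_ncard ?_
  rintro _ ⟨w, hw, rfl⟩
  exact ι.map_adj hw

namespace PlaneEmbedding

variable {P : H.PlaneEmbedding} {v₁ v₂ v₃ v₄ : V} {h₁₂ : H.Adj v₁ v₂} {h₂₃ : H.Adj v₂ v₃}
  {h₃₄ : H.Adj v₃ v₄} {h₄₁ : H.Adj v₄ v₁}

/-- A cycle vertex has its two cycle neighbours, a new vertex, and the apex of the inner triangle on
one of its cycle edges. The apex is not the other cycle neighbour, as the two cycle neighbours share
a colour and the apex is adjacent to one of them. -/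
theorem capped_four_le_ncard_neighborSet [Finite V]
    (hP : P.IsSemiMaximal (fourCycle h₁₂ h₂₃ h₃₄ h₄₁))
    (hinj : Function.Injective (capMap v₁ v₂ v₃ v₄))
    (hδ : ∀ v, v ∉ (fourCycle h₁₂ h₂₃ h₃₄ h₄₁).support → 4 ≤ (H.neighborSet v).ncard)
    (f : H.Coloring (Fin 4)) (hf₃ : f v₃ = f v₁) (hf₄ : f v₄ = f v₂) (w : V ⊕ ULift.{u} (Fin 2)) :
    4 ≤ ((capped H hinj).neighborSet w).ncard := by
  have hι : Function.Injective (capped.inl H hinj) := Sum.inl_injective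
  have hadj : ∀ (i j : Fin 6), capAdj i j →
      (capped H hinj).Adj (capped.inr H hinj ⟨i⟩) (capped.inr H hinj ⟨j⟩) := fun i j h =>
    (capped.inr H hinj).map_adj h
  have hne : ∀ {i j : Fin 6}, i ≠ j → capped.inr H hinj ⟨i⟩ ≠ capped.inr H hinj ⟨j⟩ :=
    fun h h' => h (congrArg ULift.down (hinj h'))
  have hcyc : ∀ {a b c : V} (hab : H.Adj a b) (_ : H.Adj c a) (i : Fin 2), c ≠ b → f c = f b →
      (⟨(a, b), hab⟩ : H.Dart) ∈ (fourCycle h₁₂ h₂₃ h₃₄ h₄₁).darts →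
      (capped H hinj).Adj (.inl a) (.inr ⟨i⟩) →
      4 ≤ ((capped H hinj).neighborSet (.inl a)).ncard := by
    intro a b c hab hca i hcb hfc hd hx
    obtain ⟨z, haz, hbz⟩ := hP.exists_adj_adj hd
    refine four_le_ncard_neighborSet_of_adj ((capped.inl H hinj).map_adj hab)
      ((capped.inl H hinj).map_adj hca.symm) ((capped.inl H hinj).map_adj haz) hx
      (hι.ne hcb.symm) (hι.ne hbz.ne) (by rintro ⟨⟩) (hι.ne ?_) (by rintro ⟨⟩) (by rintro ⟨⟩)
    rintro rfl
    exact f.valid hbz hfc.symm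
  have hI := hP.isFourFace
  rcases capped.exists_eq H hinj w with ⟨v, rfl⟩ | rfl | rfl
  · by_cases hv : v ∈ (fourCycle h₁₂ h₂₃ h₃₄ h₄₁).support
    · rcases mem_support_fourCycle.1 hv with rfl | rfl | rfl | rfl
      · exact hcyc h₁₂ h₄₁ 0 hI.ne₂₄.symm hf₄ (by simp [mem_darts_fourCycle]) (hadj 0 4 rfl)
      · exact hcyc h₂₃ h₁₂ 0 hI.ne₁₃ hf₃.symm (by simp [mem_darts_fourCycle]) (hadj 1 4 rfl)
      · exact hcyc h₃₄ h₂₃ 0 hI.ne₂₄ hf₄.symm (by simp [mem_darts_fourCycle]) (hadj 2 4 rfl)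
      · exact hcyc h₄₁ h₃₄ 1 hI.ne₁₃.symm hf₃ (by simp [mem_darts_fourCycle]) (hadj 3 5 rfl)
    · exact (hδ v hv).trans (ncard_neighborSet_le_of_injective hι v)
  · exact four_le_ncard_neighborSet_of_adj (hadj 4 0 rfl) (hadj 4 1 rfl) (hadj 4 2 rfl)
        (hadj 4 5 rfl)
      (hne (by decide)) (hne (by decide)) (hne (by decide)) (hne (by decide)) (hne (by decide))
      (hne (by decide))
  · exact four_le_ncard_neighborSet_of_adj (hadj 5 0 rfl) (hadj 5 2 rfl) (hadj 5 3 rfl)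
        (hadj 5 4 rfl)
      (hne (by decide)) (hne (by decide)) (hne (by decide)) (hne (by decide)) (hne (by decide))
      (hne (by decide))

/-- If the cycle stays bichromatic with `v₂` and `v₄` joined by chains in both other colours, the
cap makes the graph into a UBCMPG. -/
theorem IsSemiMaximal.isBaseModule_of_colourChain [Finite V]
    (hP : P.IsSemiMaximal (fourCycle h₁₂ h₂₃ h₃₄ h₄₁)) (hχ : H.chromaticNumber = 4)
    (hδ : ∀ v, v ∉ (fourCycle h₁₂ h₂₃ h₃₄ h₄₁).support → 4 ≤ (H.neighborSet v).ncard)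
    (f₀ : H.Coloring (Fin 4))
    (hf₀ : ∀ f : H.Coloring (Fin 4), P.KempeEquiv f₀ f → (f v₃ = f v₁ ∧ f v₄ = f v₂) ∧
      ∀ c, c ≠ f v₁ → c ≠ f v₂ → H.ColourChain f (f v₂) c v₂ v₄) :
    P.IsBaseModule (fourCycle h₁₂ h₂₃ h₃₄ h₄₁) := by
  have hI := hP.isFourFace
  have hinj : Function.Injective (capMap v₁ v₂ v₃ v₄) :=
    capMap_injective h₁₂.ne hI.ne₁₃ h₄₁.ne.symm h₂₃.ne hI.ne₂₄ h₃₄.ne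
  have hι : Function.Injective (capped.inl H hinj) := Sum.inl_injective
  obtain ⟨Q, hQ⟩ := hP.exists_isGluing_cap hinj
  obtain ⟨⟨hb₃, hb₄⟩, -⟩ := hf₀ f₀ .refl
  have hdeg := capped_four_le_ncard_neighborSet hP hinj hδ f₀ hb₃ hb₄
  obtain ⟨F₀, hF₀⟩ := capped.exists_coloring hinj f₀ (f₀.valid h₁₂) hb₃ hb₄
  -- Every colouring Kempe equivalent to `F₀` restricts to one Kempe equivalent to `f₀`, because the
  -- hypothesis on chains holds throughout that class and lets each swap be restricted.
  have hkey : ∀ F, Q.KempeEquiv F₀ F →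
      ∃ f : H.Coloring (Fin 4), P.KempeEquiv f₀ f ∧ ∀ v, F (capped.inl H hinj v) = f v := by
    intro F hF
    refine hF.induction (p := fun F => ∃ f : H.Coloring (Fin 4), P.KempeEquiv f₀ f ∧
      ∀ v, F (capped.inl H hinj v) = f v) ⟨f₀, .refl, hF₀⟩ ?_ ?_
    · rintro F F' s t S ⟨f, hf, hFf⟩ hS
      obtain ⟨⟨h₃, h₄⟩, hch⟩ := hf₀ f hf
      obtain ⟨g, hg, hFg⟩ := hQ.exists_kempeEquiv_of_isSwap hP hFf hS fun u hu v hv hus hvs => by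
        have hcap : ∀ i j : Fin 6, capAdj i j →
            (capped H hinj).Adj (capped.inr H hinj ⟨i⟩) (capped.inr H hinj ⟨j⟩) := fun i j h =>
          (capped.inr H hinj).map_adj h
        have h₄' : F (capped.inl H hinj v₄) = F (capped.inl H hinj v₂) := by rw [hFf, hFf, h₄]
        refine colourChain_fourCycle (h₁₂ := h₁₂) (h₂₃ := h₂₃) (h₃₄ := h₃₄) (h₄₁ := h₄₁)
          (by rw [hFf, hFf, h₃]) h₄' (hcap 0 4 rfl) (hcap 0 5 rfl) (hcap 2 4 rfl) (hcap 2 5 rfl)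
          (hcap 4 5 rfl) (F.valid (hcap 1 4 rfl)) (h₄' ▸ F.valid (hcap 3 5 rfl)) ?_ hS.ne hu hv
          (by rwa [hFf]) (by rwa [hFf])
        intro c hc₁ hc₂
        rw [hFf] at hc₁ hc₂ ⊢
        refine ColourChain.map (capped.inl H hinj) ?_
        simpa only [hFf] using hch c hc₁ hc₂
      exact ⟨g, hf.trans hg, hFg⟩
    · rintro F F' π ⟨f, hf, hFf⟩ hπ
      refine ⟨f.permute π, hf.tail (Or.inr ⟨π, fun _ => rfl⟩), fun v => ?_⟩
      rw [hπ, hFf]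
      rfl
  have hG := capped.connected hinj hP.connected
  refine ⟨hP, _, inferInstance, cap, cap.planeEmbedding, _, _, _, inferInstance, _, Q, _, _,
    cap.isSemiMaximal, hQ, ?_⟩
  refine ⟨Q.isMaximalPlanar hG (hQ.next_next_next hP cap.isSemiMaximal)
    fun w => le_trans (by norm_num) (hdeg w), le_antisymm ?_ ?_, hdeg, ?_, F₀, ?_, ?_⟩
  · exact Colorable.chromaticNumber_le (n := 4) ⟨F₀⟩
  · rw [← hχ]
    exact chromaticNumber_mono_of_hom (capped.inl H hinj)
  · exact isCycle_fourCycle (hι.ne hI.ne₁₃) (hι.ne hI.ne₂₄)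
  · rw [isBichromatic_map_fourCycle_iff, hF₀, hF₀, hF₀, hF₀]
    exact ⟨hb₃, hb₄⟩
  · intro F hF
    obtain ⟨f, hf, hFf⟩ := hkey F hF
    rw [isBichromatic_map_fourCycle_iff, hFf, hFf, hFf, hFf]
    exact (hf₀ f hf).1

/-- A quarter turn of the labels exchanges the roles of {v₁, v₃} and {v₂, v₄}. -/
theorem IsSemiMaximal.rotate (hP : P.IsSemiMaximal (fourCycle h₁₂ h₂₃ h₃₄ h₄₁)) :
    P.IsSemiMaximal (fourCycle h₂₃ h₃₄ h₄₁ h₁₂) := by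
  have hI := hP.isFourFace
  have hd : ∀ d : H.Dart, d ∈ (fourCycle h₂₃ h₃₄ h₄₁ h₁₂).darts ↔
      d ∈ (fourCycle h₁₂ h₂₃ h₃₄ h₄₁).darts := fun d => by
    rw [mem_darts_fourCycle, mem_darts_fourCycle]
    tauto
  refine ⟨hP.connected, isCycle_fourCycle hI.ne₂₄ hI.ne₁₃.symm, le_rfl, fun d h => ?_,
      fun d h => ?_⟩
  · exact (hd _).2 (hP.outer d ((hd d).1 h))
  · exact hP.inner d (mt (hd d).2 h)

theorem toSubgraph_fourCycle_rotate : (fourCycle h₂₃ h₃₄ h₄₁ h₁₂).toSubgraph =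
    (fourCycle h₁₂ h₂₃ h₃₄ h₄₁).toSubgraph := by
  refine Subgraph.ext ?_ ?_
  · ext v
    rw [Walk.mem_verts_toSubgraph, Walk.mem_verts_toSubgraph, mem_support_fourCycle,
      mem_support_fourCycle]
    tauto
  · ext a b
    rw [Walk.adj_toSubgraph_iff_mem_edges, Walk.adj_toSubgraph_iff_mem_edges]
    simp only [fourCycle, Walk.edges_cons, Walk.edges_nil, List.mem_cons, List.not_mem_nil,
        or_false]
    tauto

theorem IsBaseModule.rotate (hb : P.IsBaseModule (fourCycle h₂₃ h₃₄ h₄₁ h₁₂)) :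
    P.IsBaseModule (fourCycle h₁₂ h₂₃ h₃₄ h₄₁) := by
  obtain ⟨hP, V₁, i₁, H₁, P₁, x₁, C₁, W, i₂, G, Q, ι, ι₁, hP₁, hgl, hub⟩ := hb
  -- Three more quarter turns return to the original labels.
  have hP' := hP.rotate.rotate.rotate
  have hd : ∀ d : H.Dart, d ∈ (fourCycle h₂₃ h₃₄ h₄₁ h₁₂).darts ↔
      d ∈ (fourCycle h₁₂ h₂₃ h₃₄ h₄₁).darts := fun d => by
    rw [mem_darts_fourCycle, mem_darts_fourCycle]
    tauto
  have hsub : ((fourCycle h₂₃ h₃₄ h₄₁ h₁₂).map ι).toSubgraph =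
      ((fourCycle h₁₂ h₂₃ h₃₄ h₄₁).map ι).toSubgraph :=
    toSubgraph_fourCycle_rotate (h₁₂ := ι.map_adj h₁₂) (h₂₃ := ι.map_adj h₂₃) (h₃₄ := ι.map_adj h₃₄)
      (h₄₁ := ι.map_adj h₄₁)
  have hI := hP'.isFourFace
  have hbi : ∀ F : G.Coloring (Fin 4), IsBichromatic F ((fourCycle h₂₃ h₃₄ h₄₁ h₁₂).map ι) →
      IsBichromatic F ((fourCycle h₁₂ h₂₃ h₃₄ h₄₁).map ι) := fun F h => by
    rw [isBichromatic_map_fourCycle_iff] at h ⊢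
    exact ⟨h.2.symm, h.1⟩
  refine ⟨hP', V₁, i₁, H₁, P₁, x₁, C₁, W, i₂, G, Q, ι, ι₁, hP₁, ?_, ?_⟩
  · exact ⟨hgl.injective, hgl.injective₁, hgl.union, hgl.inter.trans hsub, hgl.cycle.trans hsub,
      fun d h => hgl.face d (mt (hd d).1 h), hgl.face₁⟩
  · obtain ⟨F, hF, hFF⟩ := hub.unchanged
    exact ⟨hub.isMaximalPlanar, hub.chromaticNumber_eq, hub.four_le_degree,
      isCycle_fourCycle (hgl.injective.ne hI.ne₁₃) (hgl.injective.ne hI.ne₂₄), F, hbi F hF,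
      fun F' hF' => hbi F' (hFF F' hF')⟩

/-- A shared-endpoint-colouring on `{v₂, v₄}` has chains joining `v₂` and `v₄`. -/
theorem IsSemiMaximal.colourChain_of_isSharedEndpoint₂₄ [Finite V]
    (hP : P.IsSemiMaximal (fourCycle h₁₂ h₂₃ h₃₄ h₄₁)) {f : H.Coloring (Fin 4)}
    (hf : IsSharedEndpoint₂₄ f h₁₂ h₂₃ h₃₄ h₄₁) {c : Fin 4} (hc₁ : c ≠ f v₁) (hc₂ : c ≠ f v₂) :
    H.ColourChain f (f v₂) c v₂ v₄ := by
  obtain ⟨h₃, -⟩ := (isBichromatic_fourCycle_iff _ _ _ _).1 hf.1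
  obtain ⟨d, hd₁, hd₂, hdc⟩ := exists_fourth_colour (f v₁) (f v₂) c
  have h12 := f.valid h₁₂
  -- The chain in colour c is dual to the absence of a chain from v₁ to v₃ in the other missing
  -- colour d.
  refine hP.colourChain_of_not f (b := d) h12 (fun x => ?_) hc₁ rfl rfl h₃
    (mt hasEndpointPath_iff.2 (hf.2 d hd₁ hd₂))
  revert hc₁ hc₂ hd₁ hd₂ hdc h12
  generalize f v₁ = a
  generalize f v₂ = b
  clear hf h₃
  revert a b c d x
  decide

end PlaneEmbedding

end SimpleGraph

theorem mainTheorem5 {V : Type u} [Finite V] (G : SimpleGraph V) (P : G.PlaneEmbedding)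
    {v₁ v₂ v₃ v₄ : V} (h₁₂ : G.Adj v₁ v₂) (h₂₃ : G.Adj v₂ v₃) (h₃₄ : G.Adj v₃ v₄)
    (h₄₁ : G.Adj v₄ v₁)
    (hG : P.IsSemiMaximal (SimpleGraph.fourCycle h₁₂ h₂₃ h₃₄ h₄₁))
    (hχ : G.chromaticNumber = 4)
    (hδ : ∀ v, v ∉ (SimpleGraph.fourCycle h₁₂ h₂₃ h₃₄ h₄₁).support →
      4 ≤ (G.neighborSet v).ncard)
    (_hF : ∃ f : G.Coloring (Fin 4),
      SimpleGraph.IsBichromatic f (SimpleGraph.fourCycle h₁₂ h₂₃ h₃₄ h₄₁)) :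
    P.IsBaseModule (SimpleGraph.fourCycle h₁₂ h₂₃ h₃₄ h₄₁) ↔
      ∃ f₀ : G.Coloring (Fin 4),
        SimpleGraph.IsBichromatic f₀ (SimpleGraph.fourCycle h₁₂ h₂₃ h₃₄ h₄₁) ∧
        ((∀ f : G.Coloring (Fin 4), P.KempeEquiv f₀ f →
            SimpleGraph.IsSharedEndpoint₂₄ f h₁₂ h₂₃ h₃₄ h₄₁) ∨
          (∀ f : G.Coloring (Fin 4), P.KempeEquiv f₀ f →
            SimpleGraph.IsSharedEndpoint₁₃ f h₁₂ h₂₃ h₃₄ h₄₁)) := by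
  refine ⟨SimpleGraph.PlaneEmbedding.IsBaseModule.exists_forall_isSharedEndpoint, ?_⟩
  rintro ⟨f₀, -, h | h⟩
  · exact hG.isBaseModule_of_colourChain hχ hδ f₀ fun f hf =>
      ⟨(SimpleGraph.isBichromatic_fourCycle_iff _ _ _ _).1 (h f hf).1, fun c hc₁ hc₂ =>
        hG.colourChain_of_isSharedEndpoint₂₄ (h f hf) hc₁ hc₂⟩
  -- Now v₁ and v₃ are the joined pair, so the cap is attached after a quarter turn, with its new
  -- vertices both adjacent to v₂ and v₄.
  · refine SimpleGraph.PlaneEmbedding.IsBaseModule.rotate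
      (hG.rotate.isBaseModule_of_colourChain hχ (fun v hv => hδ v ?_) f₀ fun f hf => ?_)
    · rw [SimpleGraph.PlaneEmbedding.mem_support_fourCycle] at hv ⊢
      tauto
    · obtain ⟨h₃, h₄⟩ := (SimpleGraph.isBichromatic_fourCycle_iff _ _ _ _).1 (h f hf).1
      refine ⟨⟨h₄, h₃.symm⟩, fun c hc₂ hc₃ => ?_⟩
      rw [h₃] at hc₃ ⊢
      exact (SimpleGraph.hasEndpointPath_iff.1 ((h f hf).2 c hc₃ hc₂)).symm
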